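/- **Theorem (the twisted hermitian Bott class).** Let $k$ be odd, let $R$ be a commutative ring in which $2k$ is invertible, and suppose that $R$ contains the $k$-th roots of unity, i.e. a root $\zeta$ of the cyclotomic polynomial $\Phi_k$ is given; put $\Omega_k=\mathbf Z[x]/(\Phi_k(x))$ and let $\omega$ be the class of $x$. A quadratic module is a finitely generated projective $R$-module $V$ with a nondegenerate quadratic form $q$; $V(n)$ is $V$ with the form $nq$, $V^k$ is the orthogonal sum of $k$ copies, and $C(V)$ is the Clifford algebra. Tensor products of Clifford algebras are $\mathbf Z/2$-graded, so that $C(V)\otimes C(V')=C(V\oplus V')$. For a Clifford algebra $A$, $K(A)$ is the cokernel of the restriction map $K(A\otimes C^{0,2})\to K(A\otimes C^{0,1})$ of Grothendieck groups of finitely generated projective modules; that is, the group generated by the classes of the $\mathbf Z/2$-graded $A$-modules that are finitely generated and projective, with the relations $[M\oplus N]=[M]+[N]$, and $[M]=0$ if $M$ has an involution of odd degree that anticommutes with the vectors generating $A$. The tensor product of modules defines products $K(A)\times K(B)\to K(A\otimes B)$, extended bilinearly to coefficients in $\Omega_k$. Let $V$ be a quadratic module and $W=V(-1)$. (1) The algebra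 $C(V)\otimes C(W)$ acts on $C(V)$, where $v\in V$ acts by $a\mapsto va$ and $w\in W$ by $a\mapsto(-1)^{\deg a}aw$; this identifies $C(V)\otimes C(W)$ with $\mathrm{End}_R(C(V))$, and $C(V)$ is a finitely generated projective $C(V)\otimes C(W)$-module. So $1\in K(R)\cong K(C(V)\otimes C(W))$ is the class $[C(V)]$. (2) The representation of $\mathbf Z/k$ in $O(W^k)$ by cyclic permutations lifts uniquely to $\mathrm{Spin}(W^k)$; let $t$ be the image of the generator. (3) Let $M=C(V)^{\otimes k}$ be the $k$-th graded tensor power, regarded as a graded $C(V(k))\otimes C(W^k)$-module through the diagonal $V(k)\to V^k$. Let $T$ be the action on $M$ of the generator of $\mathbf Z/k$, by cyclic permutation of the factors with the Koszul sign. Then $T'=t^{-1}T$ is an even automorphism of the $C(V(k))\otimes C(W^k)$-module $M$ with $T'^k=1$; $M$ is the direct sum of the eigenmodules $F_j=\ker(T'-\zeta^j)$, $0\le j<k$, and each $F_j$ is a finitely generated projective graded $C(V(k))\otimes C(W^k)$-module. Consequently the twisted hermitian Bott class $$\rho_k(V)=\sum_{j=0}^{k-1}[F_j]\otimes\omega^j\in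 K\bigl(C(V(k))\otimes C(W^k)\bigr)\otimes_{\mathbf Z}\Omega_k$$ is defined. (4) If $V_1$, $V_2$ are quadratic modules and $W_i=V_i(-1)$, then $$\rho_k(V_1\oplus V_2)=\rho_k(V_1)\cdot\rho_k(V_2)$$ under the identification of algebras $$C((V_1\oplus V_2)(k))\otimes C(W_1^k\oplus W_2^k)\cong\bigl[C(V_1(k))\otimes C(W_1^k)\bigr]\otimes\bigl[C(V_2(k))\otimes C(W_2^k)\bigr]$$ given by regrouping the orthogonal summands. -/

import Mathlib

/-
Graded modules over Clifford algebras and the twisted hermitian Bott class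

Throughout `R` is a commutative ring (with `2` invertible where needed). Tensor products of
Clifford algebras are `ℤ/2`-graded tensor products, and `C(Q₁) ⊗ C(Q₂)` is used in the form
`C(Q₁ ⊥ Q₂)`, to which it is canonically isomorphic (`CliffordAlgebra.prodEquiv`). So graded modules
over `C(V(k)) ⊗ C(W^k)` are graded modules over the Clifford algebra of `V(k) ⊥ W^k`, and so on.
-/

universe u

noncomputable section

namespace CliffordBott

open scoped TensorProduct

/-- A `ℤ/2`-graded (left) module over the Clifford algebra of a quadratic form `Q` on `U`, where `2`
is invertible. The grading is recorded by the involution `ε` that is `+1` on the even part and `-1`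
on the odd part, and the module structure by the action `c` of the vectors of `U`, which are odd
(`ε` anticommutes with them) and square to `Q`. The action of the whole Clifford algebra is
`GrMod.act`. -/
structure GrMod {R : Type u} [CommRing R] {U : Type u} [AddCommGroup U] [Module R U]
    (Q : QuadraticForm R U) : Type (u + 1) where
  carrier : Type u
  [addCommGroup : AddCommGroup carrier]
  [module : Module R carrier]
  /-- Clifford multiplication by vectors. -/
  c : U →ₗ[R] Module.End R carrier
  c_mul_self : ∀ x, c x * c x = algebraMap R (Module.End R carrier) (Q x)
  /-- The grading involution. -/
  ε : Module.End R carrier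
  ε_mul_self : ε * ε = 1
  ε_mul_c : ∀ x, ε * c x = -(c x * ε)

attribute [instance] GrMod.addCommGroup GrMod.module

namespace GrMod

section Basic

variable {R : Type u} [CommRing R] {U : Type u} [AddCommGroup U] [Module R U]
  {Q : QuadraticForm R U}

/-- The action of the Clifford algebra. -/
def act (M : GrMod Q) : CliffordAlgebra Q →ₐ[R] Module.End R M.carrier :=
  CliffordAlgebra.lift Q ⟨M.c, M.c_mul_self⟩

theorem act_ι (M : GrMod Q) (x : U) : M.act (CliffordAlgebra.ι Q x) = M.c x :=
  CliffordAlgebra.lift_ι_apply _ _ _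

/-- The module is finitely generated and projective over the Clifford algebra. -/
def IsFGProj (M : GrMod Q) : Prop :=
  letI : Module (CliffordAlgebra Q) M.carrier := Module.compHom M.carrier M.act.toRingHom
  Module.Finite (CliffordAlgebra Q) M.carrier ∧ Module.Projective (CliffordAlgebra Q) M.carrier

theorem ε_mul_act (M : GrMod Q) (a : CliffordAlgebra Q) :
    M.ε * M.act a = M.act (CliffordAlgebra.involute a) * M.ε := by
  induction a using CliffordAlgebra.induction with
  | algebraMap r => simp [Algebra.commutes]
  | ι x => rw [CliffordAlgebra.involute_ι, map_neg, act_ι, ε_mul_c, neg_mul]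
  | mul a b ha hb => rw [map_mul, map_mul, map_mul, ← mul_assoc, ha, mul_assoc, hb, mul_assoc]
  | add a b ha hb => rw [map_add, map_add, map_add, mul_add, add_mul, ha, hb]

/-- The graded submodule carried by an `R`-submodule stable under the action and the grading. -/
def restrict (M : GrMod Q) (S : Submodule R M.carrier) (hc : ∀ x, ∀ m ∈ S, M.c x m ∈ S)
    (hε : ∀ m ∈ S, M.ε m ∈ S) : GrMod Q where
  carrier := S
  c :=
    { toFun := fun x => (M.c x).restrict (hc x)
      map_add' := fun x y => by ext m; simp
      map_smul' := fun r x => by ext m; simp }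
  c_mul_self := fun x => by
    ext m
    simpa using LinearMap.congr_fun (M.c_mul_self x) (m : M.carrier)
  ε := M.ε.restrict hε
  ε_mul_self := by
    ext m
    simpa using LinearMap.congr_fun M.ε_mul_self (m : M.carrier)
  ε_mul_c := fun x => by
    ext m
    simpa using LinearMap.congr_fun (M.ε_mul_c x) (m : M.carrier)

/-- The Clifford algebra `C(V)`, with its own grading, as a graded bimodule over itself, that is as a
graded module over `C(V) ⊗ C(V(-1)) = C(V ⊥ V(-1))`: `v ∈ V` acts by `a ↦ v a`, and `w ∈ V(-1)` by
`a ↦ (-1)^{deg a} a w`. Under the Morita equivalence `E ↦ C(V) ⊗ E` from graded `R`-modules it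
corresponds to `R` itself. -/
def clifford (Q : QuadraticForm R U) : GrMod (Q.prod (-Q)) where
  carrier := CliffordAlgebra Q
  c := LinearMap.mk₂ R
    (fun (x : U × U) (a : CliffordAlgebra Q) =>
      CliffordAlgebra.ι Q x.1 * a + CliffordAlgebra.involute a * CliffordAlgebra.ι Q x.2)
    (fun x y a => by simp only [Prod.fst_add, Prod.snd_add, map_add, add_mul, mul_add]; abel)
    (fun r x a => by simp [smul_add])
    (fun x a b => by simp only [map_add, add_mul, mul_add]; abel)
    (fun r x a => by simp [smul_add])
  c_mul_self := fun x => by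
    ext a
    simp [mul_add, add_mul, mul_assoc, CliffordAlgebra.ι_sq_scalar]
    simp [← mul_assoc, CliffordAlgebra.ι_sq_scalar]
    rw [Algebra.smul_def, Algebra.smul_def, ← Algebra.commutes (Q x.2) a]
  ε := (CliffordAlgebra.involute (Q := Q)).toLinearMap
  ε_mul_self := by ext a; simp
  ε_mul_c := fun x => by ext a; simp; abel

/-- Restriction of scalars along the isomorphism of Clifford algebras induced by an isometry. -/
def pullback {U' : Type u} [AddCommGroup U'] [Module R U'] {Q' : QuadraticForm R U'}
    (e : Q.IsometryEquiv Q') (M : GrMod Q') : GrMod Q where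
  carrier := M.carrier
  c := M.c.comp (e : U →ₗ[R] U')
  c_mul_self := fun x => by simpa using M.c_mul_self (e x)
  ε := M.ε
  ε_mul_self := M.ε_mul_self
  ε_mul_c := fun x => M.ε_mul_c _

/-- The graded tensor product of a graded `C(Q)`-module and a graded `C(Q')`-module, as a graded
module over `C(Q) ⊗ C(Q') = C(Q ⊥ Q')`, with the sign `(a ⊗ b)(m ⊗ n) = (-1)^{deg b deg m} am ⊗ bn`:
the vector `(x, y)` acts by `m ⊗ n ↦ x m ⊗ n + (-1)^{deg m} m ⊗ y n`. -/
def tensor {U' : Type u} [AddCommGroup U'] [Module R U'] {Q' : QuadraticForm R U'}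
    (M : GrMod Q) (N : GrMod Q') : GrMod (Q.prod Q') where
  carrier := M.carrier ⊗[R] N.carrier
  c :=
    { toFun := fun x => TensorProduct.map (M.c x.1) 1 + TensorProduct.map M.ε (N.c x.2)
      map_add' := fun x y => by
        simp only [Prod.fst_add, Prod.snd_add, map_add, TensorProduct.map_add_left,
          TensorProduct.map_add_right]
        abel
      map_smul' := fun r x => by
        simp [TensorProduct.map_smul_left, TensorProduct.map_smul_right] }
  c_mul_self := fun x => by
    have h1 := fun m => LinearMap.congr_fun (M.c_mul_self x.1) m
    have h2 := fun m => LinearMap.congr_fun (N.c_mul_self x.2) m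
    have h3 := fun m => LinearMap.congr_fun (M.ε_mul_c x.1) m
    have h4 := fun m => LinearMap.congr_fun M.ε_mul_self m
    simp at h1 h2 h3 h4
    ext m n
    simp [h1, h2, h3, h4, TensorProduct.smul_tmul', TensorProduct.neg_tmul]
  ε := TensorProduct.map M.ε N.ε
  ε_mul_self := by
    have h4 := fun m => LinearMap.congr_fun M.ε_mul_self m
    have h5 := fun m => LinearMap.congr_fun N.ε_mul_self m
    simp at h4 h5
    ext m n
    simp [h4, h5]
  ε_mul_c := fun x => by
    have h3 := fun m => LinearMap.congr_fun (M.ε_mul_c x.1) m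
    have h4 := fun m => LinearMap.congr_fun (N.ε_mul_c x.2) m
    simp at h3 h4
    ext m n
    simp [h3, h4, TensorProduct.neg_tmul, TensorProduct.tmul_neg]
    abel


section Power

variable (M : GrMod Q) (k : ℕ)

/-- An odd endomorphism `f` applied to the `i`-th factor of the `k`-th graded tensor power:
`m_0 ⊗ ⋯ ⊗ m_{k-1} ↦ (-1)^{deg m_0 + ⋯ + deg m_{i-1}} m_0 ⊗ ⋯ ⊗ f m_i ⊗ ⋯ ⊗ m_{k-1}`. -/
def slot (i : Fin k) : Module.End R M.carrier →ₗ[R] Module.End R (⨂[R] _ : Fin k, M.carrier) :=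
  (PiTensorProduct.mapMultilinear R (fun _ : Fin k => M.carrier) (fun _ => M.carrier)).toLinearMap
    (fun j => if j < i then M.ε else 1) i

theorem slot_apply (i : Fin k) (f : Module.End R M.carrier) :
    M.slot k i f = PiTensorProduct.map (Function.update (fun j => if j < i then M.ε else 1) i f) :=
  rfl

theorem map_of_smul (s : Fin k → R) (f g : Fin k → Module.End R M.carrier)
    (h : ∀ j, f j = s j • g j) :
    PiTensorProduct.map f = (∏ j, s j) • PiTensorProduct.map g := by
  have := (PiTensorProduct.mapMultilinear R (fun _ : Fin k => M.carrier)
    (fun _ => M.carrier)).map_smul_univ s g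
  simpa [← funext h] using this

theorem slot_mul_slot_of_lt {i j : Fin k} (hij : i < j) {f g : Module.End R M.carrier}
    (hf : M.ε * f = -(f * M.ε)) :
    M.slot k j g * M.slot k i f = -(M.slot k i f * M.slot k j g) := by
  rw [slot_apply, slot_apply, ← PiTensorProduct.map_mul, ← PiTensorProduct.map_mul]
  refine (map_of_smul M k (fun l => if l = i then -1 else 1) _
    (Function.update (fun l => if l < i then M.ε else 1) i f *
      Function.update (fun l => if l < j then M.ε else 1) j g) fun l => ?_).trans
    (by
      rw [Finset.prod_ite_eq' Finset.univ i, if_pos (Finset.mem_univ i)]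
      exact neg_one_smul R (_ : Module.End R (⨂[R] _ : Fin k, M.carrier)))
  rcases eq_or_ne l i with rfl | hi
  · simp [Function.update_of_ne hij.ne, hij, hf]
  · rcases eq_or_ne l j with rfl | hj
    · simp [hij.not_gt, hi]
    · simp only [Pi.mul_apply, Function.update_of_ne hi, Function.update_of_ne hj, hi, if_false,
        one_smul]
      split_ifs <;> simp

theorem slot_mul_slot_of_ne {i j : Fin k} (hij : i ≠ j) {f g : Module.End R M.carrier}
    (hf : M.ε * f = -(f * M.ε)) (hg : M.ε * g = -(g * M.ε)) :
    M.slot k j g * M.slot k i f = -(M.slot k i f * M.slot k j g) := by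
  rcases lt_or_gt_of_ne hij with h | h
  · exact slot_mul_slot_of_lt M k h hf
  · rw [slot_mul_slot_of_lt M k h hg, neg_neg]

theorem slot_mul_slot_self (i : Fin k) {f : Module.End R M.carrier} {r : R}
    (h : f * f = algebraMap R (Module.End R M.carrier) r) :
    M.slot k i f * M.slot k i f = algebraMap R _ r := by
  rw [slot_apply, ← PiTensorProduct.map_mul]
  refine (map_of_smul M k (fun l => if l = i then r else 1) _ (fun _ => 1) fun l => ?_).trans ?_
  · rcases eq_or_ne l i with rfl | hi
    · simp [h, Algebra.algebraMap_eq_smul_one]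
    · simp only [Function.update_of_ne hi, hi, if_false, one_smul]
      split_ifs <;> simp [M.ε_mul_self]
  · rw [PiTensorProduct.map_one, Algebra.algebraMap_eq_smul_one]
    simp

theorem sum_mul_self_of_anticommute {A : Type*} [Ring A] {ι : Type*} (s : Finset ι) (a : ι → A)
    (h : ∀ i j, i ≠ j → a j * a i = -(a i * a j)) :
    (∑ i ∈ s, a i) * (∑ i ∈ s, a i) = ∑ i ∈ s, a i * a i := by
  classical
  induction s using Finset.induction_on with
  | empty => simp
  | insert i s hi ih =>
    rw [Finset.sum_insert hi, Finset.sum_insert hi, ← ih, add_mul, mul_add, mul_add]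
    have : (∑ j ∈ s, a j) * a i = -(a i * ∑ j ∈ s, a j) := by
      rw [Finset.sum_mul, Finset.mul_sum, ← Finset.sum_neg_distrib]
      exact Finset.sum_congr rfl fun j hj => h i j (by rintro rfl; exact hi hj)
    rw [this]
    abel

/-- The projection onto the even part. -/
def evenProj [Invertible (2 : R)] : Module.End R M.carrier := (⅟2 : R) • (1 + M.ε)

/-- The projection onto the odd part. -/
def oddProj [Invertible (2 : R)] : Module.End R M.carrier := (⅟2 : R) • (1 - M.ε)

/-- The graded cyclic permutation of the factors of the `k`-th tensor power, which moves the factor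
`i` to the place `i + 1` and the last factor to the place `0`:
`m_0 ⊗ ⋯ ⊗ m_{k-1} ↦ (-1)^s m_{k-1} ⊗ m_0 ⊗ ⋯ ⊗ m_{k-2}` with the Koszul sign
`s = deg m_{k-1} (deg m_0 + ⋯ + deg m_{k-2})`. The two summands are the cases of `m_{k-1}` even and
odd. -/
def cyc [Invertible (2 : R)] : Module.End R (⨂[R] _ : Fin k, M.carrier) :=
  (PiTensorProduct.reindex R (fun _ : Fin k => M.carrier) (finRotate k)).toLinearMap ∘ₗ
    (PiTensorProduct.map (fun i : Fin k => if (i : ℕ) + 1 = k then M.evenProj else 1) +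
      PiTensorProduct.map (fun i : Fin k => if (i : ℕ) + 1 = k then M.oddProj else M.ε))

theorem slot_comp_reindex (e : Equiv.Perm (Fin k)) (i : Fin k) (f : Module.End R M.carrier) :
    M.slot k (e i) f ∘ₗ (PiTensorProduct.reindex R (fun _ : Fin k => M.carrier) e).toLinearMap =
      (PiTensorProduct.reindex R (fun _ : Fin k => M.carrier) e).toLinearMap ∘ₗ
        PiTensorProduct.map (Function.update (fun l => if e l < e i then M.ε else 1) i f) := by
  rw [← PiTensorProduct.map_comp_reindex_eq, slot_apply]
  congr 2
  funext l
  by_cases hl : l = e i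
  · subst hl
    have : e.symm (e i) = i := e.symm_apply_apply i
    rw [this]
    simp
  · rw [Function.update_of_ne hl, Function.update_of_ne]
    · simp
    · intro h
      exact hl (by rw [← h]; simp)

theorem cyc_mul_slot [Invertible (2 : R)] (i : Fin k) {f : Module.End R M.carrier}
    (hf : M.ε * f = -(f * M.ε)) :
    M.cyc k * M.slot k i f = M.slot k (finRotate k i) f * M.cyc k := by
  simp only [cyc, Module.End.mul_eq_comp]
  rw [← LinearMap.comp_assoc, slot_comp_reindex, LinearMap.comp_assoc, LinearMap.comp_assoc,
    slot_apply]
  congr 1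
  simp only [← Module.End.mul_eq_comp, add_mul, mul_add, ← PiTensorProduct.map_mul]
  have hπ0 : M.evenProj * f = f * M.oddProj := by
    simp only [evenProj, oddProj, smul_mul_assoc, mul_smul_comm, add_mul, mul_add, hf, one_mul,
      mul_one, sub_eq_add_neg, mul_neg]
  have hπ1 : M.oddProj * f = f * M.evenProj := by
    simp only [evenProj, oddProj, smul_mul_assoc, mul_smul_comm, sub_mul, mul_add, hf, one_mul,
      mul_one, sub_neg_eq_add]
  have hε0 : M.ε * M.evenProj = M.evenProj := by
    simp [evenProj, mul_add, M.ε_mul_self, add_comm]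
  have hε1 : M.ε * M.oddProj = -M.oddProj := by
    simp [oddProj, mul_sub, M.ε_mul_self, ← smul_neg]
  obtain _ | n := k
  · exact i.elim0
  have hlast : ∀ l : Fin (n + 1), (l : ℕ) + 1 = n + 1 ↔ l = Fin.last n := fun l => by
    rw [Fin.ext_iff]; simp
  simp only [hlast]
  by_cases hi : i = Fin.last n
  · subst hi
    simp only [finRotate_last, Fin.not_lt_zero, if_false]
    rw [add_comm (PiTensorProduct.map _)]
    congr 2
    · funext l
      by_cases hl : l = Fin.last n
      · subst hl; simp [hπ1]
      · have : l < Fin.last n := lt_of_le_of_ne (Fin.le_last l) hl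
        simp [hl, this, M.ε_mul_self]
    · funext l
      by_cases hl : l = Fin.last n
      · subst hl; simp [hπ0]
      · have : l < Fin.last n := lt_of_le_of_ne (Fin.le_last l) hl
        simp [hl, this]
  · have hlt : ∀ l : Fin (n + 1), l ≠ Fin.last n →
        (finRotate (n + 1) l < finRotate (n + 1) i ↔ l < i) := fun l hl => by
      rw [Fin.lt_def, coe_finRotate_of_ne_last hl, coe_finRotate_of_ne_last hi, Fin.lt_def]
      omega
    have hlt' : finRotate (n + 1) (Fin.last n) < finRotate (n + 1) i := by
      rw [Fin.lt_def, coe_finRotate_of_ne_last hi, finRotate_last]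
      simp
    have hni : ¬ Fin.last n < i := not_lt.mpr (Fin.le_last i)
    have hB : ∃ B : Fin (n + 1) → Module.End R M.carrier,
        (fun l => if finRotate (n + 1) l < finRotate (n + 1) i then M.ε else 1) = B ∧
        B (Fin.last n) = M.ε ∧ ∀ l, l ≠ Fin.last n → B l = if l < i then M.ε else 1 :=
      ⟨_, rfl, if_pos hlt', fun l hl => if_congr (hlt l hl) rfl rfl⟩
    obtain ⟨B, hB, hB1, hB2⟩ := hB
    rw [hB]
    congr 1
    · congr 1
      funext l
      by_cases hl : l = Fin.last n
      · subst hl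
        simp [Function.update_of_ne (Ne.symm hi), hB1, hni, hε0]
      · by_cases hli : l = i
        · subst hli; simp [hl]
        · simp [hl, hli, hB2 l hl]
    · refine (map_of_smul M (n + 1)
        (fun l => (if l = i then -1 else 1) * (if l = Fin.last n then -1 else 1)) _
        (Function.update B i f * fun l => if l = Fin.last n then M.oddProj else M.ε)
          fun l => ?_).trans ?_
      · by_cases hl : l = Fin.last n
        · subst hl
          simp [Ne.symm hi, hB1, hni, hε1]
        · by_cases hli : l = i
          · subst hli; simp [hl, hf]
          · simp only [hl, hli, hB2 l hl, Function.update_of_ne hli, if_false, one_smul, mul_one,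
              Pi.mul_apply]
            split_ifs <;> simp
      · rw [Finset.prod_mul_distrib]
        simp [Pi.mul_def]

theorem cyc_mul_parity [Invertible (2 : R)] :
    M.cyc k * PiTensorProduct.map (fun _ => M.ε) = PiTensorProduct.map (fun _ => M.ε) * M.cyc k := by
  have key : PiTensorProduct.map (fun _ => M.ε) ∘ₗ
      (PiTensorProduct.reindex R (fun _ : Fin k => M.carrier) (finRotate k)).toLinearMap =
      (PiTensorProduct.reindex R (fun _ : Fin k => M.carrier) (finRotate k)).toLinearMap ∘ₗ
        PiTensorProduct.map (fun _ => M.ε) := by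
    rw [← PiTensorProduct.map_comp_reindex_eq]
  simp only [cyc, Module.End.mul_eq_comp]
  rw [← LinearMap.comp_assoc, key, LinearMap.comp_assoc, LinearMap.comp_assoc]
  congr 1
  simp only [← Module.End.mul_eq_comp, add_mul, mul_add, ← PiTensorProduct.map_mul]
  congr 2
  · funext l
    split_ifs <;> simp [evenProj, mul_add, add_mul]
  · funext l
    split_ifs <;> simp [oddProj, mul_sub, sub_mul]


end Power

end Basic

end GrMod

section Forms

variable {R : Type u} [CommRing R] {V W : Type u} [AddCommGroup V] [Module R V]
  [AddCommGroup W] [Module R W]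

/-- The orthogonal sum `W^k` of `k` copies of a quadratic module `W`. -/
abbrev powForm (k : ℕ) (q : QuadraticForm R W) : QuadraticForm R (Fin k → W) :=
  QuadraticMap.pi fun _ : Fin k => q

/-- The quadratic module `V(k) ⊥ W^k`, where `V(k)` is `V` with its form multiplied by `k`. Its
Clifford algebra is `C(V(k)) ⊗ C(W^k)`. -/
abbrev targetForm (k : ℕ) (p : QuadraticForm R V) (q : QuadraticForm R W) :
    QuadraticForm R (V × (Fin k → W)) :=
  ((k : R) • p).prod (powForm k q)

/-- The action on `W^k` of the generator of `ℤ/k`, by the cyclic shift of the coordinates: the copy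
`i` of `W` goes to the copy `i + 1`. -/
def shift (R : Type u) [CommRing R] (W : Type u) [AddCommGroup W] [Module R W] (k : ℕ) :
    (Fin k → W) ≃ₗ[R] (Fin k → W) :=
  LinearEquiv.funCongrLeft R W (finRotate k).symm

/-- `t` belongs to the group `Spin` of a quadratic module: it is an invertible even element of the
Clifford algebra, conjugation by it maps vectors to vectors, and its spinor norm is `1`. -/
structure IsSpin (q : QuadraticForm R W) (t : (CliffordAlgebra q)ˣ) : Prop where
  even : (t : CliffordAlgebra q) ∈ CliffordAlgebra.evenOdd q 0
  conj_mem : ∀ w, ∃ w', (t : CliffordAlgebra q) * CliffordAlgebra.ι q w * (↑t⁻¹ : CliffordAlgebra q)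
    = CliffordAlgebra.ι q w'
  norm : (t : CliffordAlgebra q) * CliffordAlgebra.reverse (t : CliffordAlgebra q) = 1

/-- A lifting of the representation of `ℤ/k` in `O(W^k)` to a representation of `ℤ/k` in
`Spin(W^k)`, given by the image `t` of the generator. -/
structure SpinLift (k : ℕ) (q : QuadraticForm R W) where
  /-- The image of the generator of `ℤ/k`. -/
  t : (CliffordAlgebra (powForm k q))ˣ
  isSpin : IsSpin (powForm k q) t
  conj : ∀ w, (t : CliffordAlgebra (powForm k q)) * CliffordAlgebra.ι _ w *
    (↑t⁻¹ : CliffordAlgebra (powForm k q)) = CliffordAlgebra.ι _ (shift R W k w)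
  pow_eq_one : t ^ k = 1

/-- The image of `t` in the Clifford algebra of `V(k) ⊥ W^k`. -/
def SpinLift.incl {k : ℕ} {q : QuadraticForm R W} (t : SpinLift k q) (p : QuadraticForm R V) :
    (CliffordAlgebra (targetForm k p q))ˣ :=
  Units.map (CliffordAlgebra.map (QuadraticMap.Isometry.inr ((k : R) • p)
    (powForm k q))).toMonoidHom t.t

theorem SpinLift.incl_mul_ι {k : ℕ} {q : QuadraticForm R W} (t : SpinLift k q)
    (p : QuadraticForm R V) (v : V) (w : Fin k → W) :
    (t.incl p : CliffordAlgebra (targetForm k p q)) * CliffordAlgebra.ι _ (v, w) =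
      CliffordAlgebra.ι _ (v, shift R W k w) * (t.incl p : CliffordAlgebra (targetForm k p q)) := by
  have h : ∀ w : Fin k → W, ((v, w) : V × (Fin k → W)) = (v, 0) + (0, w) := fun w => by simp
  have hw : ∀ w : Fin k → W, CliffordAlgebra.ι (targetForm k p q) (0, w) =
      CliffordAlgebra.map (QuadraticMap.Isometry.inr ((k : R) • p) (powForm k q))
        (CliffordAlgebra.ι _ w) := fun w => by
    rw [CliffordAlgebra.map_apply_ι]; rfl
  have hv : CliffordAlgebra.ι (targetForm k p q) (v, 0) =
      CliffordAlgebra.map (QuadraticMap.Isometry.inl ((k : R) • p) (powForm k q))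
        (CliffordAlgebra.ι _ v) := by
    rw [CliffordAlgebra.map_apply_ι]; rfl
  have ht : (t.incl p : CliffordAlgebra (targetForm k p q)) = CliffordAlgebra.map
      (QuadraticMap.Isometry.inr ((k : R) • p) (powForm k q)) t.t := rfl
  have hc : (t.t : CliffordAlgebra (powForm k q)) * CliffordAlgebra.ι _ w =
      CliffordAlgebra.ι _ (shift R W k w) * (t.t : CliffordAlgebra (powForm k q)) := by
    rw [← t.conj w, mul_assoc, Units.inv_mul, mul_one]
  have hcomm := CliffordAlgebra.commute_map_mul_map_of_isOrtho_of_mem_evenOdd_zero_right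
    (QuadraticMap.Isometry.inl ((k : R) • p) (powForm k q))
    (QuadraticMap.Isometry.inr ((k : R) • p) (powForm k q))
    (fun x y => QuadraticMap.IsOrtho.inl_inr x y) (CliffordAlgebra.ι _ v) t.t
    (CliffordAlgebra.ι_mem_evenOdd_one _ v) t.isSpin.even
  rw [h w, h (shift R W k w), map_add, map_add, mul_add, add_mul, hw, hw, hv, ht, ← map_mul, hc,
    map_mul, hcomm.eq]

theorem involute_map_of_even {p : QuadraticForm R V} {q : QuadraticForm R W} (f : p →qᵢ q)
    {a : CliffordAlgebra p} (ha : a ∈ CliffordAlgebra.evenOdd p 0) :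
    CliffordAlgebra.involute (CliffordAlgebra.map f a) = CliffordAlgebra.map f a := by
  induction a, ha using CliffordAlgebra.even_induction with
  | algebraMap r => simp
  | add x y hx hy ihx ihy => rw [map_add, map_add, ihx, ihy]
  | ι_mul_ι_mul m₁ m₂ x hx ih => simp [ih]

end Forms

namespace GrMod
section Twisted

variable {R : Type u} [CommRing R] {V W : Type u} [AddCommGroup V] [Module R V]
  [AddCommGroup W] [Module R W] {p : QuadraticForm R V} {q : QuadraticForm R W}

/-- The `k`-th graded tensor power of a graded module over `C(V) ⊗ C(W)`, with the scalars restricted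
from `C(V^k) ⊗ C(W^k)` to `C(V(k)) ⊗ C(W^k)` along the half-diagonal: the vector `(v, w)` acts as
`∑ i, (v, w i)` with the `i`-th summand acting on the `i`-th factor. -/
def power (M : GrMod (p.prod q)) (k : ℕ) : GrMod (targetForm k p q) where
  carrier := ⨂[R] _ : Fin k, M.carrier
  c :=
    { toFun := fun x => ∑ i : Fin k, M.slot k i (M.c (x.1, x.2 i))
      map_add' := fun x y => by
        simp only [Prod.fst_add, Prod.snd_add, Pi.add_apply, ← Finset.sum_add_distrib, ← map_add,
          Prod.mk_add_mk]
      map_smul' := fun r x => by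
        simp only [Prod.smul_fst, Prod.smul_snd, Pi.smul_apply, Finset.smul_sum, ← map_smul,
          Prod.smul_mk, RingHom.id_apply] }
  c_mul_self := fun x => by
    change (∑ i : Fin k, M.slot k i (M.c (x.1, x.2 i))) *
      (∑ i : Fin k, M.slot k i (M.c (x.1, x.2 i))) = _
    rw [sum_mul_self_of_anticommute _ _ fun i j hij =>
      M.slot_mul_slot_of_ne k hij (M.ε_mul_c _) (M.ε_mul_c _)]
    simp only [M.slot_mul_slot_self k _ (M.c_mul_self _), ← map_sum]
    congr 1
    simp [Finset.sum_add_distrib]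
  ε := PiTensorProduct.map fun _ => M.ε
  ε_mul_self := by
    rw [← PiTensorProduct.map_mul]
    simp [M.ε_mul_self]
  ε_mul_c := fun x => by
    change _ * (∑ i : Fin k, M.slot k i (M.c (x.1, x.2 i))) =
      -((∑ i : Fin k, M.slot k i (M.c (x.1, x.2 i))) * _)
    rw [Finset.mul_sum, Finset.sum_mul, ← Finset.sum_neg_distrib]
    refine Finset.sum_congr rfl fun i _ => ?_
    rw [slot_apply, ← PiTensorProduct.map_mul, ← PiTensorProduct.map_mul]
    refine (map_of_smul M k (fun l => if l = i then -1 else 1) _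
      (Function.update (fun j => if j < i then M.ε else 1) i (M.c (x.1, x.2 i)) * fun _ => M.ε)
        fun l => ?_).trans ?_
    · rcases eq_or_ne l i with rfl | hi
      · simp [M.ε_mul_c]
      · simp only [Pi.mul_apply, Function.update_of_ne hi, hi, if_false, one_smul]
        split_ifs <;> simp
    · rw [Finset.prod_ite_eq' Finset.univ i, if_pos (Finset.mem_univ i)]
      exact neg_one_smul R (_ : Module.End R (⨂[R] _ : Fin k, M.carrier))

/-- The action of the generator of `ℤ/k` on the `k`-th power of a graded module. It permutes the
action of `C(W^k)` through the shift, see `powerCyc_mul_c`. -/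
def powerCyc [Invertible (2 : R)] (M : GrMod (p.prod q)) (k : ℕ) :
    Module.End R (M.power k).carrier :=
  M.cyc k

/-- The untwisted action of the generator of `ℤ/k` on the `k`-th power of a graded module: the cyclic
permutation followed by the inverse of the lifting in `Spin(W^k)`. It is linear over
`C(V(k)) ⊗ C(W^k)` and even, see `untwisted_mul_c` and `untwisted_mul_ε`. -/
def untwisted [Invertible (2 : R)] (M : GrMod (p.prod q)) {k : ℕ} (t : SpinLift k q) :
    Module.End R (M.power k).carrier :=
  (M.power k).act (↑(t.incl p)⁻¹ : CliffordAlgebra (targetForm k p q)) * M.powerCyc k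

theorem powerCyc_mul_c [Invertible (2 : R)] (M : GrMod (p.prod q)) (k : ℕ)
    (v : V) (w : Fin k → W) :
    M.powerCyc k * (M.power k).c (v, w) = (M.power k).c (v, shift R W k w) * M.powerCyc k := by
  change M.cyc k * (∑ i : Fin k, M.slot k i (M.c (v, w i))) =
    (∑ i : Fin k, M.slot k i (M.c (v, w ((finRotate k).symm i)))) * M.cyc k
  rw [Finset.mul_sum, Finset.sum_mul,
    ← Equiv.sum_comp (finRotate k) (fun i => _ * M.cyc k)]
  refine Finset.sum_congr rfl fun i _ => ?_
  rw [M.cyc_mul_slot k i (M.ε_mul_c _), Equiv.symm_apply_apply]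

theorem untwisted_mul_c [Invertible (2 : R)] (M : GrMod (p.prod q)) {k : ℕ} (t : SpinLift k q)
    (x : V × (Fin k → W)) :
    M.untwisted t * (M.power k).c x = (M.power k).c x * M.untwisted t := by
  obtain ⟨v, w⟩ := x
  have h : (↑(t.incl p)⁻¹ : CliffordAlgebra (targetForm k p q)) *
      CliffordAlgebra.ι _ (v, shift R W k w) =
      CliffordAlgebra.ι _ (v, w) * (↑(t.incl p)⁻¹ : CliffordAlgebra (targetForm k p q)) := by
    rw [Units.inv_mul_eq_iff_eq_mul, ← mul_assoc, t.incl_mul_ι, mul_assoc, Units.mul_inv, mul_one]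
  have h' := congrArg (M.power k).act h
  rw [map_mul, map_mul, act_ι, act_ι] at h'
  rw [untwisted, mul_assoc, powerCyc_mul_c, ← mul_assoc, h', mul_assoc]

theorem untwisted_mul_ε [Invertible (2 : R)] (M : GrMod (p.prod q)) {k : ℕ} (t : SpinLift k q) :
    M.untwisted t * (M.power k).ε = (M.power k).ε * M.untwisted t := by
  have h : CliffordAlgebra.involute (t.incl p : CliffordAlgebra (targetForm k p q)) = t.incl p :=
    involute_map_of_even _ t.isSpin.even
  have h1 : CliffordAlgebra.involute (↑(t.incl p)⁻¹ : CliffordAlgebra (targetForm k p q)) =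
      (↑(t.incl p)⁻¹ : CliffordAlgebra (targetForm k p q)) := by
    have h2 := congrArg CliffordAlgebra.involute (Units.inv_mul (t.incl p))
    rw [map_mul, map_one, h] at h2
    exact (Units.inv_eq_of_mul_eq_one_left h2).symm
  have h2 := (M.power k).ε_mul_act (↑(t.incl p)⁻¹ : CliffordAlgebra (targetForm k p q))
  rw [h1] at h2
  have h3 : M.powerCyc k * (M.power k).ε = (M.power k).ε * M.powerCyc k := M.cyc_mul_parity k
  rw [untwisted, mul_assoc, h3, ← mul_assoc, ← h2, mul_assoc]

/-- The eigenmodule of the untwisted action for the eigenvalue `r`, a graded module over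
`C(V(k)) ⊗ C(W^k)`. -/
def eigen [Invertible (2 : R)] (M : GrMod (p.prod q)) {k : ℕ} (t : SpinLift k q) (r : R) :
    GrMod (targetForm k p q) :=
  (M.power k).restrict ((M.untwisted t).eigenspace r)
    (fun x m hm => by
      rw [Module.End.mem_eigenspace_iff] at hm ⊢
      have := LinearMap.congr_fun (M.untwisted_mul_c t x) m
      rw [Module.End.mul_apply, Module.End.mul_apply, hm, map_smul] at this
      exact this)
    (fun m hm => by
      rw [Module.End.mem_eigenspace_iff] at hm ⊢
      have := LinearMap.congr_fun (M.untwisted_mul_ε t) m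
      rw [Module.End.mul_apply, Module.End.mul_apply, hm, map_smul] at this
      exact this)

end Twisted
end GrMod

namespace GrMod

section KGroup

variable {R : Type u} [CommRing R] {U U' : Type u} [AddCommGroup U] [Module R U]
  [AddCommGroup U'] [Module R U'] {Q : QuadraticForm R U} {Q' : QuadraticForm R U'}

/-- `P` is isomorphic, as a graded module, to the direct sum of `M` and `N`. -/
def IsSum (P M N : GrMod Q) : Prop :=
  ∃ e : P.carrier ≃ₗ[R] M.carrier × N.carrier,
    (∀ x m, e (P.c x m) = (M.c x (e m).1, N.c x (e m).2)) ∧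
      ∀ m, e (P.ε m) = (M.ε (e m).1, N.ε (e m).2)

/-- `M` has an odd involution that anticommutes with the vectors; equivalently, the structure of a
graded `C(Q)`-module on `M`, viewed as a module over `C(Q) ⊗ C^{0,1}` whose last generator acts by
`ε`, extends to `C(Q) ⊗ C^{0,2}`. -/
def HasOddInvolution (M : GrMod Q) : Prop :=
  ∃ η : Module.End R M.carrier,
    η * η = 1 ∧ (∀ x, η * M.c x = -(M.c x * η)) ∧ η * M.ε = -(M.ε * η)

end KGroup
end GrMod

section KGroup

variable {R : Type u} [CommRing R] {U U' : Type u} [AddCommGroup U] [Module R U]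
  [AddCommGroup U'] [Module R U'] {Q : QuadraticForm R U} {Q' : QuadraticForm R U'}

/-- The relations of the graded `K`-group: `[M ⊕ N] = [M] + [N]`, and `[M] = 0` when `M` has an odd
involution. -/
def GrKRel (Q : QuadraticForm R U) : AddSubgroup (FreeAbelianGroup {M : GrMod Q // M.IsFGProj}) :=
  AddSubgroup.closure
    ({z | ∃ P M N : {M : GrMod Q // M.IsFGProj}, P.1.IsSum M.1 N.1 ∧
        z = FreeAbelianGroup.of P - FreeAbelianGroup.of M - FreeAbelianGroup.of N} ∪
      {z | ∃ M : {M : GrMod Q // M.IsFGProj}, M.1.HasOddInvolution ∧ z = FreeAbelianGroup.of M})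

/-- The `K`-group of the graded algebra `C(Q)`: the cokernel of the restriction map
`K(C(Q) ⊗ C^{0,2}) → K(C(Q) ⊗ C^{0,1})` between the Grothendieck groups of finitely generated
projective modules. As `2` is invertible, a finitely generated projective module over
`C(Q) ⊗ C^{0,1}` is the same as a graded `C(Q)`-module that is finitely generated and projective
over `C(Q)`. -/
abbrev GrK (Q : QuadraticForm R U) : Type (u + 1) :=
  FreeAbelianGroup {M : GrMod Q // M.IsFGProj} ⧸ GrKRel Q

/-- The class of a finitely generated projective graded module (and `0` for other modules). -/
def cls (M : GrMod Q) : GrK Q :=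
  haveI := Classical.propDecidable M.IsFGProj
  if h : M.IsFGProj then QuotientAddGroup.mk (FreeAbelianGroup.of ⟨M, h⟩) else 0

theorem cls_of (M : {M : GrMod Q // M.IsFGProj}) :
    cls M.1 = (QuotientAddGroup.mk (FreeAbelianGroup.of M) : GrK Q) := by
  rw [cls, dif_pos M.2]

theorem cls_sum {P M N : GrMod Q} (hP : P.IsFGProj) (hM : M.IsFGProj) (hN : N.IsFGProj)
    (h : P.IsSum M N) : cls P = cls M + cls N := by
  rw [cls, cls, cls, dif_pos hP, dif_pos hM, dif_pos hN, ← QuotientAddGroup.mk_add,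
    QuotientAddGroup.eq_iff_sub_mem]
  refine AddSubgroup.subset_closure (Or.inl ⟨⟨P, hP⟩, ⟨M, hM⟩, ⟨N, hN⟩, h, ?_⟩)
  abel

theorem cls_eq_zero {M : GrMod Q} (h : M.HasOddInvolution) : cls M = 0 := by
  rw [cls]
  split_ifs with hM
  · rw [QuotientAddGroup.eq_zero_iff]
    exact AddSubgroup.subset_closure (Or.inr ⟨⟨M, hM⟩, h, rfl⟩)
  · rfl

/-- The universal property of the graded `K`-group. -/
def GrK.lift {G : Type*} [AddCommGroup G] (f : GrMod Q → G)
    (hsum : ∀ P M N : GrMod Q, P.IsFGProj → M.IsFGProj → N.IsFGProj → P.IsSum M N →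
      f P = f M + f N)
    (hinv : ∀ M : GrMod Q, M.IsFGProj → M.HasOddInvolution → f M = 0) : GrK Q →+ G :=
  QuotientAddGroup.lift (GrKRel Q) (FreeAbelianGroup.lift fun M => f M.1) (by
    rw [GrKRel, AddSubgroup.closure_le]
    rintro z (⟨P, M, N, h, rfl⟩ | ⟨M, h, rfl⟩)
    · simp [hsum P.1 M.1 N.1 P.2 M.2 N.2 h]
    · simp [hinv M.1 M.2 h])

theorem GrK.lift_cls {G : Type*} [AddCommGroup G] (f : GrMod Q → G) (hsum) (hinv)
    {M : GrMod Q} (hM : M.IsFGProj) : GrK.lift f hsum hinv (cls M) = f M := by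
  rw [cls, dif_pos hM, GrK.lift, QuotientAddGroup.lift_mk, FreeAbelianGroup.lift_apply_of]

theorem GrK.induction {motive : GrK Q → Prop} (z : GrK Q)
    (h0 : motive 0)
    (hcls : ∀ M : GrMod Q, M.IsFGProj → motive (cls M))
    (hneg : ∀ x, motive x → motive (-x)) (hadd : ∀ x y, motive x → motive y → motive (x + y)) :
    motive z := by
  induction z using QuotientAddGroup.induction_on with
  | H z =>
    induction z using FreeAbelianGroup.induction_on with
    | zero => exact h0
    | of M => rw [← cls_of]; exact hcls _ M.2
    | neg M ih => rw [QuotientAddGroup.mk_neg]; exact hneg _ ih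
    | add x y hx hy => rw [QuotientAddGroup.mk_add]; exact hadd _ _ hx hy

end KGroup

namespace GrMod

section FGProj

variable {R : Type u} [CommRing R] {U U' : Type u} [AddCommGroup U] [Module R U]
  [AddCommGroup U'] [Module R U'] {Q : QuadraticForm R U} {Q' : QuadraticForm R U'}

theorem isFGProj_of_split (M : GrMod Q) {ι : Type*} [Finite ι]
    (i : M.carrier →ₗ[R] (ι → CliffordAlgebra Q)) (s : (ι → CliffordAlgebra Q) →ₗ[R] M.carrier)
    (hi : ∀ a m, i (M.act a m) = a • i m) (hs : ∀ (a : CliffordAlgebra Q) f, s (a • f) = M.act a (s f))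
    (h : ∀ m, s (i m) = m) : M.IsFGProj := by
  let _ : Module (CliffordAlgebra Q) M.carrier := Module.compHom M.carrier M.act.toRingHom
  let i' : M.carrier →ₗ[CliffordAlgebra Q] (ι → CliffordAlgebra Q) :=
    { toFun := i, map_add' := map_add i, map_smul' := hi }
  let s' : (ι → CliffordAlgebra Q) →ₗ[CliffordAlgebra Q] M.carrier :=
    { toFun := s, map_add' := map_add s, map_smul' := hs }
  exact ⟨Module.Finite.of_surjective s' fun m => ⟨i m, h m⟩,
    Module.Projective.of_split i' s' (LinearMap.ext h)⟩

theorem IsFGProj.exists_split {M : GrMod Q} (hM : M.IsFGProj) :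
    ∃ (n : ℕ) (i : M.carrier →ₗ[R] (Fin n → CliffordAlgebra Q))
      (s : (Fin n → CliffordAlgebra Q) →ₗ[R] M.carrier),
      (∀ a m, i (M.act a m) = a • i m) ∧
      (∀ (a : CliffordAlgebra Q) f, s (a • f) = M.act a (s f)) ∧ ∀ m, s (i m) = m := by
  let _ : Module (CliffordAlgebra Q) M.carrier := Module.compHom M.carrier M.act.toRingHom
  have : Module.Finite (CliffordAlgebra Q) M.carrier := hM.1
  have : Module.Projective (CliffordAlgebra Q) M.carrier := hM.2
  obtain ⟨n, s, i, -, -, h⟩ :=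
    Module.Finite.exists_comp_eq_id_of_projective (CliffordAlgebra Q) M.carrier
  have hr : ∀ (r : R) (m : M.carrier), r • m = algebraMap R (CliffordAlgebra Q) r • m := fun r m => by
    change r • m = M.act (algebraMap R _ r) m
    simp
  refine ⟨n, { toFun := i, map_add' := map_add i, map_smul' := fun r m => ?_ },
    { toFun := s, map_add' := map_add s, map_smul' := fun r f => ?_ },
    fun a m => map_smul i a m, fun a f => map_smul s a f, fun m => LinearMap.congr_fun h m⟩
  · rw [hr, map_smul, algebraMap_smul, RingHom.id_apply]
  · rw [RingHom.id_apply, hr, ← map_smul, algebraMap_smul]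

end FGProj

end GrMod

namespace GrMod

section Closure

variable {R : Type u} [CommRing R] {U U' : Type u} [AddCommGroup U] [Module R U]
  [AddCommGroup U'] [Module R U'] {Q : QuadraticForm R U} {Q' : QuadraticForm R U'}

theorem IsFGProj.of_equiv {M : GrMod Q'} (hM : M.IsFGProj) (M' : GrMod Q)
    (f : M'.carrier ≃ₗ[R] M.carrier) (φ : CliffordAlgebra Q ≃ₐ[R] CliffordAlgebra Q')
    (hf : ∀ x m, f (M'.c x m) = M.act (φ (CliffordAlgebra.ι Q x)) (f m)) : M'.IsFGProj := by
  have hf' : ∀ a m, f (M'.act a m) = M.act (φ a) (f m) := by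
    intro a
    induction a using CliffordAlgebra.induction with
    | algebraMap r => intro m; simp
    | ι x => intro m; rw [act_ι, hf]
    | mul a b ha hb => intro m; simp [ha, hb]
    | add a b ha hb => intro m; simp [ha, hb]
  obtain ⟨n, i, s, hi, hs, h⟩ := hM.exists_split
  refine isFGProj_of_split _
    (LinearMap.pi fun j => φ.symm.toLinearMap ∘ₗ LinearMap.proj j ∘ₗ i ∘ₗ f.toLinearMap)
    (f.symm.toLinearMap ∘ₗ s ∘ₗ LinearMap.pi fun j => φ.toLinearMap ∘ₗ LinearMap.proj j) ?_ ?_ ?_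
  · intro a m
    ext j
    simp [hf', hi]
  · intro a g
    apply f.injective
    rw [hf']
    simp only [LinearMap.comp_apply, LinearEquiv.coe_coe, LinearEquiv.apply_symm_apply]
    rw [← hs]
    congr 1
    ext j
    simp
  · intro m
    apply f.injective
    simp only [LinearMap.comp_apply, LinearEquiv.coe_coe, LinearEquiv.apply_symm_apply]
    refine Eq.trans (congrArg s ?_) (h (f m))
    ext j
    simp

theorem IsFGProj.pullback (e : Q.IsometryEquiv Q') {M : GrMod Q'} (hM : M.IsFGProj) :
    (M.pullback e).IsFGProj := by
  refine hM.of_equiv (M.pullback e) (LinearEquiv.refl R M.carrier)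
    (CliffordAlgebra.equivOfIsometry e) fun x m => ?_
  rw [CliffordAlgebra.equivOfIsometry_apply, CliffordAlgebra.map_apply_ι, act_ι]
  rfl

theorem IsSum.pullback (e : Q.IsometryEquiv Q') {P M N : GrMod Q'} (h : P.IsSum M N) :
    (P.pullback e).IsSum (M.pullback e) (N.pullback e) := by
  obtain ⟨f, hc, hε⟩ := h
  exact ⟨f, fun x m => hc (e x) m, hε⟩

theorem HasOddInvolution.pullback (e : Q.IsometryEquiv Q') {M : GrMod Q'}
    (h : M.HasOddInvolution) : (M.pullback e).HasOddInvolution := by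
  obtain ⟨η, h1, h2, h3⟩ := h
  exact ⟨η, h1, fun x => h2 (e x), h3⟩

/-- The canonical bilinear map into the tensor product. -/
def tmk (M : GrMod Q) (N : GrMod Q') :
    M.carrier →ₗ[R] N.carrier →ₗ[R] (M.tensor N).carrier :=
  TensorProduct.mk R M.carrier N.carrier

theorem tensor_c_tmk (M : GrMod Q) (N : GrMod Q') (x : U × U') (m : M.carrier) (n : N.carrier) :
    (M.tensor N).c x (M.tmk N m n) = M.tmk N (M.c x.1 m) n + M.tmk N (M.ε m) (N.c x.2 n) :=
  rfl

theorem tensor_ε_tmk (M : GrMod Q) (N : GrMod Q') (m : M.carrier) (n : N.carrier) :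
    (M.tensor N).ε (M.tmk N m n) = M.tmk N (M.ε m) (N.ε n) :=
  rfl

theorem tensor_hom_ext {M : GrMod Q} {N : GrMod Q'} {X : Type*} [AddCommGroup X] [Module R X]
    {f g : (M.tensor N).carrier →ₗ[R] X} (h : ∀ m n, f (M.tmk N m n) = g (M.tmk N m n)) : f = g :=
  TensorProduct.ext' h

theorem tensor_exists_lift (M : GrMod Q) (N : GrMod Q') {X : Type*} [AddCommGroup X] [Module R X]
    (f : M.carrier →ₗ[R] N.carrier →ₗ[R] X) :
    ∃ F : (M.tensor N).carrier →ₗ[R] X, ∀ m n, F (M.tmk N m n) = f m n :=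
  ⟨TensorProduct.lift f, fun m n => TensorProduct.lift.tmul m n⟩

theorem tensor_act_inl (M : GrMod Q) (N : GrMod Q') (a : CliffordAlgebra Q) (m : M.carrier)
    (n : N.carrier) :
    (M.tensor N).act (CliffordAlgebra.map (QuadraticMap.Isometry.inl Q Q') a) (M.tmk N m n) =
      M.tmk N (M.act a m) n := by
  induction a using CliffordAlgebra.induction generalizing m with
  | algebraMap r => simp
  | ι x =>
    rw [CliffordAlgebra.map_apply_ι, act_ι, act_ι, tensor_c_tmk]
    have hx : QuadraticMap.Isometry.inl Q Q' x = (x, 0) := rfl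
    simp [hx]
  | mul a b ha hb => simp [ha, hb]
  | add a b ha hb => simp [ha, hb]

theorem tensor_act_inr (M : GrMod Q) (N : GrMod Q') (b : CliffordAlgebra Q') (m : M.carrier)
    (n : N.carrier) (h : M.ε m = m) :
    (M.tensor N).act (CliffordAlgebra.map (QuadraticMap.Isometry.inr Q Q') b) (M.tmk N m n) =
      M.tmk N m (N.act b n) := by
  induction b using CliffordAlgebra.induction generalizing n with
  | algebraMap r => simp
  | ι x =>
    rw [CliffordAlgebra.map_apply_ι, act_ι, act_ι, tensor_c_tmk]
    have hx : QuadraticMap.Isometry.inr Q Q' x = (0, x) := rfl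
    simp [hx, h]
  | mul a b ha hb => simp [ha, hb]
  | add a b ha hb => simp [ha, hb]

theorem tensor_act_inr' (M : GrMod Q) (N : GrMod Q') (b : CliffordAlgebra Q') (m : M.carrier)
    (n : N.carrier) (h : M.ε m = -m) :
    (M.tensor N).act (CliffordAlgebra.map (QuadraticMap.Isometry.inr Q Q') b) (M.tmk N m n) =
      M.tmk N m (N.act (CliffordAlgebra.involute b) n) := by
  induction b using CliffordAlgebra.induction generalizing n with
  | algebraMap r => simp
  | ι x =>
    rw [CliffordAlgebra.map_apply_ι, act_ι, CliffordAlgebra.involute_ι, map_neg, act_ι,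
      tensor_c_tmk]
    have hx : QuadraticMap.Isometry.inr Q Q' x = (0, x) := rfl
    simp [hx, h]
  | mul a b ha hb => simp [ha, hb]
  | add a b ha hb => simp [ha, hb]

theorem isSum_of_hom {P M N : GrMod Q} (e : P.carrier ≃ₗ[R] M.carrier × N.carrier)
    (hc : ∀ x, e.toLinearMap ∘ₗ P.c x = (M.c x).prodMap (N.c x) ∘ₗ e.toLinearMap)
    (hε : e.toLinearMap ∘ₗ P.ε = M.ε.prodMap N.ε ∘ₗ e.toLinearMap) : P.IsSum M N :=
  ⟨e, fun x m => LinearMap.congr_fun (hc x) m, fun m => LinearMap.congr_fun hε m⟩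

theorem IsSum.tensor_right {P M N : GrMod Q} (X : GrMod Q') (h : P.IsSum M N) :
    (P.tensor X).IsSum (M.tensor X) (N.tensor X) := by
  obtain ⟨f, hc, hε⟩ := h
  let e : (P.tensor X).carrier ≃ₗ[R] (M.tensor X).carrier × (N.tensor X).carrier :=
    (TensorProduct.congr f (LinearEquiv.refl R X.carrier)).trans
      (TensorProduct.prodLeft R R M.carrier N.carrier X.carrier)
  have he : ∀ m n, e (P.tmk X m n) = (M.tmk X (f m).1 n, N.tmk X (f m).2 n) := fun m n => rfl
  refine isSum_of_hom e (fun x => tensor_hom_ext fun m n => ?_) (tensor_hom_ext fun m n => ?_)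
  · simp [tensor_c_tmk, he, hc, hε]
  · simp [tensor_ε_tmk, he, hε]

theorem IsSum.tensor_left {P M N : GrMod Q'} (X : GrMod Q) (h : P.IsSum M N) :
    (X.tensor P).IsSum (X.tensor M) (X.tensor N) := by
  obtain ⟨f, hc, hε⟩ := h
  let e : (X.tensor P).carrier ≃ₗ[R] (X.tensor M).carrier × (X.tensor N).carrier :=
    (TensorProduct.congr (LinearEquiv.refl R X.carrier) f).trans
      (TensorProduct.prodRight R R X.carrier M.carrier N.carrier)
  have he : ∀ m n, e (X.tmk P m n) = (X.tmk M m (f n).1, X.tmk N m (f n).2) := fun m n => rfl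
  refine isSum_of_hom e (fun x => tensor_hom_ext fun m n => ?_) (tensor_hom_ext fun m n => ?_)
  · simp [tensor_c_tmk, he, hc]
  · simp [tensor_ε_tmk, he, hε]

theorem HasOddInvolution.tensor_right {M : GrMod Q} (N : GrMod Q') (h : M.HasOddInvolution) :
    (M.tensor N).HasOddInvolution := by
  obtain ⟨η, h1, h2, h3⟩ := h
  have h1' := fun m => LinearMap.congr_fun h1 m
  have h2' := fun x m => LinearMap.congr_fun (h2 x) m
  have h3' := fun m => LinearMap.congr_fun h3 m
  simp only [Module.End.mul_apply, Module.End.one_apply, LinearMap.neg_apply] at h1' h2' h3'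
  let θ : Module.End R (M.tensor N).carrier :=
    (TensorProduct.map η 1 : Module.End R (M.carrier ⊗[R] N.carrier))
  have hθ : ∀ m n, θ (M.tmk N m n) = M.tmk N (η m) n := fun m n => rfl
  refine ⟨θ, tensor_hom_ext fun m n => ?_, fun x => tensor_hom_ext fun m n => ?_,
    tensor_hom_ext fun m n => ?_⟩
  · simp [hθ, h1']
  · simp [tensor_c_tmk, hθ, h2', h3']; abel
  · simp [tensor_ε_tmk, hθ, h3']

theorem HasOddInvolution.tensor_left (M : GrMod Q) {N : GrMod Q'} (h : N.HasOddInvolution) :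
    (M.tensor N).HasOddInvolution := by
  obtain ⟨η, h1, h2, h3⟩ := h
  have h1' := fun m => LinearMap.congr_fun h1 m
  have h2' := fun x m => LinearMap.congr_fun (h2 x) m
  have h3' := fun m => LinearMap.congr_fun h3 m
  have h4' := fun x m => LinearMap.congr_fun (M.ε_mul_c x) m
  have h5' := fun m => LinearMap.congr_fun M.ε_mul_self m
  simp only [Module.End.mul_apply, Module.End.one_apply, LinearMap.neg_apply] at h1' h2' h3' h4' h5'
  let θ : Module.End R (M.tensor N).carrier :=
    (TensorProduct.map M.ε η : Module.End R (M.carrier ⊗[R] N.carrier))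
  have hθ : ∀ m n, θ (M.tmk N m n) = M.tmk N (M.ε m) (η n) := fun m n => rfl
  refine ⟨θ, tensor_hom_ext fun m n => ?_, fun x => tensor_hom_ext fun m n => ?_,
    tensor_hom_ext fun m n => ?_⟩
  · simp [hθ, h1', h5']
  · simp [tensor_c_tmk, hθ, h2', h4', h5']; abel
  · simp [tensor_ε_tmk, hθ, h3', h5']

end Closure

end GrMod

namespace GrMod

section TensorProjective

variable {R : Type u} [CommRing R] [Invertible (2 : R)] {U U' : Type u} [AddCommGroup U]
  [Module R U] [AddCommGroup U'] [Module R U'] {Q : QuadraticForm R U} {Q' : QuadraticForm R U'}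

/-- A graded module that is finitely generated and projective has a homogeneous dual basis. -/
theorem IsFGProj.exists_graded_split {M : GrMod Q} (hM : M.IsFGProj) :
    ∃ (n : ℕ) (i : Bool → Fin n → (M.carrier →ₗ[R] CliffordAlgebra Q))
      (x : Bool → Fin n → M.carrier),
      (∀ b j a m, i b j (M.act a m) = a * i b j m) ∧
      (∀ j m, i false j (M.ε m) = CliffordAlgebra.involute (i false j m)) ∧
      (∀ j m, i true j (M.ε m) = -CliffordAlgebra.involute (i true j m)) ∧
      (∀ j, M.ε (x false j) = x false j) ∧ (∀ j, M.ε (x true j) = -x true j) ∧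
      ∀ m, ∑ b, ∑ j, M.act (i b j m) (x b j) = m := by
  obtain ⟨n, i, s, hi, hs, h⟩ := hM.exists_split
  have hεε : ∀ m, M.ε (M.ε m) = m := fun m => LinearMap.congr_fun M.ε_mul_self m
  have hεa : ∀ a m, M.ε (M.act a m) = M.act (CliffordAlgebra.involute a) (M.ε m) := fun a m =>
    LinearMap.congr_fun (M.ε_mul_act a) m
  let y : Fin n → M.carrier := fun j => s (Pi.single j 1)
  have hy : ∀ m, ∑ j, M.act (i m j) (y j) = m := fun m => by
    conv_rhs => rw [← h m, ← Finset.univ_sum_single (i m), map_sum]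
    refine Finset.sum_congr rfl fun j _ => ?_
    rw [← hs]
    congr 1
    ext l
    by_cases hl : l = j
    · subst hl; simp
    · simp [hl]
  let α : CliffordAlgebra Q →ₗ[R] CliffordAlgebra Q := (CliffordAlgebra.involute (Q := Q)).toLinearMap
  let c : Bool → R := fun b => if b then -1 else 1
  refine ⟨n, fun b j => (⅟2 : R) • (LinearMap.proj j ∘ₗ i + c b • (α ∘ₗ LinearMap.proj j ∘ₗ i ∘ₗ M.ε)),
    fun b j => (⅟2 : R) • (y j + c b • M.ε (y j)), ?_, ?_, ?_, ?_, ?_, ?_⟩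
  · intro b j a m
    simp [α, hi, hεa, mul_add]
  · intro j m
    simp [α, c, hεε, add_comm]
  · intro j m
    simp [α, c, hεε, smul_add]
  · intro j
    simp [c, hεε, add_comm]
  · intro j
    simp [c, hεε, smul_add]
  · intro m
    have h1 := hy m
    have h2 : ∑ j, M.act (CliffordAlgebra.involute (i (M.ε m) j)) (M.ε (y j)) = m := by
      have := congrArg M.ε (hy (M.ε m))
      rw [map_sum, hεε] at this
      simpa [hεa] using this
    have h4 : (⅟2 * ⅟2 * 4 : R) = 1 := by
      have : (⅟2 * ⅟2 * 4 : R) = (⅟2 * 2) * (⅟2 * 2) := by ring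
      rw [this]; simp
    have key : ∀ j, ∑ b : Bool, M.act (((⅟2 : R) • (LinearMap.proj j ∘ₗ i + c b • (α ∘ₗ LinearMap.proj j ∘ₗ i ∘ₗ M.ε))) m)
        ((⅟2 : R) • (y j + c b • M.ε (y j))) = (⅟2 * ⅟2 * 2 : R) • (M.act (i m j) (y j) +
          M.act (CliffordAlgebra.involute (i (M.ε m) j)) (M.ε (y j))) := fun j => by
      have h5 : (⅟2 ^ 2 * 2 : R) = ⅟2 := by rw [sq, mul_assoc, invOf_mul_self, mul_one]
      simp [c, α]
      match_scalars <;> first | ring1 | linear_combination h5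
    rw [Finset.sum_comm]
    simp only [key]
    rw [← Finset.smul_sum, Finset.sum_add_distrib, h1, h2, ← two_smul R m, smul_smul]
    rw [show (⅟2 * ⅟2 * 2 * 2 : R) = ⅟2 * ⅟2 * 4 by ring, h4, one_smul]

theorem IsFGProj.tensor {M : GrMod Q} {N : GrMod Q'} (hM : M.IsFGProj) (hN : N.IsFGProj) :
    (M.tensor N).IsFGProj := by
  obtain ⟨n, i, x, hi, hi0, hi1, hx0, hx1, hs⟩ := hM.exists_graded_split
  obtain ⟨n', i', x', hi', -, -, -, -, hs'⟩ := hN.exists_graded_split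
  let jl := CliffordAlgebra.map (QuadraticMap.Isometry.inl Q Q')
  let jr := CliffordAlgebra.map (QuadraticMap.Isometry.inr Q Q')
  let tw : Bool → (CliffordAlgebra Q' →ₐ[R] CliffordAlgebra Q') := fun b =>
    if b then CliffordAlgebra.involute else AlgHom.id R _
  have hcomm : ∀ (a : CliffordAlgebra Q) (u : U'),
      jl (CliffordAlgebra.involute a) * CliffordAlgebra.ι _ ((0, u) : U × U') =
        CliffordAlgebra.ι _ ((0, u) : U × U') * jl a := by
    intro a u
    induction a using CliffordAlgebra.induction with
    | algebraMap r => simp [Algebra.commutes]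
    | ι x =>
      have hx : jl (CliffordAlgebra.ι Q x) = CliffordAlgebra.ι _ ((x, 0) : U × U') :=
        CliffordAlgebra.map_apply_ι _ _
      rw [CliffordAlgebra.involute_ι, map_neg, hx, neg_mul,
        CliffordAlgebra.ι_mul_ι_comm_of_isOrtho (QuadraticMap.IsOrtho.inl_inr x u), neg_neg]
    | mul a b ha hb => rw [map_mul, map_mul, map_mul, mul_assoc, hb, ← mul_assoc, ha, mul_assoc]
    | add a b ha hb => rw [map_add, map_add, map_add, mul_add, add_mul, ha, hb]
  have hf : ∀ (b : Bool) (j : Fin n) (b' : Bool) (j' : Fin n'),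
      ∃ F : (M.tensor N).carrier →ₗ[R] CliffordAlgebra (Q.prod Q'),
        ∀ m m', F (M.tmk N m m') = jl (i b j m) * jr (tw b (i' b' j' m')) := fun b j b' j' =>
    tensor_exists_lift M N (((LinearMap.mul R (CliffordAlgebra (Q.prod Q'))).compl₁₂
      (jl.toLinearMap ∘ₗ i b j) (jr.toLinearMap ∘ₗ (tw b).toLinearMap ∘ₗ i' b' j')))
  choose F hF using hf
  have hFlin : ∀ b j b' j' (z : CliffordAlgebra (Q.prod Q')) (w : (M.tensor N).carrier),
      F b j b' j' ((M.tensor N).act z w) = z * F b j b' j' w := by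
    intro b j b' j' z
    induction z using CliffordAlgebra.induction with
    | algebraMap r => intro w; simp [Algebra.smul_def]
    | mul y z hy hz => intro w; rw [map_mul, Module.End.mul_apply, hy, hz, mul_assoc]
    | add y z hy hz => intro w; rw [map_add, LinearMap.add_apply, map_add, hy, hz, add_mul]
    | ι p =>
      have hl : jl (CliffordAlgebra.ι Q p.1) = CliffordAlgebra.ι _ ((p.1, 0) : U × U') :=
        CliffordAlgebra.map_apply_ι _ _
      have hr : jr (CliffordAlgebra.ι Q' p.2) = CliffordAlgebra.ι _ ((0, p.2) : U × U') :=
        CliffordAlgebra.map_apply_ι _ _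
      have hp : CliffordAlgebra.ι (Q.prod Q') p = jl (CliffordAlgebra.ι Q p.1) +
          jr (CliffordAlgebra.ι Q' p.2) := by
        rw [hl, hr, ← map_add]; simp
      have key : F b j b' j' ∘ₗ (M.tensor N).c p =
          LinearMap.mulLeft R (CliffordAlgebra.ι (Q.prod Q') p) ∘ₗ F b j b' j' := by
        refine tensor_hom_ext fun m m' => ?_
        simp only [LinearMap.comp_apply, tensor_c_tmk, map_add, hF, LinearMap.mulLeft_apply]
        rw [hp, add_mul, ← M.act_ι, hi, map_mul, mul_assoc, ← N.act_ι, hi', map_mul, map_mul]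
        congr 1
        cases b with
        | false =>
          have := hcomm (i false j m) p.2
          rw [hi0, ← mul_assoc, ← mul_assoc, hr]
          simp only [tw, Bool.false_eq_true, if_false, AlgHom.id_apply]
          rw [hr, this]
        | true =>
          have := hcomm (i true j m) p.2
          rw [hi1, ← mul_assoc, ← mul_assoc, hr]
          simp only [tw, if_true, CliffordAlgebra.involute_ι, map_neg]
          rw [hr, neg_mul_neg, this]
      intro w
      rw [act_ι]
      exact LinearMap.congr_fun key w
  refine isFGProj_of_split (ι := Bool × Fin n × Bool × Fin n') _
    (LinearMap.pi fun p => F p.1 p.2.1 p.2.2.1 p.2.2.2)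
    (∑ p : Bool × Fin n × Bool × Fin n', (LinearMap.flip ((M.tensor N).act.toLinearMap) (M.tmk N (x p.1 p.2.1) (x' p.2.2.1 p.2.2.2))) ∘ₗ
      LinearMap.proj p) ?_ ?_ ?_
  · intro a m
    ext p
    simp [hFlin]
  · intro a f
    simp
  · intro w
    have : (∑ p : Bool × Fin n × Bool × Fin n', (LinearMap.flip ((M.tensor N).act.toLinearMap) (M.tmk N (x p.1 p.2.1) (x' p.2.2.1 p.2.2.2))) ∘ₗ
      LinearMap.proj p) ∘ₗ (LinearMap.pi fun p => F p.1 p.2.1 p.2.2.1 p.2.2.2) = LinearMap.id := by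
      refine tensor_hom_ext fun m m' => ?_
      have hterm : ∀ b j b' j', (M.tensor N).act (F b j b' j' (M.tmk N m m'))
          (M.tmk N (x b j) (x' b' j')) =
            M.tmk N (M.act (i b j m) (x b j)) (N.act (i' b' j' m') (x' b' j')) := by
        intro b j b' j'
        rw [hF, map_mul, Module.End.mul_apply]
        cases b with
        | false => 
          rw [tensor_act_inr _ _ _ _ _ (hx0 j), tensor_act_inl]
          rfl
        | true =>
          rw [tensor_act_inr' _ _ _ _ _ (hx1 j), tensor_act_inl]
          simp [tw]
      simp only [LinearMap.comp_apply, LinearMap.sum_apply, LinearMap.flip_apply, LinearMap.pi_apply,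
        LinearMap.proj_apply, AlgHom.toLinearMap_apply, LinearMap.id_apply, hterm]
      simp only [Fintype.sum_prod_type, ← map_sum, hs', ← LinearMap.sum_apply, hs]
    exact LinearMap.congr_fun this w

end TensorProjective
end GrMod

section Products

variable {R : Type u} [CommRing R] {U U' : Type u} [AddCommGroup U] [Module R U]
  [AddCommGroup U'] [Module R U'] {Q : QuadraticForm R U} {Q' : QuadraticForm R U'}

/-- Restriction of scalars along the isomorphism of Clifford algebras induced by an isometry:
`[M] ↦ [M.pullback e]`. -/
def GrK.pull (e : Q.IsometryEquiv Q') : GrK Q' →+ GrK Q :=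
  GrK.lift (fun M => cls (M.pullback e))
    (fun _ _ _ hP hM hN h => cls_sum (hP.pullback e) (hM.pullback e) (hN.pullback e) (h.pullback e))
    (fun _ _ h => cls_eq_zero (h.pullback e))

/-- The product with the class of a fixed graded module. -/
def GrK.mulRight [Invertible (2 : R)] (N : GrMod Q') (hN : N.IsFGProj) :
    GrK Q →+ GrK (Q.prod Q') :=
  GrK.lift (fun M => cls (M.tensor N))
    (fun _ _ _ hP hM hM' h =>
      cls_sum (hP.tensor hN) (hM.tensor hN) (hM'.tensor hN) (h.tensor_right N))
    (fun _ _ h => cls_eq_zero (h.tensor_right N))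

open Classical in
/-- The external product `K(C(U)) × K(C(U')) → K(C(U) ⊗ C(U')) = K(C(U ⊥ U'))`,
`[M] · [N] = [M ⊗ N]`, as a biadditive map; see `GrK.mul_cls`. -/
def GrK.mul [Invertible (2 : R)] (Q : QuadraticForm R U) (Q' : QuadraticForm R U') :
    GrK Q →+ GrK Q' →+ GrK (Q.prod Q') :=
  AddMonoidHom.flip <| GrK.lift (fun N => if hN : N.IsFGProj then GrK.mulRight N hN else 0)
    (fun P N N' hP hN hN' h => by
      rw [dif_pos hP, dif_pos hN, dif_pos hN']
      refine AddMonoidHom.ext fun z => ?_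
      induction z using GrK.induction with
      | h0 => simp
      | hcls M hM =>
        simp only [AddMonoidHom.add_apply, GrK.mulRight, GrK.lift_cls _ _ _ hM]
        exact cls_sum (hM.tensor hP) (hM.tensor hN) (hM.tensor hN') (h.tensor_left M)
      | hneg x hx => rw [map_neg, hx, map_neg]
      | hadd x y hx hy => rw [map_add, map_add, hx, hy])
    (fun N hN h => by
      rw [dif_pos hN]
      refine AddMonoidHom.ext fun z => ?_
      induction z using GrK.induction with
      | h0 => simp
      | hcls M hM =>
        rw [GrK.mulRight, GrK.lift_cls _ _ _ hM]
        exact cls_eq_zero (h.tensor_left M)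
      | hneg x hx => simpa using hx
      | hadd x y hx hy => rw [map_add, map_add, hx, hy])

theorem GrK.mul_cls [Invertible (2 : R)] {M : GrMod Q} {N : GrMod Q'} (hM : M.IsFGProj)
    (hN : N.IsFGProj) : GrK.mul Q Q' (cls M) (cls N) = cls (M.tensor N) := by
  rw [GrK.mul, AddMonoidHom.flip_apply, GrK.lift_cls _ _ _ hN, dif_pos hN, GrK.mulRight, GrK.lift_cls _ _ _ hM]

/-- The ring `Ω_k = ℤ[x]/(Φ_k(x))` of integers of the `k`-th cyclotomic field. -/
abbrev Omega (k : ℕ) : Type := AdjoinRoot (Polynomial.cyclotomic k ℤ)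

/-- The group `K(C(U)) ⊗_ℤ Ω_k`. -/
abbrev GrKOmega (k : ℕ) (Q : QuadraticForm R U) : Type (u + 1) := GrK Q ⊗[ℤ] Omega k

/-- Transport along an isometry with coefficients in `Ω_k`. -/
def GrKOmega.pull (k : ℕ) (e : Q.IsometryEquiv Q') : GrKOmega k Q' →ₗ[ℤ] GrKOmega k Q :=
  TensorProduct.map (GrK.pull e).toIntLinearMap LinearMap.id

/-- The external product with coefficients in `Ω_k`:
`([M] ⊗ a) · ([N] ⊗ b) = [M ⊗ N] ⊗ ab`. -/
def GrKOmega.mul [Invertible (2 : R)] (k : ℕ) (Q : QuadraticForm R U) (Q' : QuadraticForm R U') :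
    GrKOmega k Q →ₗ[ℤ] GrKOmega k Q' →ₗ[ℤ] GrKOmega k (Q.prod Q') :=
  TensorProduct.map₂
    ((addMonoidHomLequivInt ℤ).toLinearMap ∘ₗ (GrK.mul Q Q').toIntLinearMap)
    (LinearMap.mul ℤ (Omega k))

theorem GrKOmega.mul_tmul [Invertible (2 : R)] (k : ℕ) (x : GrK Q) (y : GrK Q') (a b : Omega k) :
    GrKOmega.mul k Q Q' (x ⊗ₜ a) (y ⊗ₜ b) = GrK.mul Q Q' x y ⊗ₜ (a * b) := rfl

end Products

section Bott

variable {R : Type u} [CommRing R] [Invertible (2 : R)]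

/-- The twisted operation on a graded module `M` over `C(V) ⊗ C(W)`:
`∑_j [F_j] ⊗ ω^j`, where `F_j` is the eigenmodule of the untwisted action of the generator of `ℤ/k`
on the `k`-th power for the eigenvalue `ζ^j`, and `ω` is the class of `x` in
`Ω_k = ℤ[x]/(Φ_k(x))`. -/
def twistedOp {V W : Type u} [AddCommGroup V] [Module R V] [AddCommGroup W] [Module R W]
    {p : QuadraticForm R V} {q : QuadraticForm R W} {k : ℕ} (ζ : R) (t : SpinLift k q)
    (M : GrMod (p.prod q)) : GrKOmega k (targetForm k p q) :=
  ∑ j : Fin k, cls (M.eigen t (ζ ^ (j : ℕ))) ⊗ₜ[ℤ]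
    (AdjoinRoot.root (Polynomial.cyclotomic k ℤ) ^ (j : ℕ))

/-- The twisted hermitian Bott class `ρ_k(V)` in `K(C(V(k)) ⊗ C(W^k)) ⊗ Ω_k`, where `W = V(-1)`: the
value of the twisted operation on the class of `C(V)` in `K(C(V) ⊗ C(W))`, which is the image of
`1 ∈ K(R)` by the Morita equivalence. -/
def bottClass {V : Type u} [AddCommGroup V] [Module R V] {k : ℕ} (ζ : R) (Q : QuadraticForm R V)
    (t : SpinLift k (-Q)) : GrKOmega k (targetForm k Q (-Q)) :=
  twistedOp ζ t (GrMod.clifford Q)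

end Bott

section Shuffle

variable {R : Type u} [CommRing R] {V₁ V₂ : Type u} [AddCommGroup V₁] [Module R V₁]
  [AddCommGroup V₂] [Module R V₂]

/-- The isometry `(V₁ ⊥ V₂)(k) ⊥ (W₁ ⊥ W₂)^k ≅ (V₁(k) ⊥ W₁^k) ⊥ (V₂(k) ⊥ W₂^k)`, with `W_i = V_i(-1)`,
that regroups the summands. -/
def shuffle (k : ℕ) (Q₁ : QuadraticForm R V₁) (Q₂ : QuadraticForm R V₂) :
    (targetForm k (Q₁.prod Q₂) (-(Q₁.prod Q₂))).IsometryEquiv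
      ((targetForm k Q₁ (-Q₁)).prod (targetForm k Q₂ (-Q₂))) where
  toFun x := ((x.1.1, fun i => (x.2 i).1), (x.1.2, fun i => (x.2 i).2))
  invFun y := ((y.1.1, y.2.1), fun i => (y.1.2 i, y.2.2 i))
  map_add' _ _ := rfl
  map_smul' _ _ := rfl
  left_inv _ := rfl
  right_inv _ := rfl
  map_app' x := by
    simp [Finset.sum_add_distrib, mul_add]
    abel

end Shuffle

end CliffordBott

end

/-!
The proof reduces every statement about nondegenerate forms to forms of rank one. If `Q` is
nondegenerate, `Q ⊥ -Q` is hyperbolic, and a hyperbolic space of a projective module is an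
orthogonal summand of a sum of copies of `⟨1⟩ ⊥ ⟨-1⟩`. So a property of quadratic forms that holds
for unary forms with unit value and passes to isometric forms, orthogonal sums and orthogonal
summands holds for all nondegenerate forms (`nondegenerate_induction`). It is applied to two
properties. The passage to summands uses the scalar part of an element of a Clifford algebra, which
exists because `2` is invertible, and the slices `C(Q ⊥ Q') = C(Q) ⊗ C(Q') → C(Q)` that it defines.

* `IsSplit Q`: the algebra `C(Q ⊥ -Q)` is the endomorphism algebra of `C(Q)`, and `C(Q)` is finitely
  generated projective over `R`. This makes `C(Q)` a finitely generated projective module over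
  `C(Q ⊥ -Q)` (`IsSplit.isFGProj`), and it shows that the even centre of `C(Q)` is `R`
  (`IsSplit.eq_algebraMap`).
* `HasRotor`: the cyclic shift of `Q ^ k` is induced by an even element whose norm and scalar part
  are units. In rank one this is the product of the `k - 1` reflection vectors `e_n - e_{n+1}`; the
  condition on the scalar part is what makes the rotor of a sum restrict to the summands.

A rotor `x` of norm `r` has `x ^ k = s` with `s ^ 2 = r ^ k`, and it becomes an element of norm `1`
and order `k` of the spin group after multiplication by `r ^ ((k - 1) / 2) / s`. Two such elements
differ by a scalar `c` with `c ^ 2 = c ^ k = 1`, so `c = 1` as `k` is odd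
(`SpinLift.nonempty_unique`).

The map `a ↦ a (1 ⊗ ⋯ ⊗ 1)` is an isomorphism of `C(V ^ k)` with the graded tensor power of `C(V)`
(`powerEquiv`), and it carries the automorphism induced by the shift of the coordinates to the
graded permutation `T`. Hence `T ^ k = 1`, and `T' ^ k = 1` as `T'` commutes with `t`. The
identities between powers of `ζ` that split a module into eigenmodules hold in the domain
`ℤ[x]/(Φ_k)` and are transported to `R`. The eigenmodules are images of idempotents, and they are
finitely generated projective because `C(V ^ k)` is so over `C(V ^ k ⊥ W ^ k)`, where
`V ^ k = V(k) ⊥ V'`, so that `C(V ^ k ⊥ W ^ k)` is itself finitely generated projective over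
`C(V(k) ⊥ W ^ k)` (`isFGProj_power`).

For an orthogonal sum, `C((V₁ ⊥ V₂) ^ k) = C(V₁ ^ k) ⊗ C(V₂ ^ k)` (`powerProd`) identifies `T` with
`T₁ ⊗ T₂`, and uniqueness of the lift gives `t = t₁ t₂`; so `T'` is `T₁' ⊗ T₂'`
(`powerProd_untwisted`). Its eigenmodule for `ζ ^ j` is the sum of the tensor products of the
eigenmodules for `ζ ^ a` and `ζ ^ b` with `a + b ≡ j` modulo `k` (`cls_eigen_prod`), and
multiplicativity follows from the additivity of classes and `ω ^ k = 1`.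
-/

noncomputable section

namespace CliffordBott

open scoped TensorProduct

/-! ### The scalar part of an element of a Clifford algebra -/

section ScalarPart

variable {R : Type u} [CommRing R] {U U' X : Type u} [AddCommGroup U] [Module R U]
  [AddCommGroup U'] [Module R U'] [AddCommGroup X] [Module R X]
  {Q : QuadraticForm R U} {Q' : QuadraticForm R U'} {P : QuadraticForm R X}

/-- Moving a vector `x` past the Clifford algebra of a subspace orthogonal to `x` costs the grading
involution. -/
theorem map_involute_mul_ι (f : Q →qᵢ P) (x : X) (h : ∀ u, P.IsOrtho (f u) x)
    (a : CliffordAlgebra Q) :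
    CliffordAlgebra.map f (CliffordAlgebra.involute a) * CliffordAlgebra.ι P x =
      CliffordAlgebra.ι P x * CliffordAlgebra.map f a := by
  induction a using CliffordAlgebra.induction with
  | algebraMap r => simp [Algebra.commutes]
  | ι u =>
    rw [CliffordAlgebra.involute_ι, map_neg, CliffordAlgebra.map_apply_ι, neg_mul,
      CliffordAlgebra.ι_mul_ι_comm_of_isOrtho (h u), neg_neg]
  | mul a b ha hb => rw [map_mul, map_mul, map_mul, mul_assoc, hb, ← mul_assoc, ha, mul_assoc]
  | add a b ha hb => rw [map_add, map_add, map_add, mul_add, add_mul, ha, hb]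

theorem contractLeft_map (f : Q →qᵢ P) (d : Module.Dual R X) (a : CliffordAlgebra Q) :
    CliffordAlgebra.contractLeft d (CliffordAlgebra.map f a) =
      CliffordAlgebra.map f (CliffordAlgebra.contractLeft (d ∘ₗ f.toLinearMap) a) := by
  induction a using CliffordAlgebra.left_induction with
  | algebraMap r => simp
  | add x y hx hy => simp only [map_add, hx, hy]
  | ι_mul x m hx =>
    rw [map_mul, CliffordAlgebra.map_apply_ι, CliffordAlgebra.contractLeft_ι_mul, hx,
      CliffordAlgebra.contractLeft_ι_mul, map_sub, map_smul, map_mul, CliffordAlgebra.map_apply_ι]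
    rfl

theorem contractLeft_mul_of_eq_zero (d : Module.Dual R X) (a b : CliffordAlgebra P)
    (hb : CliffordAlgebra.contractLeft d b = 0) :
    CliffordAlgebra.contractLeft d (a * b) = CliffordAlgebra.contractLeft d a * b := by
  induction a using CliffordAlgebra.left_induction with
  | algebraMap r =>
    rw [CliffordAlgebra.contractLeft_algebraMap_mul, hb, CliffordAlgebra.contractLeft_algebraMap]
    simp
  | add x y hx hy => simp only [map_add, add_mul, hx, hy]
  | ι_mul x m hx =>
    rw [mul_assoc, CliffordAlgebra.contractLeft_ι_mul, CliffordAlgebra.contractLeft_ι_mul, hx,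
      sub_mul, smul_mul_assoc, mul_assoc]

variable [Invertible (2 : R)]

/-- The scalar part of an element of the Clifford algebra: its component of degree zero under the
identification with the exterior algebra that exists because `2` is invertible. -/
def scalarPart (Q : QuadraticForm R U) : CliffordAlgebra Q →ₗ[R] R :=
  (ExteriorAlgebra.algebraMapInv (R := R) (M := U)).toLinearMap ∘ₗ
    (CliffordAlgebra.equivExterior Q).toLinearMap

theorem equivExterior_ι_mul (v : U) (a : CliffordAlgebra Q) :
    CliffordAlgebra.equivExterior Q (CliffordAlgebra.ι Q v * a) =
      CliffordAlgebra.ι 0 v * CliffordAlgebra.equivExterior Q a +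
        CliffordAlgebra.contractLeft (QuadraticMap.associated (R := R) Q v)
          (CliffordAlgebra.equivExterior Q a) := by
  have := CliffordAlgebra.changeForm_ι_mul
    (CliffordAlgebra.changeForm.associated_neg_proof (Q := Q)) v a
  have h : QuadraticMap.associated (R := R) (-Q) v = -QuadraticMap.associated (R := R) Q v := by
    rw [map_neg, LinearMap.neg_apply]
  rw [h, map_neg CliffordAlgebra.contractLeft, LinearMap.neg_apply, sub_neg_eq_add] at this
  exact this

theorem equivExterior_algebraMap (r : R) :
    CliffordAlgebra.equivExterior Q (algebraMap R _ r) = algebraMap R _ r :=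
  CliffordAlgebra.changeForm_algebraMap CliffordAlgebra.changeForm.associated_neg_proof r

theorem scalarPart_algebraMap (r : R) : scalarPart Q (algebraMap R _ r) = r := by
  rw [scalarPart, LinearMap.comp_apply, LinearEquiv.coe_coe, equivExterior_algebraMap]
  exact ExteriorAlgebra.algebraMap_leftInverse (R := R) U r

theorem scalarPart_one : scalarPart Q 1 = 1 := by
  simpa using scalarPart_algebraMap (Q := Q) 1

/-- This recursion computes the scalar part of a product of vectors. -/
theorem scalarPart_ι_mul (v : U) (a : CliffordAlgebra Q) :
    scalarPart Q (CliffordAlgebra.ι Q v * a) =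
      scalarPart Q (CliffordAlgebra.contractLeft (QuadraticMap.associated (R := R) Q v) a) := by
  have h : CliffordAlgebra.contractLeft (QuadraticMap.associated (R := R) Q v)
      (CliffordAlgebra.equivExterior Q a) = CliffordAlgebra.equivExterior Q
        (CliffordAlgebra.contractLeft (QuadraticMap.associated (R := R) Q v) a) :=
    (CliffordAlgebra.changeForm_contractLeft
      CliffordAlgebra.changeForm.associated_neg_proof _ _).symm
  simp only [scalarPart, LinearMap.comp_apply, LinearEquiv.coe_coe, AlgHom.toLinearMap_apply]
  rw [equivExterior_ι_mul, map_add, map_mul, h]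
  have : ExteriorAlgebra.algebraMapInv (R := R) (CliffordAlgebra.ι (0 : QuadraticForm R U) v) = 0 :=
    ExteriorAlgebra.lift_ι_apply R _ _ v
  rw [this, zero_mul, zero_add]

theorem scalarPart_involute (a : CliffordAlgebra Q) :
    scalarPart Q (CliffordAlgebra.involute a) = scalarPart Q a := by
  have h1 : ∀ a, CliffordAlgebra.equivExterior Q (CliffordAlgebra.involute a) =
      CliffordAlgebra.involute (CliffordAlgebra.equivExterior Q a) := by
    have hd : ∀ (d : Module.Dual R U) (b : CliffordAlgebra (0 : QuadraticForm R U)),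
        CliffordAlgebra.contractLeft d (CliffordAlgebra.involute b) =
          -CliffordAlgebra.involute (CliffordAlgebra.contractLeft d b) := by
      intro d b
      induction b using CliffordAlgebra.left_induction with
      | algebraMap r => simp
      | add x y hx hy => simp only [map_add, hx, hy, neg_add]
      | ι_mul x m hx =>
        simp [CliffordAlgebra.contractLeft_ι_mul, hx]
    intro a
    induction a using CliffordAlgebra.left_induction with
    | algebraMap r =>
      rw [AlgHom.commutes, equivExterior_algebraMap]
      exact (AlgHom.commutes _ r).symm
    | add x y hx hy => rw [map_add, map_add, map_add, hx, hy]; exact (map_add _ _ _).symm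
    | ι_mul x m hx =>
      rw [map_mul, CliffordAlgebra.involute_ι, neg_mul, map_neg, equivExterior_ι_mul, hx, hd,
        equivExterior_ι_mul]
      refine Eq.trans ?_ (map_add CliffordAlgebra.involute _ _).symm
      rw [map_mul, CliffordAlgebra.involute_ι]
      simp
      abel
  have h2 : (ExteriorAlgebra.algebraMapInv (R := R) (M := U)).comp
      (CliffordAlgebra.involute (Q := (0 : QuadraticForm R U))) =
        ExteriorAlgebra.algebraMapInv := by
    ext v
    simp [ExteriorAlgebra.algebraMapInv]
  simp only [scalarPart, LinearMap.comp_apply, LinearEquiv.coe_coe, AlgHom.toLinearMap_apply, h1]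
  exact AlgHom.congr_fun h2 _

/-- The identification of the Clifford algebra with the exterior algebra is multiplicative on
orthogonal subspaces. -/
theorem equivExterior_map_mul_map (f : Q →qᵢ P) (g : Q' →qᵢ P)
    (h : ∀ x y, P.IsOrtho (f x) (g y)) (a : CliffordAlgebra Q) (b : CliffordAlgebra Q') :
    CliffordAlgebra.equivExterior P (CliffordAlgebra.map f a * CliffordAlgebra.map g b) =
      ExteriorAlgebra.map f.toLinearMap (CliffordAlgebra.equivExterior Q a) *
        ExteriorAlgebra.map g.toLinearMap (CliffordAlgebra.equivExterior Q' b) := by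
  have hext : ∀ {Y Z : Type u} [AddCommGroup Y] [Module R Y] [AddCommGroup Z] [Module R Z]
      (l : Y →ₗ[R] Z) (d : Module.Dual R Z) (z : ExteriorAlgebra R Y),
      CliffordAlgebra.contractLeft d (ExteriorAlgebra.map l z) =
        ExteriorAlgebra.map l (CliffordAlgebra.contractLeft (d ∘ₗ l) z) := by
    intro Y Z _ _ _ _ l d z
    exact contractLeft_map { l with map_app' := fun _ => rfl } d z
  have hmap : ∀ {Y : Type u} [AddCommGroup Y] [Module R Y] {q : QuadraticForm R Y} (l : q →qᵢ P)
      (v : Y) (z : ExteriorAlgebra R Y),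
      CliffordAlgebra.ι 0 (l v) * ExteriorAlgebra.map l.toLinearMap z +
        CliffordAlgebra.contractLeft (QuadraticMap.associated (R := R) P (l v))
          (ExteriorAlgebra.map l.toLinearMap z) = ExteriorAlgebra.map l.toLinearMap
        (CliffordAlgebra.ι 0 v * z + CliffordAlgebra.contractLeft
          (QuadraticMap.associated (R := R) q v) z) := by
    intro Y _ _ q l v z
    have h1 : ExteriorAlgebra.map l.toLinearMap (CliffordAlgebra.ι 0 v) =
      CliffordAlgebra.ι 0 (l v) := ExteriorAlgebra.map_apply_ι l.toLinearMap v
    have h2 : (QuadraticMap.associated (R := R) P (l v)) ∘ₗ l.toLinearMap =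
        QuadraticMap.associated (R := R) q v := by
      ext w
      simp [QuadraticMap.associated_apply, ← map_add]
    rw [map_add, map_mul, h1, hext, h2]
  have hg : ∀ b, CliffordAlgebra.equivExterior P (CliffordAlgebra.map g b) =
      ExteriorAlgebra.map g.toLinearMap (CliffordAlgebra.equivExterior Q' b) := by
    intro b
    induction b using CliffordAlgebra.left_induction with
    | algebraMap r =>
      rw [AlgHom.commutes, equivExterior_algebraMap, equivExterior_algebraMap]
      exact (AlgHom.commutes _ r).symm
    | add x y hx hy => simp only [map_add, hx, hy]
    | ι_mul x m hx =>
      rw [map_mul, CliffordAlgebra.map_apply_ι, equivExterior_ι_mul, hx, hmap,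
        equivExterior_ι_mul]
  induction a using CliffordAlgebra.left_induction with
  | algebraMap r =>
    rw [AlgHom.commutes, equivExterior_algebraMap, ← Algebra.smul_def, map_smul, hg,
      Algebra.smul_def]
    congr 1
    exact (AlgHom.commutes (ExteriorAlgebra.map f.toLinearMap) r).symm
  | add x y hx hy => simp only [map_add, add_mul, hx, hy]
  | ι_mul x m hx =>
    have hd : CliffordAlgebra.contractLeft (QuadraticMap.associated (R := R) P (f m))
        (ExteriorAlgebra.map g.toLinearMap (CliffordAlgebra.equivExterior Q' b)) = 0 := by
      have : QuadraticMap.associated (R := R) P (f m) ∘ₗ g.toLinearMap = 0 := by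
        ext y
        exact (QuadraticMap.associated_isOrtho (R := R)).2 (h m y)
      rw [hext, this]
      simp
    rw [map_mul (CliffordAlgebra.map f), CliffordAlgebra.map_apply_ι, mul_assoc,
      equivExterior_ι_mul, hx, contractLeft_mul_of_eq_zero _ _ _ hd, ← mul_assoc]
    refine (add_mul _ _ _).symm.trans ?_
    rw [hmap, equivExterior_ι_mul]

/-- The scalar part is multiplicative on orthogonal subspaces; it is not on the whole algebra. -/
theorem scalarPart_map_mul_map (f : Q →qᵢ P) (g : Q' →qᵢ P)
    (h : ∀ x y, P.IsOrtho (f x) (g y)) (a : CliffordAlgebra Q) (b : CliffordAlgebra Q') :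
    scalarPart P (CliffordAlgebra.map f a * CliffordAlgebra.map g b) =
      scalarPart Q a * scalarPart Q' b := by
  have key : ∀ {Y Z : Type u} [AddCommGroup Y] [Module R Y] [AddCommGroup Z] [Module R Z]
      (l : Y →ₗ[R] Z) (z : ExteriorAlgebra R Y),
      ExteriorAlgebra.algebraMapInv (ExteriorAlgebra.map l z) =
        ExteriorAlgebra.algebraMapInv z := by
    intro Y Z _ _ _ _ l z
    have : (ExteriorAlgebra.algebraMapInv (R := R)).comp (ExteriorAlgebra.map l) =
        ExteriorAlgebra.algebraMapInv := by
      ext v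
      simp [ExteriorAlgebra.algebraMapInv]
    exact AlgHom.congr_fun this z
  simp only [scalarPart, LinearMap.comp_apply, LinearEquiv.coe_coe, AlgHom.toLinearMap_apply]
  rw [equivExterior_map_mul_map f g h, map_mul, key, key]

theorem scalarPart_map (f : Q →qᵢ P) (a : CliffordAlgebra Q) :
    scalarPart P (CliffordAlgebra.map f a) = scalarPart Q a := by
  have := scalarPart_map_mul_map f (f.comp (0 : (0 : QuadraticForm R PUnit.{u + 1}) →qᵢ Q))
    (fun x y => by
      have : (f.comp (0 : (0 : QuadraticForm R PUnit.{u + 1}) →qᵢ Q)) y = 0 := map_zero f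
      rw [this]
      exact QuadraticMap.IsOrtho.zero_right _) a 1
  simpa [scalarPart_one] using this

theorem algebraMap_injective (Q : QuadraticForm R U) :
    Function.Injective (algebraMap R (CliffordAlgebra Q)) :=
  Function.LeftInverse.injective (scalarPart_algebraMap (Q := Q))

end ScalarPart

/-! ### Graded modules and the Clifford algebra of an orthogonal sum -/

namespace GrMod

section Hom

variable {R : Type u} [CommRing R] {U U' X : Type u} [AddCommGroup U] [Module R U]
  [AddCommGroup U'] [Module R U'] [AddCommGroup X] [Module R X]
  {Q : QuadraticForm R U} {Q' : QuadraticForm R U'} {P : QuadraticForm R X}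

/-- A map that commutes with the vectors, along an isometry `g`, commutes with the whole Clifford
algebra. -/
theorem hom_act (M : GrMod Q) (N : GrMod P) (g : Q →qᵢ P) (f : M.carrier →ₗ[R] N.carrier)
    (h : ∀ x m, f (M.c x m) = N.c (g x) (f m)) (a : CliffordAlgebra Q) (m : M.carrier) :
    f (M.act a m) = N.act (CliffordAlgebra.map g a) (f m) := by
  induction a using CliffordAlgebra.induction generalizing m with
  | algebraMap r => simp
  | ι x => rw [act_ι, CliffordAlgebra.map_apply_ι, act_ι, h]
  | mul a b ha hb => rw [map_mul, Module.End.mul_apply, ha, hb, map_mul, map_mul,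
      Module.End.mul_apply]
  | add a b ha hb => rw [map_add, LinearMap.add_apply, map_add, ha, hb, map_add, map_add,
      LinearMap.add_apply]

theorem hom_act' (M N : GrMod Q) (f : M.carrier →ₗ[R] N.carrier)
    (h : ∀ x m, f (M.c x m) = N.c x (f m)) (a : CliffordAlgebra Q) (m : M.carrier) :
    f (M.act a m) = N.act a (f m) := by
  have := hom_act M N (QuadraticMap.Isometry.id Q) f h a m
  rwa [CliffordAlgebra.map_id] at this

theorem ε_ε (M : GrMod Q) (m : M.carrier) : M.ε (M.ε m) = m :=
  LinearMap.congr_fun M.ε_mul_self m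

theorem ε_act (M : GrMod Q) (a : CliffordAlgebra Q) (m : M.carrier) :
    M.ε (M.act a m) = M.act (CliffordAlgebra.involute a) (M.ε m) :=
  LinearMap.congr_fun (M.ε_mul_act a) m

theorem exists_even_add_odd [Invertible (2 : R)] (M : GrMod Q) (m : M.carrier) :
    ∃ m₀ m₁, m = m₀ + m₁ ∧ M.ε m₀ = m₀ ∧ M.ε m₁ = -m₁ := by
  refine ⟨(⅟2 : R) • (m + M.ε m), (⅟2 : R) • (m - M.ε m), ?_, ?_, ?_⟩
  · rw [← smul_add, add_add_sub_cancel, ← two_smul R m, smul_smul, invOf_mul_self, one_smul]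
  · rw [map_smul, map_add, ε_ε, add_comm]
  · rw [map_smul, map_sub, ε_ε, ← smul_neg, neg_sub]

/-- The Clifford algebra as a graded left module over itself. -/
def reg (Q : QuadraticForm R U) : GrMod Q where
  carrier := CliffordAlgebra Q
  c := LinearMap.mul R (CliffordAlgebra Q) ∘ₗ CliffordAlgebra.ι Q
  c_mul_self := fun x => by
    ext a
    simp [← mul_assoc, CliffordAlgebra.ι_sq_scalar, Algebra.smul_def]
  ε := (CliffordAlgebra.involute (Q := Q)).toLinearMap
  ε_mul_self := by ext a; simp
  ε_mul_c := fun x => by ext a; simp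

/-- The identification of `C(Q)` with the carrier of its regular module. -/
def toReg (Q : QuadraticForm R U) : CliffordAlgebra Q ≃ₗ[R] (reg Q).carrier :=
  LinearEquiv.refl R (CliffordAlgebra Q)

theorem reg_c (x : U) (a : CliffordAlgebra Q) :
    (reg Q).c x (toReg Q a) = toReg Q (CliffordAlgebra.ι Q x * a) := rfl

theorem reg_ε (a : CliffordAlgebra Q) :
    (reg Q).ε (toReg Q a) = toReg Q (CliffordAlgebra.involute a) := rfl

theorem reg_act (a b : CliffordAlgebra Q) :
    (reg Q).act a (toReg Q b) = toReg Q (a * b) := by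
  induction a using CliffordAlgebra.induction generalizing b with
  | algebraMap r => simp [← Algebra.smul_def]
  | ι x => rw [act_ι, reg_c]
  | mul a c ha hc => rw [map_mul, Module.End.mul_apply, hc, ha, mul_assoc]
  | add a c ha hc => rw [map_add, LinearMap.add_apply, hc, ha, add_mul, map_add]

/-- The identification of `C(V)` with the carrier of the bimodule `C(V)`. -/
def toClifford (Q : QuadraticForm R U) : CliffordAlgebra Q ≃ₗ[R] (clifford Q).carrier :=
  LinearEquiv.refl R (CliffordAlgebra Q)

theorem clifford_c (x : U × U) (a : CliffordAlgebra Q) :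
    (clifford Q).c x (toClifford Q a) = toClifford Q (CliffordAlgebra.ι Q x.1 * a +
      CliffordAlgebra.involute a * CliffordAlgebra.ι Q x.2) := rfl

theorem clifford_ε (a : CliffordAlgebra Q) :
    (clifford Q).ε (toClifford Q a) = toClifford Q (CliffordAlgebra.involute a) := rfl

/-- The left action of `C(V)` in the bimodule `C(V)` is left multiplication. -/
theorem clifford_act_inl (a b : CliffordAlgebra Q) :
    (clifford Q).act (CliffordAlgebra.map (QuadraticMap.Isometry.inl Q (-Q)) a)
      (toClifford Q b) = toClifford Q (a * b) := by
  induction a using CliffordAlgebra.induction generalizing b with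
  | algebraMap r => simp [← Algebra.smul_def]
  | ι x =>
    rw [CliffordAlgebra.map_apply_ι, act_ι, clifford_c]
    simp
  | mul a c ha hc => rw [map_mul, map_mul, Module.End.mul_apply, hc, ha, mul_assoc]
  | add a c ha hc => rw [map_add, map_add, LinearMap.add_apply, hc, ha, add_mul, map_add]

end Hom

section TensorAction

variable {R : Type u} [CommRing R] {U U' : Type u} [AddCommGroup U] [Module R U]
  [AddCommGroup U'] [Module R U'] {Q : QuadraticForm R U} {Q' : QuadraticForm R U'}

theorem isOrtho_inl_inr (x : U) (y : U') :
    (Q.prod Q').IsOrtho (QuadraticMap.Isometry.inl Q Q' x) (QuadraticMap.Isometry.inr Q Q' y) :=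
  QuadraticMap.IsOrtho.inl_inr x y

theorem isOrtho_inr_inl (x : U) (y : U') :
    (Q.prod Q').IsOrtho (QuadraticMap.Isometry.inr Q Q' y) (QuadraticMap.Isometry.inl Q Q' x) :=
  (isOrtho_inl_inr x y).symm

theorem tensor_act_inr_even [Invertible (2 : R)] (M : GrMod Q) (N : GrMod Q')
    (b : CliffordAlgebra Q') (hb : CliffordAlgebra.involute b = b) (m : M.carrier)
    (n : N.carrier) :
    (M.tensor N).act (CliffordAlgebra.map (QuadraticMap.Isometry.inr Q Q') b) (M.tmk N m n) =
      M.tmk N m (N.act b n) := by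
  obtain ⟨m₀, m₁, rfl, h0, h1⟩ := M.exists_even_add_odd m
  simp only [map_add, LinearMap.add_apply]
  rw [tensor_act_inr _ _ _ _ _ h0, tensor_act_inr' _ _ _ _ _ h1, hb]

theorem tensor_act_inr_odd [Invertible (2 : R)] (M : GrMod Q) (N : GrMod Q')
    (b : CliffordAlgebra Q') (hb : CliffordAlgebra.involute b = -b) (m : M.carrier)
    (n : N.carrier) :
    (M.tensor N).act (CliffordAlgebra.map (QuadraticMap.Isometry.inr Q Q') b) (M.tmk N m n) =
      M.tmk N (M.ε m) (N.act b n) := by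
  obtain ⟨m₀, m₁, rfl, h0, h1⟩ := M.exists_even_add_odd m
  simp only [map_add, LinearMap.add_apply]
  rw [tensor_act_inr _ _ _ _ _ h0, tensor_act_inr' _ _ _ _ _ h1, hb, h0, h1]
  simp

variable (Q Q') in
/-- The multiplication map `C(Q) ⊗ C(Q') → C(Q ⊥ Q')`. -/
def mulMap : CliffordAlgebra Q ⊗[R] CliffordAlgebra Q' →ₗ[R] CliffordAlgebra (Q.prod Q') :=
  TensorProduct.lift ((LinearMap.mul R (CliffordAlgebra (Q.prod Q'))).compl₁₂
    (CliffordAlgebra.map (QuadraticMap.Isometry.inl Q Q')).toLinearMap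
    (CliffordAlgebra.map (QuadraticMap.Isometry.inr Q Q')).toLinearMap)

theorem mulMap_tmul (a : CliffordAlgebra Q) (b : CliffordAlgebra Q') :
    mulMap Q Q' (a ⊗ₜ b) = CliffordAlgebra.map (QuadraticMap.Isometry.inl Q Q') a *
      CliffordAlgebra.map (QuadraticMap.Isometry.inr Q Q') b := rfl

theorem ι_prod (x : U) (y : U') : CliffordAlgebra.ι (Q.prod Q') (x, y) =
    CliffordAlgebra.map (QuadraticMap.Isometry.inl Q Q') (CliffordAlgebra.ι Q x) +
      CliffordAlgebra.map (QuadraticMap.Isometry.inr Q Q') (CliffordAlgebra.ι Q' y) := by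
  rw [CliffordAlgebra.map_apply_ι, CliffordAlgebra.map_apply_ι, ← map_add]
  simp

theorem ι_inr_mul_map_inl (y : U') (a : CliffordAlgebra Q) :
    CliffordAlgebra.map (QuadraticMap.Isometry.inr Q Q') (CliffordAlgebra.ι Q' y) *
      CliffordAlgebra.map (QuadraticMap.Isometry.inl Q Q') a =
    CliffordAlgebra.map (QuadraticMap.Isometry.inl Q Q') (CliffordAlgebra.involute a) *
      CliffordAlgebra.map (QuadraticMap.Isometry.inr Q Q') (CliffordAlgebra.ι Q' y) := by
  rw [CliffordAlgebra.map_apply_ι, map_involute_mul_ι _ _ fun u => isOrtho_inl_inr u y]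

theorem ι_inl_mul_map_inr (x : U) (b : CliffordAlgebra Q') :
    CliffordAlgebra.map (QuadraticMap.Isometry.inl Q Q') (CliffordAlgebra.ι Q x) *
      CliffordAlgebra.map (QuadraticMap.Isometry.inr Q Q') b =
    CliffordAlgebra.map (QuadraticMap.Isometry.inr Q Q') (CliffordAlgebra.involute b) *
      CliffordAlgebra.map (QuadraticMap.Isometry.inl Q Q') (CliffordAlgebra.ι Q x) := by
  rw [CliffordAlgebra.map_apply_ι, map_involute_mul_ι _ _ fun u => isOrtho_inr_inl x u]

theorem ι_mul_mulMap_tmul (x : U × U') (a : CliffordAlgebra Q) (b : CliffordAlgebra Q') :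
    CliffordAlgebra.ι (Q.prod Q') x * mulMap Q Q' (a ⊗ₜ b) =
      mulMap Q Q' ((CliffordAlgebra.ι Q x.1 * a) ⊗ₜ b +
        CliffordAlgebra.involute a ⊗ₜ (CliffordAlgebra.ι Q' x.2 * b)) := by
  obtain ⟨x, y⟩ := x
  rw [map_add, mulMap_tmul, mulMap_tmul, mulMap_tmul, ι_prod, add_mul, map_mul, map_mul,
    mul_assoc, ← mul_assoc (CliffordAlgebra.map (QuadraticMap.Isometry.inr Q Q') _),
    ι_inr_mul_map_inl, mul_assoc]

theorem mulMap_surjective : Function.Surjective (mulMap Q Q') := by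
  intro z
  induction z using CliffordAlgebra.left_induction with
  | algebraMap r =>
    refine ⟨algebraMap R _ r ⊗ₜ 1, ?_⟩
    rw [mulMap_tmul, map_one, mul_one, AlgHom.commutes]
  | add x y hx hy =>
    obtain ⟨x, rfl⟩ := hx
    obtain ⟨y, rfl⟩ := hy
    exact ⟨x + y, map_add _ _ _⟩
  | ι_mul x m hx =>
    obtain ⟨x, rfl⟩ := hx
    induction x using TensorProduct.induction_on with
    | zero => exact ⟨0, by simp⟩
    | tmul a b => exact ⟨_, (ι_mul_mulMap_tmul m a b).symm⟩
    | add y z hy hz =>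
      obtain ⟨y', hy⟩ := hy
      obtain ⟨z', hz⟩ := hz
      exact ⟨y' + z', by rw [map_add, map_add, mul_add, hy, hz]⟩

/-- A left inverse of the multiplication map is the orbit map of `1 ⊗ 1` in the tensor product of
the regular modules. -/
theorem mulMap_bijective : Function.Bijective (mulMap Q Q') := by
  refine ⟨?_, mulMap_surjective⟩
  let one : ((reg Q).tensor (reg Q')).carrier := (reg Q).tmk (reg Q') (toReg Q 1) (toReg Q' 1)
  obtain ⟨F, hF⟩ := tensor_exists_lift (reg Q) (reg Q')
    ((TensorProduct.mk R (CliffordAlgebra Q) (CliffordAlgebra Q')).compl₁₂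
      (toReg Q).symm.toLinearMap (toReg Q').symm.toLinearMap)
  let κ : CliffordAlgebra (Q.prod Q') →ₗ[R] CliffordAlgebra Q ⊗[R] CliffordAlgebra Q' :=
    F ∘ₗ LinearMap.flip (((reg Q).tensor (reg Q')).act.toLinearMap) one
  have h : κ ∘ₗ mulMap Q Q' = LinearMap.id := by
    refine TensorProduct.ext' fun a b => ?_
    have h1 : (reg Q).ε (toReg Q 1) = toReg Q 1 := by rw [reg_ε, map_one]
    simp only [κ, one, LinearMap.comp_apply, LinearMap.flip_apply, AlgHom.toLinearMap_apply]
    rw [mulMap_tmul, map_mul, Module.End.mul_apply, tensor_act_inr _ _ _ _ _ h1, tensor_act_inl,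
      reg_act, reg_act, mul_one, mul_one, hF]
    simp
  exact Function.LeftInverse.injective (g := κ) (LinearMap.congr_fun h)

variable (Q Q') in
/-- The isomorphism `C(Q) ⊗ C(Q') ≅ C(Q ⊥ Q')`. -/
def mulEquiv :
    CliffordAlgebra Q ⊗[R] CliffordAlgebra Q' ≃ₗ[R] CliffordAlgebra (Q.prod Q') :=
  LinearEquiv.ofBijective (mulMap Q Q') mulMap_bijective

end TensorAction
end GrMod

/-! ### Split forms -/

section Split

variable {R : Type u} [CommRing R] {U U' X : Type u} [AddCommGroup U] [Module R U]
  [AddCommGroup U'] [Module R U'] [AddCommGroup X] [Module R X]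
  {Q : QuadraticForm R U} {Q' : QuadraticForm R U'} {P : QuadraticForm R X}

theorem exists_involute_even_add_odd [Invertible (2 : R)] (a : CliffordAlgebra Q) :
    ∃ a₀ a₁, a = a₀ + a₁ ∧ CliffordAlgebra.involute a₀ = a₀ ∧
      CliffordAlgebra.involute a₁ = -a₁ := by
  obtain ⟨m₀, m₁, h, h0, h1⟩ := (GrMod.reg Q).exists_even_add_odd (GrMod.toReg Q a)
  exact ⟨m₀, m₁, h, h0, h1⟩

variable (Q Q') in
/-- The map `C(Q ⊥ Q') → C(Q)` that applies a functional on `C(Q')` to the second factor of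
`C(Q ⊥ Q') = C(Q) ⊗ C(Q')`. -/
def sliceLeft (φ : CliffordAlgebra Q' →ₗ[R] R) :
    CliffordAlgebra (Q.prod Q') →ₗ[R] CliffordAlgebra Q :=
  (TensorProduct.rid R (CliffordAlgebra Q)).toLinearMap ∘ₗ
    TensorProduct.map LinearMap.id φ ∘ₗ (GrMod.mulEquiv Q Q').symm.toLinearMap

variable (Q Q') in
/-- The map `C(Q ⊥ Q') → C(Q')` that applies a functional on `C(Q)` to the first factor of
`C(Q ⊥ Q') = C(Q) ⊗ C(Q')`. -/
def sliceRight (φ : CliffordAlgebra Q →ₗ[R] R) :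
    CliffordAlgebra (Q.prod Q') →ₗ[R] CliffordAlgebra Q' :=
  (TensorProduct.lid R (CliffordAlgebra Q')).toLinearMap ∘ₗ
    TensorProduct.map φ LinearMap.id ∘ₗ (GrMod.mulEquiv Q Q').symm.toLinearMap

theorem mulEquiv_symm_inl_mul_inr (a : CliffordAlgebra Q) (b : CliffordAlgebra Q') :
    (GrMod.mulEquiv Q Q').symm (CliffordAlgebra.map (QuadraticMap.Isometry.inl Q Q') a *
      CliffordAlgebra.map (QuadraticMap.Isometry.inr Q Q') b) = a ⊗ₜ b :=
  (GrMod.mulEquiv Q Q').symm_apply_apply (a ⊗ₜ b)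

theorem sliceLeft_inl_mul_inr (φ : CliffordAlgebra Q' →ₗ[R] R) (a : CliffordAlgebra Q)
    (b : CliffordAlgebra Q') :
    sliceLeft Q Q' φ (CliffordAlgebra.map (QuadraticMap.Isometry.inl Q Q') a *
      CliffordAlgebra.map (QuadraticMap.Isometry.inr Q Q') b) = φ b • a := by
  rw [sliceLeft, LinearMap.comp_apply, LinearMap.comp_apply, LinearEquiv.coe_coe,
    LinearEquiv.coe_coe, mulEquiv_symm_inl_mul_inr, TensorProduct.map_tmul,
    TensorProduct.rid_tmul, LinearMap.id_apply]

theorem sliceRight_inl_mul_inr (φ : CliffordAlgebra Q →ₗ[R] R) (a : CliffordAlgebra Q)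
    (b : CliffordAlgebra Q') :
    sliceRight Q Q' φ (CliffordAlgebra.map (QuadraticMap.Isometry.inl Q Q') a *
      CliffordAlgebra.map (QuadraticMap.Isometry.inr Q Q') b) = φ a • b := by
  rw [sliceRight, LinearMap.comp_apply, LinearMap.comp_apply, LinearEquiv.coe_coe,
    LinearEquiv.coe_coe, mulEquiv_symm_inl_mul_inr, TensorProduct.map_tmul,
    TensorProduct.lid_tmul, LinearMap.id_apply]

/-- To check an additive property on `C(Q ⊥ Q')` it is enough to check it on products of elements of
the two factors. -/
theorem prod_induction {motive : CliffordAlgebra (Q.prod Q') → Prop}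
    (z : CliffordAlgebra (Q.prod Q')) (h0 : motive 0)
    (hmul : ∀ a b, motive (CliffordAlgebra.map (QuadraticMap.Isometry.inl Q Q') a *
      CliffordAlgebra.map (QuadraticMap.Isometry.inr Q Q') b))
    (hadd : ∀ x y, motive x → motive y → motive (x + y)) : motive z := by
  obtain ⟨z, rfl⟩ := GrMod.mulMap_surjective z
  induction z using TensorProduct.induction_on with
  | zero => rwa [map_zero]
  | tmul a b => exact hmul a b
  | add x y hx hy => rw [map_add]; exact hadd _ _ hx hy

theorem sliceLeft_inl (φ : CliffordAlgebra Q' →ₗ[R] R) (a : CliffordAlgebra Q) :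
    sliceLeft Q Q' φ (CliffordAlgebra.map (QuadraticMap.Isometry.inl Q Q') a) = φ 1 • a := by
  simpa using sliceLeft_inl_mul_inr (Q' := Q') φ a 1

/-- The Clifford algebra `C(Q)` is a finitely generated projective module over the ground ring, and
its bimodule structure identifies `C(Q ⊥ -Q)` with `End C(Q)`. -/
structure IsSplit (Q : QuadraticForm R U) : Prop where
  bijective : Function.Bijective (GrMod.clifford Q).act
  finite : Module.Finite R (CliffordAlgebra Q)
  projective : Module.Projective R (CliffordAlgebra Q)

/-- Whether `C(Q)` is the full endomorphism algebra of a module only depends on the isomorphism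
class of the module over an isometry. -/
theorem GrMod.act_bijective_iff (M : GrMod Q) (N : GrMod P) (e : Q.IsometryEquiv P)
    (f : M.carrier ≃ₗ[R] N.carrier) (h : ∀ x m, f (M.c x m) = N.c (e x) (f m)) :
    Function.Bijective M.act ↔ Function.Bijective N.act := by
  have key : ⇑f.conj ∘ M.act = N.act ∘ CliffordAlgebra.equivOfIsometry e := by
    funext z
    refine LinearMap.ext fun n => ?_
    have := GrMod.hom_act M N e.toIsometry f.toLinearMap h z (f.symm n)
    simpa [LinearEquiv.conj_apply] using this
  rw [← Function.Bijective.of_comp_iff' f.conj.bijective, key,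
    Function.Bijective.of_comp_iff _ (CliffordAlgebra.equivOfIsometry e).bijective]

/-- An isometry of `Q` and `P` gives an isometry of `Q ⊥ -Q` and `P ⊥ -P`. -/
def double (e : Q.IsometryEquiv P) : (Q.prod (-Q)).IsometryEquiv (P.prod (-P)) where
  toLinearEquiv := e.toLinearEquiv.prodCongr e.toLinearEquiv
  map_app' x := by
    change P (e x.1) + -P (e x.2) = Q x.1 + -Q x.2
    rw [e.map_app, e.map_app]

theorem clifford_congr_c (e : Q.IsometryEquiv P) (x : U × U) (a : CliffordAlgebra Q) :
    GrMod.toClifford P (CliffordAlgebra.equivOfIsometry e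
      ((GrMod.toClifford Q).symm ((GrMod.clifford Q).c x (GrMod.toClifford Q a)))) =
    (GrMod.clifford P).c (double e x)
      (GrMod.toClifford P (CliffordAlgebra.equivOfIsometry e a)) := by
  rw [GrMod.clifford_c, GrMod.clifford_c, LinearEquiv.symm_apply_apply, map_add, map_mul, map_mul]
  simp only [CliffordAlgebra.equivOfIsometry_apply, CliffordAlgebra.map_apply_ι]
  have : ∀ a, CliffordAlgebra.map e.toIsometry (CliffordAlgebra.involute a) =
      CliffordAlgebra.involute (CliffordAlgebra.map e.toIsometry a) := by
    intro a
    have : (CliffordAlgebra.map e.toIsometry).comp CliffordAlgebra.involute =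
      (CliffordAlgebra.involute).comp (CliffordAlgebra.map e.toIsometry) := by
        ext x
        simp
    exact AlgHom.congr_fun this a
  rw [this]
  rfl

theorem IsSplit.of_isometryEquiv (hQ : IsSplit Q) (e : Q.IsometryEquiv P) : IsSplit P := by
  refine ⟨?_, ?_, ?_⟩
  · refine (GrMod.act_bijective_iff (GrMod.clifford Q) (GrMod.clifford P) (double e)
      ((GrMod.toClifford Q).symm.trans ((CliffordAlgebra.equivOfIsometry e).toLinearEquiv.trans
        (GrMod.toClifford P))) fun x m => ?_).1 hQ.bijective
    obtain ⟨a, rfl⟩ := (GrMod.toClifford Q).surjective m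
    have := clifford_congr_c e x a
    simpa using this
  · have := hQ.finite
    exact Module.Finite.equiv (CliffordAlgebra.equivOfIsometry e).toLinearEquiv
  · have := hQ.projective
    exact Module.Projective.of_equiv (CliffordAlgebra.equivOfIsometry e).toLinearEquiv

/-- The module `C(Q)` is a direct summand of `C(Q ⊥ -Q) = End C(Q)`: the inclusion sends `m` to the
endomorphism `x ↦ scalarPart x • m`, and the retraction is evaluation at `1`. -/
theorem IsSplit.isFGProj [Invertible (2 : R)] (hQ : IsSplit Q) : (GrMod.clifford Q).IsFGProj := by
  let φ : CliffordAlgebra (Q.prod (-Q)) ≃ₐ[R] Module.End R (GrMod.clifford Q).carrier :=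
    AlgEquiv.ofBijective (GrMod.clifford Q).act hQ.bijective
  have hφ : ∀ z, φ z = (GrMod.clifford Q).act z := fun z => rfl
  let l : (GrMod.clifford Q).carrier →ₗ[R] R :=
    scalarPart Q ∘ₗ (GrMod.toClifford Q).symm.toLinearMap
  let one := GrMod.toClifford Q 1
  have hl : l one = 1 := by simp [l, one, scalarPart_one]
  -- `i m` is the element that acts as `x ↦ l x • m`
  let i : (GrMod.clifford Q).carrier →ₗ[R] CliffordAlgebra (Q.prod (-Q)) :=
    φ.symm.toLinearMap ∘ₗ LinearMap.smulRightₗ l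
  have hi : ∀ m x, (GrMod.clifford Q).act (i m) x = l x • m := fun m x => by
    rw [← hφ]
    simp [i]
  refine GrMod.isFGProj_of_split (ι := Unit) _ (LinearMap.pi fun _ => i)
    (LinearMap.flip (GrMod.clifford Q).act.toLinearMap one ∘ₗ LinearMap.proj ()) ?_ ?_ ?_
  · intro a m
    ext
    apply hQ.bijective.1
    refine LinearMap.ext fun x => ?_
    simp [hi]
  · intro a f
    simp
  · intro m
    simp [hi, hl]

end Split

section Tensor

variable {R : Type u} [CommRing R] [Invertible (2 : R)] {U U' : Type u} [AddCommGroup U]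
  [Module R U] [AddCommGroup U'] [Module R U'] {Q : QuadraticForm R U} {Q' : QuadraticForm R U'}

namespace GrMod

/-- If `M ⊗ N` is a faithful and full module, in the sense that the Clifford algebra maps
isomorphically to its endomorphisms, and `N` has an even vector on which an even functional takes
the value `1`, then `M` is faithful and full. -/
theorem act_bijective_of_tensor (M : GrMod Q) (N : GrMod Q') (l : N.carrier →ₗ[R] R)
    (n : N.carrier) (hln : l n = 1) (hn : N.ε n = n) (hl : ∀ x, l (N.ε x) = l x)
    (h : Function.Bijective (M.tensor N).act) : Function.Bijective M.act := by
  constructor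
  · rw [injective_iff_map_eq_zero]
    intro z hz
    have h1 : (M.tensor N).act (CliffordAlgebra.map (QuadraticMap.Isometry.inl Q Q') z) = 0 := by
      refine tensor_hom_ext fun m n => ?_
      rw [tensor_act_inl, hz]
      simp
    rw [← map_zero (M.tensor N).act] at h1
    have h2 := congrArg (sliceLeft Q Q' (scalarPart Q')) (h.1 h1)
    rwa [sliceLeft_inl, scalarPart_one, one_smul, map_zero] at h2
  · intro T
    obtain ⟨T', hT'⟩ := tensor_exists_lift M N ((M.tmk N).compl₁₂ T LinearMap.id)
    obtain ⟨Z, hZ⟩ := h.2 T'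
    obtain ⟨L, hL⟩ := tensor_exists_lift M N (LinearMap.lsmul R M.carrier ∘ₗ l).flip
    have key : ∀ m, L ((M.tensor N).act Z (M.tmk N m n)) =
        M.act (sliceLeft Q Q' (l ∘ₗ LinearMap.flip N.act.toLinearMap n) Z) m := by
      intro m
      clear hZ
      induction Z using prod_induction with
      | h0 => simp
      | hadd x y hx hy => simp only [map_add, LinearMap.add_apply, hx, hy]
      | hmul a b =>
        rw [sliceLeft_inl_mul_inr]
        obtain ⟨b₀, b₁, rfl, h0, h1⟩ := exists_involute_even_add_odd b
        have hb1 : l (N.act b₁ n) = 0 := by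
          have h3 := hl (N.act b₁ n)
          rw [ε_act, h1, hn, map_neg, LinearMap.neg_apply, map_neg] at h3
          have h4 : (2 : R) * l (N.act b₁ n) = 0 := by linear_combination -h3
          simpa using congrArg (fun x => ⅟(2 : R) * x) h4
        simp only [map_add, map_mul, mul_add, LinearMap.add_apply, Module.End.mul_apply]
        rw [tensor_act_inr_even _ _ _ h0, tensor_act_inr_odd _ _ _ h1, tensor_act_inl,
          tensor_act_inl, hL, hL]
        simp [hb1]
    refine ⟨sliceLeft Q Q' (l ∘ₗ LinearMap.flip N.act.toLinearMap n) Z, LinearMap.ext fun m => ?_⟩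
    rw [← key, hZ, hT']
    simp [hL, hln]

/-- Endomorphisms of the underlying modules satisfy `End M ⊗ End N = End (M ⊗ N)`. The action of the
graded tensor product differs from the ungraded one by the grading of `M` in front of odd elements
of the second factor, and this grading is itself the action of an element `e` of `C(Q)`. -/
theorem act_bijective_tensor (M : GrMod Q) (N : GrMod Q') [Module.Finite R M.carrier]
    [Module.Projective R M.carrier] [Module.Finite R N.carrier] [Module.Projective R N.carrier]
    (hM : Function.Bijective M.act) (hN : Function.Bijective N.act) :
    Function.Bijective (M.tensor N).act := by
  obtain ⟨e, he⟩ := hM.2 M.ε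
  have hee : e * e = 1 := hM.1 (by rw [map_mul, he, M.ε_mul_self, map_one])
  let π : R → (CliffordAlgebra Q' →ₗ[R] CliffordAlgebra Q') := fun s =>
    (⅟2 : R) • (LinearMap.id + s • (CliffordAlgebra.involute (Q := Q')).toLinearMap)
  -- the twist that accounts for the sign rule
  let τ : CliffordAlgebra Q ⊗[R] CliffordAlgebra Q' →ₗ[R]
      CliffordAlgebra Q ⊗[R] CliffordAlgebra Q' :=
    TensorProduct.map LinearMap.id (π 1) + TensorProduct.map (LinearMap.mulRight R e) (π (-1))
  have hπ0 : ∀ b, CliffordAlgebra.involute b = b → π 1 b = b ∧ π (-1) b = 0 := by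
    intro b hb
    simp [π, hb, ← two_smul R, smul_smul]
  have hπ1 : ∀ b, CliffordAlgebra.involute b = -b → π 1 b = 0 ∧ π (-1) b = b := by
    intro b hb
    simp [π, hb, ← two_smul R, smul_smul]
  have hτ0 : ∀ a b, CliffordAlgebra.involute b = b → τ (a ⊗ₜ b) = a ⊗ₜ b := by
    intro a b hb
    simp [τ, hπ0 b hb]
  have hτ1 : ∀ a b, CliffordAlgebra.involute b = -b → τ (a ⊗ₜ b) = (a * e) ⊗ₜ b := by
    intro a b hb
    simp [τ, hπ1 b hb]
  have hττ : τ ∘ₗ τ = LinearMap.id := by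
    refine TensorProduct.ext' fun a b => ?_
    obtain ⟨b₀, b₁, rfl, h0, h1⟩ := exists_involute_even_add_odd b
    simp [TensorProduct.tmul_add, hτ0 _ _ h0, hτ1 _ _ h1, mul_assoc, hee]
  have hτ : Function.Bijective τ :=
    Function.bijective_iff_has_inverse.2 ⟨τ, LinearMap.congr_fun hττ, LinearMap.congr_fun hττ⟩
  let Φ := TensorProduct.congr (AlgEquiv.ofBijective M.act hM).toLinearEquiv
    (AlgEquiv.ofBijective N.act hN).toLinearEquiv
  have hΦ : ∀ a b, Φ (a ⊗ₜ b) = M.act a ⊗ₜ N.act b := fun a b => rfl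
  let H := homTensorHomEquiv R M.carrier N.carrier M.carrier N.carrier
  let toE : Module.End R (M.carrier ⊗[R] N.carrier) → Module.End R (M.tensor N).carrier := id
  have hE : ∀ f m n, toE f (M.tmk N m n) = f (m ⊗ₜ n) := fun f m n => rfl
  have hH : ∀ (f : Module.End R M.carrier) (g : Module.End R N.carrier) m n,
      toE (H (f ⊗ₜ g)) (M.tmk N m n) = M.tmk N (f m) (g n) := by
    intro f g m n
    rw [hE]
    simp only [H, homTensorHomEquiv_apply, TensorProduct.homTensorHomMap_apply]
    rfl
  have key : (M.tensor N).act ∘ mulMap Q Q' = toE ∘ H ∘ Φ ∘ τ := by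
    funext z
    induction z using TensorProduct.induction_on with
    | zero => simp; rfl
    | add x y hx hy =>
      simp only [Function.comp_apply, map_add] at hx hy ⊢
      rw [hx, hy]
      rfl
    | tmul a b =>
      refine tensor_hom_ext fun m n => ?_
      obtain ⟨b₀, b₁, rfl, h0, h1⟩ := exists_involute_even_add_odd b
      have hadd : ∀ f g, toE (f + g) = toE f + toE g := fun f g => rfl
      simp only [Function.comp_apply, TensorProduct.tmul_add, map_add, hτ0 _ _ h0, hτ1 _ _ h1, hadd,
        LinearMap.add_apply, mulMap_tmul, map_mul, Module.End.mul_apply]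
      rw [tensor_act_inr_even _ _ _ h0, tensor_act_inr_odd _ _ _ h1, tensor_act_inl,
          tensor_act_inl]
      simp only [hΦ, hH, map_mul, he, Module.End.mul_apply]
  rw [← Function.Bijective.of_comp_iff _ mulMap_bijective, key]
  exact Function.bijective_id.comp (H.bijective.comp (Φ.bijective.comp hτ))

end GrMod

end Tensor

/-! ### Orthogonal sums of split forms and forms of rank one -/

section SplitProd

variable {R : Type u} [CommRing R] {U U' : Type u} [AddCommGroup U]
  [Module R U] [AddCommGroup U'] [Module R U'] {Q : QuadraticForm R U} {Q' : QuadraticForm R U'}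

namespace GrMod

/-- The identification of the tensor product of carriers with the carrier of the tensor product. -/
def tensorEquiv (M : GrMod Q) (N : GrMod Q') :
    M.carrier ⊗[R] N.carrier ≃ₗ[R] (M.tensor N).carrier :=
  LinearEquiv.refl R (M.carrier ⊗[R] N.carrier)

/-- The isometry `(V ⊥ V') ⊥ (W ⊥ W') ≅ (V ⊥ W) ⊥ (V' ⊥ W')`, with `W = V(-1)`, `W' = V'(-1)`. -/
def doubleProd (Q : QuadraticForm R U) (Q' : QuadraticForm R U') :
    ((Q.prod Q').prod (-(Q.prod Q'))).IsometryEquiv ((Q.prod (-Q)).prod (Q'.prod (-Q'))) where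
  toLinearEquiv := LinearEquiv.prodProdProdComm R U U' U U'
  map_app' x := by simp; abel

/-- The bimodule `C(V ⊥ V')` is the tensor product of the bimodules `C(V)` and `C(V')`. -/
def cliffordTensor (Q : QuadraticForm R U) (Q' : QuadraticForm R U') :
    ((clifford Q).tensor (clifford Q')).carrier ≃ₗ[R] (clifford (Q.prod Q')).carrier :=
  (tensorEquiv _ _).symm.trans ((TensorProduct.congr (toClifford Q).symm (toClifford Q').symm).trans
    ((mulEquiv Q Q').trans (toClifford (Q.prod Q'))))

theorem cliffordTensor_tmk (a : CliffordAlgebra Q) (b : CliffordAlgebra Q') :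
    cliffordTensor Q Q' (tmk _ _ (toClifford Q a) (toClifford Q' b)) =
      toClifford (Q.prod Q') (CliffordAlgebra.map (QuadraticMap.Isometry.inl Q Q') a *
        CliffordAlgebra.map (QuadraticMap.Isometry.inr Q Q') b) := rfl

theorem involute_map {X : Type u} [AddCommGroup X] [Module R X] {P : QuadraticForm R X}
    (f : Q →qᵢ P) (a : CliffordAlgebra Q) :
    CliffordAlgebra.involute (CliffordAlgebra.map f a) =
      CliffordAlgebra.map f (CliffordAlgebra.involute a) := by
  have : (CliffordAlgebra.map f).comp CliffordAlgebra.involute =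
    (CliffordAlgebra.involute).comp (CliffordAlgebra.map f) := by
      ext x
      simp
  exact (AlgHom.congr_fun this a).symm

theorem cliffordTensor_c (x : (U × U') × (U × U'))
    (m : ((clifford Q).tensor (clifford Q')).carrier) :
    cliffordTensor Q Q' (((clifford Q).tensor (clifford Q')).c (doubleProd Q Q' x) m) =
      (clifford (Q.prod Q')).c x (cliffordTensor Q Q' m) := by
  refine LinearMap.congr_fun (f := (cliffordTensor Q Q').toLinearMap ∘ₗ
    ((clifford Q).tensor (clifford Q')).c (doubleProd Q Q' x))
    (g := (clifford (Q.prod Q')).c x ∘ₗ (cliffordTensor Q Q').toLinearMap)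
    (tensor_hom_ext fun m n => ?_) m
  obtain ⟨a, rfl⟩ := (toClifford Q).surjective m
  obtain ⟨b, rfl⟩ := (toClifford Q').surjective n
  obtain ⟨⟨v, v'⟩, ⟨w, w'⟩⟩ := x
  have hx : doubleProd Q Q' ((v, v'), (w, w')) = ((v, w), (v', w')) := rfl
  simp only [LinearMap.comp_apply, LinearEquiv.coe_coe]
  rw [tensor_c_tmk, hx, cliffordTensor_tmk, clifford_c, clifford_c, clifford_c, clifford_ε, map_add,
    cliffordTensor_tmk, cliffordTensor_tmk, ← map_add]
  congr 1
  simp only [map_mul, map_add, ι_prod, involute_map, mul_add, add_mul]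
  have h1 := ι_inr_mul_map_inl (Q := Q) (Q' := Q') v' a
  have h2 := ι_inl_mul_map_inr (Q := Q) (Q' := Q') w b
  have h3 : ∀ p q r s : CliffordAlgebra (Q.prod Q'), p * q = r * s →
      ∀ t, p * (q * t) = r * (s * t) :=
    fun p q r s h t => by rw [← mul_assoc, h, mul_assoc]
  simp only [mul_assoc, h3 _ _ _ _ h1, h2]
  abel

end GrMod

variable [Invertible (2 : R)]

open GrMod in
theorem IsSplit.prod (hQ : IsSplit Q) (hQ' : IsSplit Q') : IsSplit (Q.prod Q') := by
  have h1 := hQ.finite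
  have h2 := hQ'.finite
  have h3 := hQ.projective
  have h4 := hQ'.projective
  have h1' : Module.Finite R (clifford Q).carrier := Module.Finite.equiv (toClifford Q)
  have h2' : Module.Finite R (clifford Q').carrier := Module.Finite.equiv (toClifford Q')
  have h3' : Module.Projective R (clifford Q).carrier := Module.Projective.of_equiv (toClifford Q)
  have h4' : Module.Projective R (clifford Q').carrier := Module.Projective.of_equiv (toClifford Q')
  refine ⟨?_, Module.Finite.equiv (mulEquiv Q Q'), Module.Projective.of_equiv (mulEquiv Q Q')⟩
  refine (act_bijective_iff _ _ (doubleProd Q Q') (cliffordTensor Q Q').symm fun x m => ?_).2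
    (act_bijective_tensor _ _ hQ.bijective hQ'.bijective)
  rw [LinearEquiv.symm_apply_eq, cliffordTensor_c, LinearEquiv.apply_symm_apply]

open GrMod in
/-- An orthogonal summand of a split form is split. -/
theorem IsSplit.of_prod (h : IsSplit (Q.prod Q')) : IsSplit Q := by
  have hl : sliceLeft Q Q' (scalarPart Q') ∘ₗ
      (CliffordAlgebra.map (QuadraticMap.Isometry.inl Q Q')).toLinearMap = LinearMap.id := by
    ext a
    simp [sliceLeft_inl, scalarPart_one]
  have h1 := h.finite
  have h2 := h.projective
  refine ⟨?_, Module.Finite.of_surjective (sliceLeft Q Q' (scalarPart Q'))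
      fun a => ⟨_, LinearMap.congr_fun hl a⟩,
    Module.Projective.of_split _ _ hl⟩
  refine act_bijective_of_tensor (clifford Q) (clifford Q')
    (scalarPart Q' ∘ₗ (toClifford Q').symm.toLinearMap) (toClifford Q' 1) ?_ ?_ ?_ ?_
  · simp [scalarPart_one]
  · rw [clifford_ε, map_one]
  · intro x
    obtain ⟨a, rfl⟩ := (toClifford Q').surjective x
    rw [clifford_ε]
    simp [scalarPart_involute]
  · refine (act_bijective_iff (clifford (Q.prod Q')) _ (doubleProd Q Q')
      (cliffordTensor Q Q').symm fun x m => ?_).1 h.bijective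
    rw [LinearEquiv.symm_apply_eq, cliffordTensor_c, LinearEquiv.apply_symm_apply]

end SplitProd

section Rank

variable {R : Type u} [CommRing R]

/-- The elements `1` and `ι 1` span the Clifford algebra of a form on `R`. -/
theorem exists_eq_of_rank_one (q : QuadraticForm R R) (a : CliffordAlgebra q) :
    ∃ r s : R, a = algebraMap R _ r + s • CliffordAlgebra.ι q 1 := by
  induction a using CliffordAlgebra.left_induction with
  | algebraMap r => exact ⟨r, 0, by simp⟩
  | add x y hx hy =>
    obtain ⟨r, s, rfl⟩ := hx
    obtain ⟨r', s', rfl⟩ := hy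
    exact ⟨r + r', s + s', by rw [map_add, add_smul]; abel⟩
  | ι_mul x m hx =>
    obtain ⟨r, s, rfl⟩ := hx
    refine ⟨s * m * q 1, r * m, ?_⟩
    have hm : CliffordAlgebra.ι q m = m • CliffordAlgebra.ι q 1 := by
      rw [← map_smul, smul_eq_mul, mul_one]
    simp only [hm, mul_add, mul_smul_comm, smul_mul_assoc, CliffordAlgebra.ι_sq_scalar,
      Algebra.algebraMap_eq_smul_one, mul_one]
    module

variable [Invertible (2 : R)]

/-- The elements `1` and `ι 1` of the Clifford algebra of a unary form are linearly independent. -/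
theorem eq_zero_of_rank_one (q : QuadraticForm R R) (hq : IsUnit (q 1)) {r s : R}
    (h : algebraMap R _ r + s • CliffordAlgebra.ι q 1 = 0) : r = 0 ∧ s = 0 := by
  have hι : scalarPart q (CliffordAlgebra.ι q 1) = 0 := by
    have := scalarPart_ι_mul (Q := q) 1 1
    rwa [mul_one, CliffordAlgebra.contractLeft_one, map_zero] at this
  have h1 := congrArg (scalarPart q) h
  have h2 := congrArg (fun a => scalarPart q (CliffordAlgebra.ι q 1 * a)) h
  simp only [mul_add, mul_smul_comm, CliffordAlgebra.ι_sq_scalar] at h2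
  rw [← Algebra.commutes, ← Algebra.smul_def] at h2
  simp only [map_add, map_smul, hι, scalarPart_algebraMap, smul_eq_mul, mul_zero, add_zero,
    zero_add, map_zero] at h1 h2
  exact ⟨h1, hq.mul_left_eq_zero.1 h2⟩

open GrMod in
/-- For a unary form with unit value, `C(q ⊥ -q)` has the basis `1, i, j, i j`, which acts on the
basis `1, e` of `C(q)` by the matrices computed below; these form a basis of the two by two
matrices. -/
theorem IsSplit.rank_one (q : QuadraticForm R R) (hq : IsUnit (q 1)) : IsSplit q := by
  obtain ⟨v, hv⟩ := hq.exists_right_inv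
  set e := CliffordAlgebra.ι q 1 with he
  have hee : e * e = q 1 • (1 : CliffordAlgebra q) := by
    rw [he, CliffordAlgebra.ι_sq_scalar, Algebra.algebraMap_eq_smul_one]
  let f : R × R →ₗ[R] CliffordAlgebra q :=
    (Algebra.linearMap R (CliffordAlgebra q)).coprod (LinearMap.toSpanSingleton R _ e)
  have hf : ∀ r s, f (r, s) = algebraMap R _ r + s • e := fun r s => rfl
  have hfb : Function.Bijective f := by
    refine ⟨(injective_iff_map_eq_zero f).2 fun ⟨r, s⟩ h => ?_, fun a => ?_⟩
    · obtain ⟨rfl, rfl⟩ := eq_zero_of_rank_one q hq h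
      rfl
    · obtain ⟨r, s, rfl⟩ := exists_eq_of_rank_one q a
      exact ⟨(r, s), rfl⟩
  let F := LinearEquiv.ofBijective f hfb
  have hinj : ∀ r s r' s' : R, algebraMap R _ r + s • e = algebraMap R _ r' + s' • e →
      r = r' ∧ s = s' := fun r s r' s' h => by
    simpa using hfb.1 (a₁ := (r, s)) (a₂ := (r', s')) h
  let D := CliffordAlgebra (q.prod (-q))
  let i : D := CliffordAlgebra.ι (q.prod (-q)) (1, 0)
  let j : D := CliffordAlgebra.ι (q.prod (-q)) (0, 1)
  have hspan : ∀ z : D, ∃ w x y k : R, z = algebraMap R D w + x • i + y • j + k • (i * j) := by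
    intro z
    induction z using prod_induction with
    | h0 => exact ⟨0, 0, 0, 0, by simp⟩
    | hadd a b ha hb =>
      obtain ⟨w, x, y, k, rfl⟩ := ha
      obtain ⟨w', x', y', k', rfl⟩ := hb
      refine ⟨w + w', x + x', y + y', k + k', ?_⟩
      simp only [map_add, add_smul]
      abel
    | hmul a b =>
      obtain ⟨r, s, rfl⟩ := exists_eq_of_rank_one q a
      obtain ⟨r', s', rfl⟩ := exists_eq_of_rank_one (-q) b
      refine ⟨r * r', s * r', r * s', s * s', ?_⟩
      simp only [map_add, map_smul, CliffordAlgebra.map_apply_ι, AlgHom.commutes]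
      change (algebraMap R D r + s • i) * (algebraMap R D r' + s' • j) = _
      simp only [Algebra.algebraMap_eq_smul_one, add_mul, mul_add, smul_mul_smul_comm, one_mul,
        mul_one]
      abel
  have hi : ∀ a, (clifford q).act i (toClifford q a) = toClifford q (e * a) := fun a => by
    rw [act_ι, clifford_c]
    simp [e]
  have hj : ∀ a, (clifford q).act j (toClifford q a) =
      toClifford q (CliffordAlgebra.involute a * e) := fun a => by
    rw [act_ι, clifford_c]
    simp [e]
  have h1 : ∀ w x y k : R, (clifford q).act (algebraMap R D w + x • i + y • j + k • (i * j))
      (toClifford q 1) = toClifford q (algebraMap R _ (w + q 1 * k) + (x + y) • e) := by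
    intro w x y k
    simp only [map_add, map_smul, map_mul, LinearMap.add_apply, LinearMap.smul_apply,
      Module.End.mul_apply, hi, hj, Module.End.one_apply, map_one, one_mul,
      mul_one, hee, smul_mul_smul_comm, Algebra.algebraMap_eq_smul_one]
    module
  have h2 : ∀ w x y k : R, (clifford q).act (algebraMap R D w + x • i + y • j + k • (i * j))
      (toClifford q e) = toClifford q (algebraMap R _ (q 1 * (x - y)) + (w - q 1 * k) • e) := by
    intro w x y k
    have hie : CliffordAlgebra.involute e = -e := CliffordAlgebra.involute_ι _
    simp only [map_add, map_smul, map_mul, LinearMap.add_apply, LinearMap.smul_apply,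
      Module.End.mul_apply, hi, hj, Module.End.one_apply, map_one, hie, neg_mul,
      hee, mul_smul_comm, mul_one, map_neg, Algebra.algebraMap_eq_smul_one]
    module
  refine ⟨⟨?_, ?_⟩, Module.Finite.equiv F, Module.Projective.of_equiv F⟩
  · rw [injective_iff_map_eq_zero]
    intro z hz
    obtain ⟨w, x, y, k, rfl⟩ := hspan z
    have e1 := h1 w x y k
    have e2 := h2 w x y k
    rw [hz, LinearMap.zero_apply, eq_comm, map_eq_zero_iff _ (toClifford q).injective] at e1 e2
    obtain ⟨a1, a2⟩ := eq_zero_of_rank_one q hq e1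
    obtain ⟨a3, a4⟩ := eq_zero_of_rank_one q hq e2
    have c2 : ⅟(2 : R) * 2 = 1 := invOf_mul_self _
    have hw : w = 0 := by linear_combination ⅟(2 : R) * a1 + ⅟(2 : R) * a4 - w * c2
    have hk : k = 0 := by
      linear_combination v * ⅟(2 : R) * a1 - v * ⅟(2 : R) * a4 - k * q 1 * v * c2 - k * hv
    have hx : x = 0 := by
      linear_combination ⅟(2 : R) * a2 + v * ⅟(2 : R) * a3 - x * c2 - ⅟(2 : R) * (x - y) * hv
    have hy : y = 0 := by
      linear_combination ⅟(2 : R) * a2 - v * ⅟(2 : R) * a3 - y * c2 + ⅟(2 : R) * (x - y) * hv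
    simp [hw, hk, hx, hy]
  · intro T
    obtain ⟨α, β, h1'⟩ := exists_eq_of_rank_one q ((toClifford q).symm (T (toClifford q 1)))
    obtain ⟨γ, δ, h2'⟩ := exists_eq_of_rank_one q ((toClifford q).symm (T (toClifford q e)))
    rw [LinearEquiv.symm_apply_eq] at h1' h2'
    have c2 : ⅟(2 : R) * 2 = 1 := invOf_mul_self _
    -- the coefficients solve the linear system given by `h1` and `h2`
    refine ⟨algebraMap R D (⅟2 * (α + δ)) + (⅟2 * (β + v * γ)) • i + (⅟2 * (β - v * γ)) • j +
      (⅟2 * v * (α - δ)) • (i * j), ?_⟩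
    refine LinearMap.ext fun m => ?_
    obtain ⟨a, rfl⟩ := (toClifford q).surjective m
    obtain ⟨r, s, rfl⟩ := exists_eq_of_rank_one q a
    have hT : ∀ T : Module.End R (clifford q).carrier,
        T (toClifford q (algebraMap R _ r + s • e)) =
          r • T (toClifford q 1) + s • T (toClifford q e) := fun T => by
      rw [Algebra.algebraMap_eq_smul_one, map_add, map_add, map_smul, map_smul, map_smul, map_smul]
    rw [hT, hT, h1, h2, h1', h2']
    have w1 : ⅟2 * (α + δ) + q 1 * (⅟2 * v * (α - δ)) = α := by
      linear_combination α * c2 + ⅟(2 : R) * (α - δ) * hv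
    have w2 : ⅟2 * (β + v * γ) + ⅟2 * (β - v * γ) = β := by
      linear_combination β * c2
    have w3 : q 1 * (⅟2 * (β + v * γ) - ⅟2 * (β - v * γ)) = γ := by
      linear_combination q 1 * v * γ * c2 + γ * hv
    have w4 : ⅟2 * (α + δ) - q 1 * (⅟2 * v * (α - δ)) = δ := by
      linear_combination δ * c2 - ⅟(2 : R) * (α - δ) * hv
    rw [w1, w2, w3, w4]

end Rank

/-! ### Nondegenerate forms are split -/

section Nondegenerate

variable {R : Type u} [CommRing R] [Invertible (2 : R)]

/-- The form `Q ⊥ -Q` is hyperbolic when `Q` is nondegenerate and `2` is invertible. -/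
theorem toDualProd_bijective {V : Type u} [AddCommGroup V] [Module R V] (Q : QuadraticForm R V)
    (hQ : Function.Bijective Q.polarBilin) :
    Function.Bijective (QuadraticForm.toDualProd Q) := by
  have hB : ∀ x y, QuadraticMap.associated (R := R) Q x y = ⅟(2 : R) * Q.polarBilin x y :=
    fun x y => by simp [QuadraticMap.associated_apply, QuadraticMap.polar]
  have hB' : ∀ x, QuadraticMap.associated (R := R) Q x = ⅟(2 : R) • Q.polarBilin x :=
    fun x => LinearMap.ext fun y => by rw [hB]; rfl
  have hinj : ∀ x, QuadraticMap.associated (R := R) Q x = 0 → x = 0 := fun x hx => by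
    apply hQ.1
    rw [map_zero, ← one_smul R (Q.polarBilin x), ← mul_invOf_self (2 : R), mul_smul, ← hB', hx,
      smul_zero]
  have hsurj : ∀ f, ∃ x, QuadraticMap.associated (R := R) Q x = f := fun f => by
    obtain ⟨x, hx⟩ := hQ.2 f
    refine ⟨(2 : R) • x, ?_⟩
    rw [hB', map_smul, hx, smul_smul, invOf_mul_self, one_smul]
  have h2 : ∀ x : V, (⅟(2 : R)) • (x + x) = x := fun x => by
    rw [← two_smul R x, smul_smul, invOf_mul_self, one_smul]
  have happ : ∀ x y : V, QuadraticForm.toDualProd Q (x, y) =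
      (QuadraticMap.associated (R := R) Q (x + y), x - y) := fun x y => by
    rw [map_add]; rfl
  constructor
  · rw [injective_iff_map_eq_zero]
    rintro ⟨x, y⟩ h
    rw [happ, Prod.mk_eq_zero] at h
    have h1 := hinj _ h.1
    obtain rfl := sub_eq_zero.1 h.2
    have : x = 0 := by rw [← h2 x, h1, smul_zero]
    simp [this]
  · rintro ⟨f, m⟩
    obtain ⟨s, rfl⟩ := hsurj f
    refine ⟨(⅟(2 : R) • (s + m), ⅟(2 : R) • (s - m)), ?_⟩
    rw [happ, ← smul_add, ← smul_sub, add_add_sub_cancel, h2, add_sub_sub_cancel, h2]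

/-- An induction principle for nondegenerate forms: every such form is an orthogonal summand of an
orthogonal sum of forms of rank one, because `Q ⊥ -Q` is the hyperbolic space of `V` and `V` is a
summand of a free module. -/
theorem nondegenerate_induction
    {motive : ∀ {V : Type u} [AddCommGroup V] [Module R V], QuadraticForm R V → Prop}
    (iso : ∀ {V W : Type u} [AddCommGroup V] [Module R V] [AddCommGroup W] [Module R W]
      {Q : QuadraticForm R V} {P : QuadraticForm R W}, Q.IsometryEquiv P → motive Q → motive P)
    (rank_one : ∀ q : QuadraticForm R R, IsUnit (q 1) → motive q)
    (prod : ∀ {V W : Type u} [AddCommGroup V] [Module R V] [AddCommGroup W] [Module R W]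
      {Q : QuadraticForm R V} {P : QuadraticForm R W}, motive Q → motive P → motive (Q.prod P))
    (of_prod : ∀ {V W : Type u} [AddCommGroup V] [Module R V] [AddCommGroup W] [Module R W]
      {Q : QuadraticForm R V} {P : QuadraticForm R W}, motive (Q.prod P) → motive Q)
    {V : Type u} [AddCommGroup V] [Module R V] [Module.Finite R V] [Module.Projective R V]
    (Q : QuadraticForm R V) (hQ : Function.Bijective Q.polarBilin) : motive Q := by
  have toDual : ∀ {V : Type u} [AddCommGroup V] [Module R V] (Q : QuadraticForm R V),
      Function.Bijective Q.polarBilin → Nonempty ((Q.prod (-Q)).IsometryEquiv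
        (QuadraticForm.dualProd R V)) := fun Q hQ =>
    ⟨⟨LinearEquiv.ofBijective (QuadraticForm.toDualProd Q).toLinearMap (toDualProd_bijective Q hQ),
      (QuadraticForm.toDualProd Q).map_app'⟩⟩
  have hyp_one : motive (QuadraticForm.dualProd R R) := by
    have h1 : ((QuadraticMap.sq : QuadraticForm R R)) 1 = 1 := by simp
    obtain ⟨e⟩ := toDual (QuadraticMap.sq : QuadraticForm R R) (by
      have hp : ∀ x y : R, (QuadraticMap.sq : QuadraticForm R R).polarBilin x y = 2 * (x * y) :=
        fun x y => by simp [QuadraticMap.polar]; ring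
      constructor
      · rw [injective_iff_map_eq_zero]
        intro x hx
        have := LinearMap.congr_fun hx 1
        rw [hp, mul_one, LinearMap.zero_apply] at this
        rw [← one_mul x, ← invOf_mul_self (2 : R), mul_assoc, this, mul_zero]
      · intro f
        refine ⟨⅟2 * f 1, LinearMap.ext_ring ?_⟩
        rw [hp, mul_one, ← mul_assoc, mul_invOf_self, one_mul])
    exact iso e (prod (rank_one _ (by rw [h1]; exact isUnit_one))
      (rank_one _ (by rw [neg_apply, h1]; exact isUnit_one.neg)))
  have hyp_free : ∀ n : ℕ, motive (QuadraticForm.dualProd R (Fin n → R)) := by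
    intro n
    induction n with
    -- the zero form is a summand of the hyperbolic plane
    | zero =>
      have e : ((QuadraticForm.dualProd R R).prod
          (QuadraticForm.dualProd R (Fin 0 → R))).IsometryEquiv (QuadraticForm.dualProd R R) :=
        QuadraticForm.dualProdProdIsometry.symm.trans
          (QuadraticForm.dualProdIsometry (LinearEquiv.prodUnique))
      exact of_prod (iso (QuadraticMap.IsometryEquiv.prodComm _ _) (iso e.symm hyp_one))
    | succ n ih =>
      exact iso (QuadraticForm.dualProdProdIsometry.symm.trans
          (QuadraticForm.dualProdIsometry (Fin.consLinearEquiv R (fun _ : Fin (n + 1) => R))))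
          (prod hyp_one ih)
  obtain ⟨n, f, g, -, -, h⟩ := Module.Finite.exists_comp_eq_id_of_projective R V
  have hfg : ∀ v, f (g v) = v := LinearMap.congr_fun h
  let e : (Fin n → R) ≃ₗ[R] V × LinearMap.ker f :=
    { toFun := fun x => (f x, ⟨x - g (f x), by simp [hfg]⟩)
      map_add' := fun x y => by
        ext1
        · simp
        · ext1; simp; abel
      map_smul' := fun r x => by
        ext1
        · simp
        · ext1; simp [smul_sub]
      invFun := fun p => g p.1 + p.2
      left_inv := fun x => by simp
      right_inv := fun p => by
        have : f p.2 = 0 := p.2.2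
        ext1
        · simp [hfg]
        · ext1; simp [hfg] }
  obtain ⟨e'⟩ := toDual Q hQ
  exact of_prod (iso e'.symm (of_prod (iso ((QuadraticForm.dualProdIsometry e).trans
    QuadraticForm.dualProdProdIsometry) (hyp_free n))))

/-- The Clifford algebra `C(Q ⊥ -Q)` of a nondegenerate form `Q` is the endomorphism algebra of
`C(Q)`. -/
theorem IsSplit.of_nondegenerate {V : Type u} [AddCommGroup V] [Module R V] [Module.Finite R V]
    [Module.Projective R V] (Q : QuadraticForm R V) (hQ : Function.Bijective Q.polarBilin) :
    IsSplit Q :=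
  nondegenerate_induction (motive := fun Q => IsSplit Q) (fun e h => h.of_isometryEquiv e)
    IsSplit.rank_one (fun h h' => h.prod h') (fun h => h.of_prod) Q hQ

end Nondegenerate

section Pow

variable {R : Type u} [CommRing R] {W W' : Type u} [AddCommGroup W] [Module R W]
  [AddCommGroup W'] [Module R W']

/-- The isometry `W^(k+1) ≅ W ⊥ W^k`. -/
def powSucc (k : ℕ) (q : QuadraticForm R W) :
    (powForm (k + 1) q).IsometryEquiv (q.prod (powForm k q)) where
  toLinearEquiv := (Fin.consLinearEquiv R (fun _ : Fin (k + 1) => W)).symm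
  map_app' x := by
    change q (x 0) + powForm k q (fun i => x i.succ) = _
    simp [Fin.sum_univ_succ]

/-- The isometry `(W ⊥ W')^k ≅ W^k ⊥ W'^k`. -/
def powProd (k : ℕ) (q : QuadraticForm R W) (q' : QuadraticForm R W') :
    (powForm k (q.prod q')).IsometryEquiv ((powForm k q).prod (powForm k q')) where
  toFun w := (fun i => (w i).1, fun i => (w i).2)
  invFun w := fun i => (w.1 i, w.2 i)
  map_add' _ _ := rfl
  map_smul' _ _ := rfl
  left_inv _ := rfl
  right_inv _ := rfl
  map_app' x := by simp [Finset.sum_add_distrib]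

variable [Invertible (2 : R)]

theorem IsSplit.pow {q : QuadraticForm R W} (h : IsSplit q) (k : ℕ) : IsSplit (powForm k q) := by
  induction k with
  | zero =>
    let e : ((powForm 0 q).prod q).IsometryEquiv q :=
      { toLinearEquiv := LinearEquiv.uniqueProd
        map_app' := fun x => by simp }
    exact (h.of_isometryEquiv e.symm).of_prod
  | succ k ih => exact (h.prod ih).of_isometryEquiv (powSucc k q).symm

/-- The even centre of a split Clifford algebra consists of scalars. -/
theorem IsSplit.eq_algebraMap {q : QuadraticForm R W} (h : IsSplit q) {z : CliffordAlgebra q}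
    (hz : CliffordAlgebra.involute z = z)
    (hc : ∀ w, z * CliffordAlgebra.ι q w = CliffordAlgebra.ι q w * z) :
    z = algebraMap R _ (scalarPart q z) := by
  let L := (GrMod.clifford q).act (CliffordAlgebra.map (QuadraticMap.Isometry.inl q (-q)) z)
  have hL : ∀ a, L (GrMod.toClifford q a) = GrMod.toClifford q (z * a) :=
    GrMod.clifford_act_inl z
  have hLc : ∀ x m, L ((GrMod.clifford q).c x m) = (GrMod.clifford q).c x (L m) := by
    intro x m
    obtain ⟨a, rfl⟩ := (GrMod.toClifford q).surjective m
    rw [GrMod.clifford_c, hL, hL, GrMod.clifford_c, mul_add, ← mul_assoc, hc, mul_assoc, map_mul,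
      hz, mul_assoc]
  -- the projection onto the scalars is the action of an element of `C(q ⊥ -q)`
  obtain ⟨y, hy⟩ := h.bijective.2 (LinearMap.smulRight
    (scalarPart q ∘ₗ (GrMod.toClifford q).symm.toLinearMap) (GrMod.toClifford q 1))
  have h1 := GrMod.hom_act' _ _ L hLc y (GrMod.toClifford q 1)
  rw [hy, hL] at h1
  simp only [LinearMap.smulRight_apply, LinearMap.comp_apply, LinearEquiv.coe_coe,
    LinearEquiv.symm_apply_apply, scalarPart_one, one_smul, hL, mul_one, ← map_smul] at h1
  rw [Algebra.algebraMap_eq_smul_one]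
  exact (GrMod.toClifford q).injective h1

end Pow

/-! ### Rotors -/

section Rotor

variable {R : Type u} [CommRing R] {U U' : Type u} [AddCommGroup U] [Module R U]
  [AddCommGroup U'] [Module R U'] {P : QuadraticForm R U} {P' : QuadraticForm R U'}

/-- An even element `x` of the Clifford algebra with `x u = σ(u) x` for all vectors `u`. -/
structure IsRotor (P : QuadraticForm R U) (σ : U → U) (x : CliffordAlgebra P) : Prop where
  even : CliffordAlgebra.involute x = x
  mul_ι : ∀ u, x * CliffordAlgebra.ι P u = CliffordAlgebra.ι P (σ u) * x

theorem IsRotor.map {σ : U → U} {σ' : U' → U'} {x : CliffordAlgebra P} (hx : IsRotor P σ x)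
    (e : P.IsometryEquiv P') (h : ∀ u, e (σ u) = σ' (e u)) :
    IsRotor P' σ' (CliffordAlgebra.map e.toIsometry x) := by
  refine ⟨by rw [GrMod.involute_map, hx.even], fun u => ?_⟩
  obtain ⟨u, rfl⟩ := e.surjective u
  have h1 := congrArg (CliffordAlgebra.map e.toIsometry) (hx.mul_ι u)
  rw [map_mul, map_mul, CliffordAlgebra.map_apply_ι, CliffordAlgebra.map_apply_ι] at h1
  have h2 : σ' (e.toLinearEquiv u) = e.toLinearEquiv (σ u) := (h u).symm
  rw [h2]
  exact h1

theorem IsRotor.prod {σ : U → U} {σ' : U' → U'} {x : CliffordAlgebra P} {x' : CliffordAlgebra P'}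
    (hx : IsRotor P σ x) (hx' : IsRotor P' σ' x') :
    IsRotor (P.prod P') (Prod.map σ σ') (CliffordAlgebra.map (QuadraticMap.Isometry.inl P P') x *
      CliffordAlgebra.map (QuadraticMap.Isometry.inr P P') x') := by
  refine ⟨by rw [map_mul, GrMod.involute_map, GrMod.involute_map, hx.even, hx'.even], ?_⟩
  rintro ⟨u, u'⟩
  have h1 := GrMod.ι_inl_mul_map_inr (Q := P) u x'
  have h2 := GrMod.ι_inr_mul_map_inl (Q' := P') (σ' u') x
  rw [hx'.even] at h1
  rw [hx.even] at h2
  have h3 : ∀ f : P →qᵢ P.prod P',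
      CliffordAlgebra.map f x * CliffordAlgebra.map f (CliffordAlgebra.ι P u) =
      CliffordAlgebra.map f (CliffordAlgebra.ι P (σ u)) * CliffordAlgebra.map f x := fun f => by
    rw [← map_mul, hx.mul_ι, map_mul]
  have h4 : ∀ f : P' →qᵢ P.prod P',
      CliffordAlgebra.map f x' * CliffordAlgebra.map f (CliffordAlgebra.ι P' u') =
      CliffordAlgebra.map f (CliffordAlgebra.ι P' (σ' u')) * CliffordAlgebra.map f x' := fun f => by
    rw [← map_mul, hx'.mul_ι, map_mul]
  rw [Prod.map_apply, GrMod.ι_prod, GrMod.ι_prod, mul_add, add_mul, mul_assoc, ← h1, mul_assoc, h4,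
    ← mul_assoc, h3, ← mul_assoc (CliffordAlgebra.map _ x), ← h2]
  simp only [mul_assoc]

theorem IsRotor.reverse_mul_ι {σ : U → U} {x : CliffordAlgebra P} (hx : IsRotor P σ x) (u : U) :
    CliffordAlgebra.reverse x * CliffordAlgebra.ι P (σ u) =
      CliffordAlgebra.ι P u * CliffordAlgebra.reverse x := by
  have := congrArg CliffordAlgebra.reverse (hx.mul_ι u)
  rw [CliffordAlgebra.reverse.map_mul, CliffordAlgebra.reverse.map_mul, CliffordAlgebra.reverse_ι,
    CliffordAlgebra.reverse_ι] at this
  exact this.symm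

theorem IsRotor.reverse_even {σ : U → U} {x : CliffordAlgebra P} (hx : IsRotor P σ x) :
    CliffordAlgebra.involute (CliffordAlgebra.reverse x) = CliffordAlgebra.reverse x := by
  rw [← CliffordAlgebra.reverse_involute, hx.even]

theorem sliceLeft_inl_mul (φ : CliffordAlgebra P' →ₗ[R] R) (a : CliffordAlgebra P)
    (z : CliffordAlgebra (P.prod P')) :
    sliceLeft P P' φ (CliffordAlgebra.map (QuadraticMap.Isometry.inl P P') a * z) =
      a * sliceLeft P P' φ z := by
  induction z using prod_induction with
  | h0 => simp
  | hadd x y hx hy => simp only [map_add, mul_add, hx, hy]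
  | hmul b c => rw [← mul_assoc, ← map_mul, sliceLeft_inl_mul_inr, sliceLeft_inl_mul_inr,
      mul_smul_comm]

theorem sliceRight_mul_inr (φ : CliffordAlgebra P →ₗ[R] R) (z : CliffordAlgebra (P.prod P'))
    (a : CliffordAlgebra P') :
    sliceRight P P' φ (z * CliffordAlgebra.map (QuadraticMap.Isometry.inr P P') a) =
      sliceRight P P' φ z * a := by
  induction z using prod_induction with
  | h0 => simp
  | hadd x y hx hy => simp only [map_add, add_mul, hx, hy]
  | hmul b c => rw [mul_assoc, ← map_mul, sliceRight_inl_mul_inr, sliceRight_inl_mul_inr,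
      smul_mul_assoc]

theorem reverse_map (f : P →qᵢ P') (a : CliffordAlgebra P) :
    CliffordAlgebra.reverse (CliffordAlgebra.map f a) =
      CliffordAlgebra.map f (CliffordAlgebra.reverse a) := by
  induction a using CliffordAlgebra.induction with
  | algebraMap r => simp
  | ι x => simp
  | mul a b ha hb => simp [ha, hb]
  | add a b ha hb => simp [ha, hb]

theorem inl_mul_inr_mul_reverse {x : CliffordAlgebra P} {x' : CliffordAlgebra P'} {r r' : R}
    (h : x * CliffordAlgebra.reverse x = algebraMap R _ r)
    (h' : x' * CliffordAlgebra.reverse x' = algebraMap R _ r') :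
    (CliffordAlgebra.map (QuadraticMap.Isometry.inl P P') x *
      CliffordAlgebra.map (QuadraticMap.Isometry.inr P P') x') *
      CliffordAlgebra.reverse (CliffordAlgebra.map (QuadraticMap.Isometry.inl P P') x *
        CliffordAlgebra.map (QuadraticMap.Isometry.inr P P') x') = algebraMap R _ (r * r') := by
  rw [CliffordAlgebra.reverse.map_mul, reverse_map, reverse_map, mul_assoc,
    ← mul_assoc (CliffordAlgebra.map _ x'), ← map_mul, h', AlgHom.commutes, Algebra.commutes r',
    ← mul_assoc, ← map_mul, h, AlgHom.commutes, map_mul]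

variable [Invertible (2 : R)]

/-- Two rotors over the same isometry differ by a scalar, because the even centre of a split
Clifford algebra is the ground ring. -/
theorem IsSplit.rotor_mul_reverse (hP : IsSplit P) {σ : U → U} (hσ : Function.Surjective σ)
    {x y : CliffordAlgebra P} (hx : IsRotor P σ x) (hy : IsRotor P σ y) :
    x * CliffordAlgebra.reverse y =
      algebraMap R _ (scalarPart P (x * CliffordAlgebra.reverse y)) := by
  refine hP.eq_algebraMap (by rw [map_mul, hx.even, hy.reverse_even]) fun w => ?_
  obtain ⟨u, rfl⟩ := hσ w
  rw [mul_assoc, hy.reverse_mul_ι, ← mul_assoc, hx.mul_ι, mul_assoc]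

theorem IsSplit.reverse_mul_rotor (hP : IsSplit P) {σ : U → U}
    {x y : CliffordAlgebra P} (hx : IsRotor P σ x) (hy : IsRotor P σ y) :
    CliffordAlgebra.reverse x * y =
      algebraMap R _ (scalarPart P (CliffordAlgebra.reverse x * y)) := by
  refine hP.eq_algebraMap (by rw [map_mul, hy.even, hx.reverse_even]) fun w => ?_
  rw [mul_assoc, hy.mul_ι, ← mul_assoc, hx.reverse_mul_ι, mul_assoc]

theorem sliceLeft_mul_ι (z : CliffordAlgebra (P.prod P')) (u : U) :
    sliceLeft P P' (scalarPart P') (z * CliffordAlgebra.ι _ (u, 0)) =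
      sliceLeft P P' (scalarPart P') z * CliffordAlgebra.ι P u := by
  induction z using prod_induction with
  | h0 => simp
  | hadd x y hx hy => simp only [map_add, add_mul, hx, hy]
  | hmul b c =>
    have h := GrMod.ι_inl_mul_map_inr (Q := P) u (CliffordAlgebra.involute c)
    rw [CliffordAlgebra.involute_involute] at h
    rw [GrMod.ι_prod, map_zero, map_zero, add_zero, mul_assoc, ← h, ← mul_assoc, ← map_mul,
      sliceLeft_inl_mul_inr, sliceLeft_inl_mul_inr, scalarPart_involute, smul_mul_assoc]

theorem sliceRight_ι_mul (z : CliffordAlgebra (P.prod P')) (u : U') :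
    sliceRight P P' (scalarPart P) (CliffordAlgebra.ι _ (0, u) * z) =
      CliffordAlgebra.ι P' u * sliceRight P P' (scalarPart P) z := by
  induction z using prod_induction with
  | h0 => simp
  | hadd x y hx hy => simp only [map_add, mul_add, hx, hy]
  | hmul b c =>
    rw [GrMod.ι_prod, map_zero, map_zero, zero_add, ← mul_assoc, GrMod.ι_inr_mul_map_inl, mul_assoc,
      ← map_mul, sliceRight_inl_mul_inr, sliceRight_inl_mul_inr, scalarPart_involute,
      mul_smul_comm]

theorem sliceLeft_involute (z : CliffordAlgebra (P.prod P')) :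
    sliceLeft P P' (scalarPart P') (CliffordAlgebra.involute z) =
      CliffordAlgebra.involute (sliceLeft P P' (scalarPart P') z) := by
  induction z using prod_induction with
  | h0 => simp
  | hadd x y hx hy => simp only [map_add, hx, hy]
  | hmul b c => rw [map_mul, GrMod.involute_map, GrMod.involute_map, sliceLeft_inl_mul_inr,
      sliceLeft_inl_mul_inr, scalarPart_involute, map_smul]

theorem sliceRight_involute (z : CliffordAlgebra (P.prod P')) :
    sliceRight P P' (scalarPart P) (CliffordAlgebra.involute z) =
      CliffordAlgebra.involute (sliceRight P P' (scalarPart P) z) := by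
  induction z using prod_induction with
  | h0 => simp
  | hadd x y hx hy => simp only [map_add, hx, hy]
  | hmul b c => rw [map_mul, GrMod.involute_map, GrMod.involute_map, sliceRight_inl_mul_inr,
      sliceRight_inl_mul_inr, scalarPart_involute, map_smul]

theorem scalarPart_inl_mul_inr (a : CliffordAlgebra P) (b : CliffordAlgebra P') :
    scalarPart (P.prod P') (CliffordAlgebra.map (QuadraticMap.Isometry.inl P P') a *
      CliffordAlgebra.map (QuadraticMap.Isometry.inr P P') b) = scalarPart P a * scalarPart P' b :=
  scalarPart_map_mul_map _ _ GrMod.isOrtho_inl_inr a b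

theorem scalarPart_sliceLeft (z : CliffordAlgebra (P.prod P')) :
    scalarPart P (sliceLeft P P' (scalarPart P') z) = scalarPart (P.prod P') z := by
  induction z using prod_induction with
  | h0 => simp
  | hadd x y hx hy => simp only [map_add, hx, hy]
  | hmul b c => rw [sliceLeft_inl_mul_inr, scalarPart_inl_mul_inr, map_smul, smul_eq_mul, mul_comm]

theorem scalarPart_sliceRight (z : CliffordAlgebra (P.prod P')) :
    scalarPart P' (sliceRight P P' (scalarPart P) z) = scalarPart (P.prod P') z := by
  induction z using prod_induction with
  | h0 => simp
  | hadd x y hx hy => simp only [map_add, hx, hy]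
  | hmul b c => rw [sliceRight_inl_mul_inr, scalarPart_inl_mul_inr, map_smul, smul_eq_mul]

/-- `σ` is induced by a rotor whose norm and whose scalar part are units. -/
def HasRotor (P : QuadraticForm R U) (σ : U → U) : Prop :=
  ∃ x, IsRotor P σ x ∧ IsUnit (scalarPart P x) ∧
    ∃ r, IsUnit r ∧ x * CliffordAlgebra.reverse x = algebraMap R _ r

theorem HasRotor.map {σ : U → U} {σ' : U' → U'} (hP : HasRotor P σ)
    (e : P.IsometryEquiv P') (h : ∀ u, e (σ u) = σ' (e u)) : HasRotor P' σ' := by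
  obtain ⟨x, h1, h2, r, hr, h3⟩ := hP
  refine ⟨_, h1.map e h, by rwa [scalarPart_map], r, hr, ?_⟩
  rw [reverse_map, ← map_mul, h3, AlgHom.commutes]

theorem HasRotor.prod {σ : U → U} {σ' : U' → U'} (hP : HasRotor P σ) (hP' : HasRotor P' σ') :
    HasRotor (P.prod P') (Prod.map σ σ') := by
  obtain ⟨x, h1, h2, r, hr, h3⟩ := hP
  obtain ⟨x', h1', h2', r', hr', h3'⟩ := hP'
  exact ⟨_, h1.prod h1', by rw [scalarPart_inl_mul_inr]; exact h2.mul h2', r * r', hr.mul hr',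
    inl_mul_inr_mul_reverse h3 h3'⟩

/-- The rotors of an orthogonal sum of isometries give rotors of the summands: if `t` is a rotor of
the sum, its slices `x` and `x'` by the scalar parts are rotors, and `x x'` is a multiple of `t`,
by a factor that is determined by the scalar parts. -/
theorem HasRotor.of_prod (hP : IsSplit P) (hP' : IsSplit P') {σ : U ≃ₗ[R] U} {σ' : U' ≃ₗ[R] U'}
    (h : HasRotor (P.prod P') (Prod.map σ σ')) : HasRotor P σ := by
  obtain ⟨t, ht, hs, ρ, hρ, e2⟩ := h
  have hPP := hP.prod hP'
  let x := sliceLeft P P' (scalarPart P') t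
  let x' := sliceRight P P' (scalarPart P) t
  have hx : IsRotor P σ x := by
    refine ⟨by rw [← sliceLeft_involute, ht.even], fun u => ?_⟩
    have h1 := ht.mul_ι (u, 0)
    rw [Prod.map_apply, map_zero] at h1
    have h2 := sliceLeft_inl_mul (P' := P') (scalarPart P') (CliffordAlgebra.ι P (σ u)) t
    rw [CliffordAlgebra.map_apply_ι] at h2
    rw [← sliceLeft_mul_ι, h1]
    exact h2
  have hx' : IsRotor P' σ' x' := by
    refine ⟨by rw [← sliceRight_involute, ht.even], fun u => ?_⟩
    have h1 := ht.mul_ι (0, u)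
    rw [Prod.map_apply, map_zero] at h1
    have h2 := sliceRight_mul_inr (P := P) (scalarPart P) t (CliffordAlgebra.ι P' u)
    rw [CliffordAlgebra.map_apply_ι] at h2
    rw [← sliceRight_ι_mul, ← h1]
    exact h2.symm
  have hsx : scalarPart P x = scalarPart _ t := scalarPart_sliceLeft t
  have hsx' : scalarPart P' x' = scalarPart _ t := scalarPart_sliceRight t
  have hy := hx.prod hx'
  set y := CliffordAlgebra.map (QuadraticMap.Isometry.inl P P') x *
    CliffordAlgebra.map (QuadraticMap.Isometry.inr P P') x' with hydef
  have e1 := hPP.reverse_mul_rotor ht hy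
  have e3 := hP.rotor_mul_reverse σ.surjective hx hx
  have e4 := hP'.rotor_mul_reverse σ'.surjective hx' hx'
  set c := scalarPart _ (CliffordAlgebra.reverse t * y)
  set r := scalarPart _ (x * CliffordAlgebra.reverse x)
  set r' := scalarPart _ (x' * CliffordAlgebra.reverse x')
  -- `y` is a multiple of `t` by a unit, so that its norm `r * r'` is a unit
  have e5 : ρ • y = c • t := by
    rw [Algebra.smul_def, ← e2, mul_assoc, e1, Algebra.smul_def, Algebra.commutes]
  have hc : IsUnit c := by
    have := congrArg (scalarPart (P.prod P')) e5
    rw [map_smul, map_smul, hydef, scalarPart_inl_mul_inr, hsx, hsx', smul_eq_mul, smul_eq_mul,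
      ← mul_assoc] at this
    rw [← hs.mul_right_cancel this]
    exact hρ.mul hs
  have e6 : y * CliffordAlgebra.reverse y = algebraMap R _ (r * r') := by
    rw [hydef, inl_mul_inr_mul_reverse e3 e4]
  have e7 : (ρ * ρ) • algebraMap R (CliffordAlgebra (P.prod P')) (r * r') =
      (c * c) • algebraMap R _ ρ := by
    rw [← e6, ← e2, ← smul_mul_smul_comm, ← smul_mul_smul_comm, ← map_smul, ← map_smul, e5]
  have e8 := congrArg (scalarPart (P.prod P')) e7
  rw [map_smul, map_smul, scalarPart_algebraMap, scalarPart_algebraMap, smul_eq_mul, smul_eq_mul]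
    at e8
  have hr : IsUnit r := by
    have h1 : IsUnit ((ρ * ρ) * (r * r')) := by rw [e8]; exact (hc.mul hc).mul hρ
    exact isUnit_of_mul_isUnit_left (isUnit_of_mul_isUnit_right h1)
  exact ⟨x, hx, by rwa [hsx], r, hr, e3⟩

end Rotor

/-! ### The cyclic shift is induced by a rotor -/

section RankOne

variable {R : Type u} [CommRing R] {k : ℕ}

/-- The `n`-th coordinate of a vector, and `0` for `n` out of range. -/
def coord (w : Fin k → R) (n : ℕ) : R := if h : n < k then w ⟨n, h⟩ else 0

/-- The difference of the basis vectors `n` and `n + 1`. -/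
def rootVec (R : Type u) [CommRing R] (k n : ℕ) : Fin k → R := fun i =>
  (if (i : ℕ) = n then 1 else 0) - (if (i : ℕ) = n + 1 then 1 else 0)

/-- The product of the reflection vectors `n, n + 1, …, n + m - 1` in the Clifford algebra. -/
def rootProd (q : QuadraticForm R R) (k : ℕ) : ℕ → ℕ → CliffordAlgebra (powForm k q)
  | _, 0 => 1
  | n, m + 1 => CliffordAlgebra.ι _ (rootVec R k n) * rootProd q k (n + 1) m

/-- The product of the transpositions `(n, n + 1), …, (n + m - 1, n + m)` of the coordinates. -/
def swapProd (w : Fin k → R) : ℕ → ℕ → (Fin k → R)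
  | _, 0 => w
  | n, m + 1 => swapProd w (n + 1) m -
      (coord (swapProd w (n + 1) m) n - coord (swapProd w (n + 1) m) (n + 1)) • rootVec R k n

theorem coord_rootVec {i n : ℕ} (hi : i < k) : coord (rootVec R k n) i =
    (if i = n then 1 else 0) - (if i = n + 1 then 1 else 0) := by
  rw [coord, dif_pos hi]
  rfl

theorem coord_sub_smul (w v : Fin k → R) (r : R) (i : ℕ) :
    coord (w - r • v) i = coord w i - r * coord v i := by
  unfold coord
  split_ifs <;> simp

theorem coord_swapProd (w : Fin k → R) (m n i : ℕ) (h : n + m < k) (hi : i < k) :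
    coord (swapProd w n m) i =
      if i = n then coord w (n + m) else if n < i ∧ i ≤ n + m then coord w (i - 1)
        else coord w i := by
  induction m generalizing n i with
  | zero =>
    have : ¬(n < i ∧ i ≤ n + 0) := by omega
    rw [if_neg this, swapProd]
    split_ifs with h1
    · rw [h1, add_zero]
    · rfl
  | succ m ih =>
    rw [swapProd, coord_sub_smul, ih (n + 1) i (by omega) hi, ih (n + 1) n (by omega) (by omega),
      ih (n + 1) (n + 1) (by omega) (by omega), coord_rootVec hi]
    have e : n + 1 + m = n + (m + 1) := by omega
    rw [if_neg (show n ≠ n + 1 by omega), if_neg (show ¬(n + 1 < n ∧ n ≤ n + 1 + m) by omega),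
      if_pos rfl, e]
    rcases lt_trichotomy i n with h1 | h1 | h1
    · rw [if_neg (by omega), if_neg (by omega), if_neg (by omega), if_neg (by omega),
        if_neg (by omega), if_neg (by omega)]
      ring
    · subst h1
      rw [if_neg (by omega), if_neg (by omega), if_pos rfl, if_neg (by omega), if_pos rfl]
      ring
    · by_cases h2 : i = n + 1
      · subst h2
        rw [if_pos rfl, if_neg (by omega), if_pos rfl, if_neg (by omega), if_pos (by omega),
          Nat.add_sub_cancel]
        ring
      · rw [if_neg h2, if_neg (show i ≠ n by omega), if_neg h2, if_neg (show i ≠ n by omega)]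
        by_cases h3 : i ≤ n + (m + 1)
        · rw [if_pos (by omega), if_pos (by omega)]; ring
        · rw [if_neg (by omega), if_neg (by omega)]; ring

theorem swapProd_eq_shift (hk : 0 < k) (w : Fin k → R) : swapProd w 0 (k - 1) = shift R R k w := by
  obtain ⟨n, rfl⟩ : ∃ n, k = n + 1 := ⟨k - 1, by omega⟩
  have hc : ∀ (v : Fin (n + 1) → R) (i : Fin (n + 1)), coord v i = v i := fun v i => by
    rw [coord, dif_pos i.2]
  funext i
  obtain ⟨j, rfl⟩ := (finRotate (n + 1)).surjective i
  have hs : shift R R (n + 1) w (finRotate (n + 1) j) = w j := by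
    change w ((finRotate (n + 1)).symm (finRotate (n + 1) j)) = w j
    rw [Equiv.symm_apply_apply]
  rw [hs, ← hc (swapProd w 0 _), coord_swapProd _ _ _ _ (by omega) (Fin.is_lt _)]
  by_cases hj : j = Fin.last n
  · subst hj
    rw [finRotate_last, if_pos (by simp), ← hc w]
    congr 1
    simp
  · have hj' : (j : ℕ) < n := lt_of_le_of_ne (Nat.le_of_lt_succ j.2) fun h => hj (Fin.ext h)
    rw [coe_finRotate_of_ne_last hj, if_neg (by omega), if_pos (by omega), Nat.add_sub_cancel, hc]

theorem powForm_apply (q : QuadraticForm R R) (w : Fin k → R) :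
    powForm k q w = q 1 * ∑ i, w i * w i := by
  have hq : ∀ x, q x = q 1 * (x * x) := fun x => by
    have := q.map_smul x 1
    rw [smul_eq_mul, mul_one, smul_eq_mul] at this
    rw [this, mul_comm]
  rw [QuadraticMap.pi_apply, Finset.mul_sum]
  exact Finset.sum_congr rfl fun i _ => hq _

theorem sum_mul_rootVec (w : Fin k → R) (n : ℕ) (hn : n + 1 < k) :
    ∑ i, w i * rootVec R k n i = coord w n - coord w (n + 1) := by
  have h : ∀ m : ℕ, m < k → ∑ i : Fin k, w i * (if (i : ℕ) = m then 1 else 0) = coord w m := by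
    intro m hm
    rw [Finset.sum_eq_single ⟨m, hm⟩, if_pos rfl, mul_one, coord, dif_pos hm]
    · intro i _ hi
      rw [if_neg (fun h => hi (Fin.ext h)), mul_zero]
    · simp
  simp only [rootVec, mul_sub, Finset.sum_sub_distrib]
  rw [h n (by omega), h (n + 1) hn]

theorem polar_rootVec (q : QuadraticForm R R) (w : Fin k → R) (n : ℕ) (hn : n + 1 < k) :
    QuadraticMap.polar (powForm k q) (rootVec R k n) w =
      2 * q 1 * (coord w n - coord w (n + 1)) := by
  rw [← sum_mul_rootVec w n hn, QuadraticMap.polar, powForm_apply, powForm_apply, powForm_apply,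
    ← mul_sub, ← mul_sub, ← Finset.sum_sub_distrib, ← Finset.sum_sub_distrib, Finset.mul_sum,
    Finset.mul_sum]
  exact Finset.sum_congr rfl fun i _ => by simp; ring

theorem powForm_rootVec (q : QuadraticForm R R) (n : ℕ) (hn : n + 1 < k) :
    powForm k q (rootVec R k n) = 2 * q 1 := by
  rw [powForm_apply, sum_mul_rootVec _ n hn, coord_rootVec (by omega), coord_rootVec hn]
  simp
  ring

/-- Twisted conjugation by the difference of two consecutive basis vectors is the transposition of
the two coordinates. -/
theorem rootVec_mul_ι (q : QuadraticForm R R) (w : Fin k → R) (n : ℕ) (hn : n + 1 < k) :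
    CliffordAlgebra.ι (powForm k q) (rootVec R k n) * CliffordAlgebra.ι _ w =
      -(CliffordAlgebra.ι _ (w - (coord w n - coord w (n + 1)) • rootVec R k n) *
        CliffordAlgebra.ι _ (rootVec R k n)) := by
  have h := CliffordAlgebra.ι_mul_ι_add_swap (Q := powForm k q) (rootVec R k n) w
  rw [eq_neg_iff_add_eq_zero, map_sub, map_smul, sub_mul, smul_mul_assoc,
    CliffordAlgebra.ι_sq_scalar, powForm_rootVec q n hn, ← add_sub_assoc, h,
    polar_rootVec q w n hn, Algebra.smul_def, ← map_mul, ← map_sub]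
  convert map_zero (algebraMap R (CliffordAlgebra (powForm k q)))
  ring

theorem rootProd_mul_ι (q : QuadraticForm R R) (w : Fin k → R) (m n : ℕ) (h : n + m < k) :
    rootProd q k n m * CliffordAlgebra.ι _ w =
      (-1) ^ m * (CliffordAlgebra.ι _ (swapProd w n m) * rootProd q k n m) := by
  induction m generalizing n with
  | zero => simp [rootProd, swapProd]
  | succ m ih =>
    have hc : ∀ a b : CliffordAlgebra (powForm k q), a * ((-1) ^ m * b) = (-1) ^ m * (a * b) :=
      fun a b => by rw [← mul_assoc, ← ((Commute.neg_one_left a).pow_left m).eq, mul_assoc]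
    rw [rootProd, mul_assoc, ih (n + 1) (by omega), hc, ← mul_assoc (CliffordAlgebra.ι _ _),
      rootVec_mul_ι q _ n (by omega), swapProd, pow_succ]
    simp [mul_assoc]

theorem involute_rootProd (q : QuadraticForm R R) (m n : ℕ) :
    CliffordAlgebra.involute (rootProd q k n m) = (-1) ^ m * rootProd q k n m := by
  induction m generalizing n with
  | zero => simp [rootProd]
  | succ m ih =>
    rw [rootProd, map_mul, ih, CliffordAlgebra.involute_ι, pow_succ, neg_mul, ← mul_assoc,
      ← ((Commute.neg_one_left (CliffordAlgebra.ι (powForm k q) _)).pow_left m).eq]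
    simp [mul_assoc]

theorem rootProd_mul_reverse (q : QuadraticForm R R) (m n : ℕ) (h : n + m < k) :
    rootProd q k n m * CliffordAlgebra.reverse (rootProd q k n m) =
      algebraMap R _ ((2 * q 1) ^ m) := by
  induction m generalizing n with
  | zero => simp [rootProd]
  | succ m ih =>
    rw [rootProd, CliffordAlgebra.reverse.map_mul, CliffordAlgebra.reverse_ι, mul_assoc,
      ← mul_assoc (rootProd q k (n + 1) m), ih (n + 1) (by omega), Algebra.commutes, ← mul_assoc,
      CliffordAlgebra.ι_sq_scalar, powForm_rootVec q n (by omega), ← map_mul, pow_succ, mul_comm]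

theorem contractLeft_rootProd (q : QuadraticForm R R) (d : Module.Dual R (Fin k → R)) (m n : ℕ)
    (h : ∀ j, n ≤ j → j < n + m → d (rootVec R k j) = 0) :
    CliffordAlgebra.contractLeft d (rootProd q k n m) = 0 := by
  induction m generalizing n with
  | zero => simp [rootProd]
  | succ m ih =>
    rw [rootProd, CliffordAlgebra.contractLeft_ι_mul, h n le_rfl (by omega),
      ih (n + 1) fun j hj hj' => h j (by omega) (by omega)]
    simp

variable [Invertible (2 : R)]

/-- Each root vector is orthogonal to all of the following ones but the next, so the scalar part of
the product is the product of those of consecutive pairs. -/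
theorem scalarPart_rootProd (q : QuadraticForm R R) (m n : ℕ) (h : n + 2 * m < k) :
    scalarPart (powForm k q) (rootProd q k n (2 * m)) = (-q 1) ^ m := by
  induction m generalizing n with
  | zero => simp [rootProd, scalarPart_one]
  | succ m ih =>
    have hB : ∀ j, j < k → j + 1 < k →
        QuadraticMap.associated (R := R) (powForm k q) (rootVec R k n) (rootVec R k j) =
        q 1 * (coord (rootVec R k j) n - coord (rootVec R k j) (n + 1)) := by
      intro j hj hj'
      have h2 : ⅟(2 : R) * 2 = 1 := invOf_mul_self _
      have := polar_rootVec q (rootVec R k j) n (by omega)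
      rw [QuadraticMap.polar] at this
      rw [QuadraticMap.associated_apply, this, Module.End.smul_def,
        QuadraticMap.half_moduleEnd_apply_eq_half_smul, smul_eq_mul]
      linear_combination q 1 * (coord (rootVec R k j) n - coord (rootVec R k j) (n + 1)) * h2
    have h0 : CliffordAlgebra.contractLeft
        (QuadraticMap.associated (R := R) (powForm k q) (rootVec R k n))
        (rootProd q k (n + 1 + 1) (2 * m)) = 0 := by
      refine contractLeft_rootProd q _ _ _ fun j hj hj' => ?_
      rw [hB j (by omega) (by omega), coord_rootVec (by omega), coord_rootVec (by omega),
        if_neg (by omega), if_neg (by omega), if_neg (by omega), if_neg (by omega)]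
      simp
    have h1 : QuadraticMap.associated (R := R) (powForm k q) (rootVec R k n) (rootVec R k (n + 1)) =
        -q 1 := by
      rw [hB (n + 1) (by omega) (by omega), coord_rootVec (by omega), coord_rootVec (by omega),
        if_neg (by omega), if_neg (by omega), if_pos rfl, if_neg (by omega)]
      ring
    rw [show 2 * (m + 1) = 2 * m + 1 + 1 by ring, rootProd, rootProd, scalarPart_ι_mul,
      CliffordAlgebra.contractLeft_ι_mul, h0, mul_zero, sub_zero, map_smul,
      ih (n + 1 + 1) (by omega), h1, smul_eq_mul, pow_succ, mul_comm]

/-- The cyclic shift of an odd number `k` of coordinates is the product of the `k - 1` reflections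
in the differences of consecutive basis vectors. -/
theorem hasRotor_rank_one (hk : Odd k) (q : QuadraticForm R R) (hq : IsUnit (q 1)) :
    HasRotor (powForm k q) (shift R R k) := by
  obtain ⟨m, rfl⟩ := hk
  have hm : Even (2 * m) := even_two_mul m
  refine ⟨rootProd q (2 * m + 1) 0 (2 * m), ⟨?_, fun w => ?_⟩, ?_, (2 * q 1) ^ (2 * m), ?_, ?_⟩
  · rw [involute_rootProd, hm.neg_one_pow, one_mul]
  · rw [rootProd_mul_ι q w _ _ (by omega), hm.neg_one_pow, one_mul,
      ← swapProd_eq_shift (by omega) w]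
    rfl
  · rw [scalarPart_rootProd q m 0 (by omega)]
    exact hq.neg.pow m
  · exact ((isUnit_of_invertible 2).mul hq).pow _
  · exact rootProd_mul_reverse q _ _ (by omega)

end RankOne

section Spin

variable {R : Type u} [CommRing R] [Invertible (2 : R)]

/-- The cyclic shift of an odd power of a nondegenerate form is induced by a rotor. The form is
reached from rank one forms by orthogonal sums, summands and isometries. -/
theorem hasRotor_of_nondegenerate {k : ℕ} (hk : Odd k) {W : Type u} [AddCommGroup W] [Module R W]
    [Module.Finite R W] [Module.Projective R W] (q : QuadraticForm R W)
    (hq : Function.Bijective q.polarBilin) : HasRotor (powForm k q) (shift R W k) := by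
  -- splitness is carried along, as it is needed to pass to orthogonal summands
  refine (nondegenerate_induction (motive := fun {V} [AddCommGroup V] [Module R V]
    (q : QuadraticForm R V) => IsSplit q ∧ HasRotor (powForm k q) (shift R V k)) ?_ ?_ ?_ ?_ q hq).2
  · intro V W _ _ _ _ Q P e h
    exact ⟨h.1.of_isometryEquiv e,
      h.2.map (QuadraticMap.IsometryEquiv.pi fun _ => e) fun u => rfl⟩
  · intro q hq
    exact ⟨IsSplit.rank_one q hq, hasRotor_rank_one hk q hq⟩
  · intro V W _ _ _ _ Q P h h'
    exact ⟨h.1.prod h'.1, (h.2.prod h'.2).map (powProd k Q P).symm fun u => rfl⟩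
  · intro V W _ _ _ _ Q P h
    have h1 := h.1.of_prod
    have h2 := (h.1.of_isometryEquiv (QuadraticMap.IsometryEquiv.prodComm Q P)).of_prod
    exact ⟨h1, HasRotor.of_prod (h1.pow k) (h2.pow k) (h.2.map
      (σ' := Prod.map (shift R V k) (shift R W k)) (powProd k Q P) fun u => rfl)⟩

end Spin

/-! ### Lifting the cyclic shift to the spin group -/

section SpinLift

variable {R : Type u} [CommRing R] {U W : Type u} [AddCommGroup U] [Module R U]
  [AddCommGroup W] [Module R W] {P : QuadraticForm R U} {q : QuadraticForm R W} {k : ℕ}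

theorem finRotate_pow_self (k : ℕ) : finRotate k ^ k = 1 := by
  obtain _ | n := k
  · rfl
  · have : finRotate (n + 1) = Equiv.addRight 1 := Equiv.ext fun i => finRotate_apply i
    have h : (n + 1) • (1 : Fin (n + 1)) = 0 := by
      simpa using card_nsmul_eq_zero (x := (1 : Fin (n + 1)))
    rw [this, Equiv.nsmul_addRight, h]
    ext i
    simp

theorem shift_iterate (n : ℕ) (w : Fin k → W) (i : Fin k) :
    (shift R W k)^[n] w ((finRotate k ^ n) i) = w i := by
  induction n generalizing w i with
  | zero => rfl
  | succ n ih =>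
    rw [Function.iterate_succ_apply, pow_succ, Equiv.Perm.mul_apply, ih]
    change w ((finRotate k).symm (finRotate k i)) = w i
    rw [Equiv.symm_apply_apply]

/-- The cyclic shift of `k` coordinates has order `k`. -/
theorem shift_iterate_self (w : Fin k → W) : (shift R W k)^[k] w = w := by
  funext i
  have := shift_iterate (R := R) k w i
  rwa [finRotate_pow_self] at this

theorem IsRotor.pow {σ : U → U} {x : CliffordAlgebra P} (hx : IsRotor P σ x) (n : ℕ) :
    IsRotor P σ^[n] (x ^ n) := by
  refine ⟨by rw [map_pow, hx.even], fun u => ?_⟩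
  induction n generalizing u with
  | zero => simp
  | succ n ih =>
    rw [pow_succ, mul_assoc, hx.mul_ι, ← mul_assoc, ih, mul_assoc, Function.iterate_succ_apply]

theorem pow_mul_reverse_pow {x : CliffordAlgebra P} {r : R}
    (h : x * CliffordAlgebra.reverse x = algebraMap R _ r) (n : ℕ) :
    x ^ n * CliffordAlgebra.reverse (x ^ n) = algebraMap R _ (r ^ n) := by
  induction n with
  | zero => simp
  | succ n ih =>
    rw [pow_succ, CliffordAlgebra.reverse.map_mul, mul_assoc, ← mul_assoc x, h,
      Algebra.commutes r, ← mul_assoc, ih, ← map_mul, pow_succ]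

theorem SpinLift.involute_t (t : SpinLift k q) :
    CliffordAlgebra.involute (t.t : CliffordAlgebra (powForm k q)) = t.t :=
  CliffordAlgebra.involute_eq_of_mem_even t.isSpin.even

theorem SpinLift.isRotor (t : SpinLift k q) :
    IsRotor (powForm k q) (shift R W k) (t.t : CliffordAlgebra (powForm k q)) :=
  ⟨t.involute_t, fun u => by rw [← t.conj u, mul_assoc, Units.inv_mul, mul_one]⟩

theorem bijective_polarBilin_neg (hq : Function.Bijective q.polarBilin) :
    Function.Bijective (-q).polarBilin := by
  have : ⇑(-q).polarBilin = ⇑(LinearEquiv.neg R (M := W →ₗ[R] R)) ∘ ⇑q.polarBilin := by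
    funext x
    ext y
    simp [QuadraticMap.polar_neg]
  rw [this]
  exact (LinearEquiv.neg R).bijective.comp hq

variable [Invertible (2 : R)]

theorem mem_evenOdd_zero_of_involute_eq {a : CliffordAlgebra P}
    (ha : CliffordAlgebra.involute a = a) : a ∈ CliffordAlgebra.evenOdd P 0 := by
  obtain ⟨b, hb, c, hc, rfl⟩ := Submodule.mem_sup.1
    ((CliffordAlgebra.evenOdd_isCompl (Q := P)).sup_eq_top ▸ Submodule.mem_top (x := a))
  rw [map_add, CliffordAlgebra.involute_eq_of_mem_even hb,
    CliffordAlgebra.involute_eq_of_mem_odd hc, add_right_inj, neg_eq_iff_add_eq_zero,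
    ← two_smul R c] at ha
  have := congrArg (fun z => (⅟2 : R) • z) ha
  simp only [smul_smul, invOf_mul_self, one_smul, smul_zero] at this
  rwa [this, add_zero]

/-- Two rotors of order `k` and norm `1` over the same isometry are equal when `k` is odd: they
differ by a scalar `c` with `c ^ 2 = 1` and `c ^ k = 1`. -/
theorem IsSplit.rotor_unique (hP : IsSplit P) (hk : Odd k) {σ : U → U} {x y : CliffordAlgebra P}
    (hx : IsRotor P σ x) (hy : IsRotor P σ y) (hx1 : x * CliffordAlgebra.reverse x = 1)
    (hy1 : y * CliffordAlgebra.reverse y = 1) (hxk : x ^ k = 1) (hyk : y ^ k = 1) : x = y := by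
  have h := hP.reverse_mul_rotor hy hx
  set c := scalarPart P (CliffordAlgebra.reverse y * x)
  have hxy : x = c • y := by
    rw [Algebra.smul_def, Algebra.commutes, ← h, ← mul_assoc, hy1, one_mul]
  have hck : c ^ k = 1 := by
    apply algebraMap_injective P
    rw [map_one, Algebra.algebraMap_eq_smul_one, ← hyk, ← smul_pow, ← hxy, hxk, hyk]
  have hc2 : c * c = 1 := by
    apply algebraMap_injective P
    rw [map_one, Algebra.algebraMap_eq_smul_one, ← hy1, ← smul_mul_smul_comm, ← map_smul, ← hxy,
      hx1, hy1]
  obtain ⟨m, rfl⟩ := hk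
  rw [pow_succ, pow_mul, sq, hc2, one_pow, one_mul] at hck
  rw [hxy, hck, one_smul]

/-- A rotor `x` over the cyclic shift, with norm `r` and `x ^ k = s`, is normalised to an element of
norm `1` and order `k` by the scalar `r ^ ((k - 1) / 2) / s`, since `s ^ 2 = r ^ k`. -/
theorem HasRotor.nonempty_spinLift (hk : Odd k) (hP : IsSplit (powForm k q))
    (h : HasRotor (powForm k q) (shift R W k)) : Nonempty (SpinLift k q) := by
  obtain ⟨x, hx, -, r, hr, h1⟩ := h
  have hxk : x ^ k = algebraMap R _ (scalarPart _ (x ^ k)) := by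
    refine hP.eq_algebraMap (hx.pow k).even fun w => ?_
    rw [(hx.pow k).mul_ι, shift_iterate_self]
  set s := scalarPart _ (x ^ k)
  have hs : s * s = r ^ k := by
    apply algebraMap_injective (powForm k q)
    rw [← pow_mul_reverse_pow h1, hxk, CliffordAlgebra.reverse.commutes, map_mul]
  have hsu : IsUnit s := isUnit_of_mul_isUnit_left (by rw [hs]; exact hr.pow k)
  obtain ⟨s', hss⟩ := hsu.exists_right_inv
  have hs' : s' * s' * r ^ k = 1 := by rw [← hs]; linear_combination (s * s' + 1) * hss
  obtain ⟨m, hm⟩ := hk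
  let c := r ^ m * s'
  have hc2 : c * c * r = 1 := by
    rw [← hs', hm]; ring
  have hck : c ^ k * s = 1 := by
    have : c ^ k * s = (s' * s' * r ^ k) ^ m * (s * s') := by rw [hm]; ring
    rw [this, hs', hss, one_pow, one_mul]
  let t := c • x
  have ht : t ^ k = 1 := by
    rw [smul_pow, hxk, Algebra.smul_def, ← map_mul, hck, map_one]
  have hrot : IsRotor (powForm k q) (shift R W k) t :=
    ⟨by rw [map_smul, hx.even], fun u => by rw [smul_mul_assoc, hx.mul_ι, mul_smul_comm]⟩
  have hconj : ∀ (u : (CliffordAlgebra (powForm k q))ˣ), (u : CliffordAlgebra (powForm k q)) = t →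
      ∀ w, (u : CliffordAlgebra (powForm k q)) * CliffordAlgebra.ι _ w *
        (↑u⁻¹ : CliffordAlgebra (powForm k q)) = CliffordAlgebra.ι _ (shift R W k w) := by
    intro u hu w
    rw [Units.mul_inv_eq_iff_eq_mul, hu, hrot.mul_ι]
  let u := Units.ofPowEqOne t k ht (by omega)
  exact ⟨u, ⟨mem_evenOdd_zero_of_involute_eq hrot.even, fun w => ⟨_, hconj u rfl w⟩, by
      change t * CliffordAlgebra.reverse t = 1
      rw [map_smul, smul_mul_smul_comm, h1, Algebra.smul_def, ← map_mul, hc2, map_one]⟩,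
    hconj u rfl, Units.ext ht⟩

theorem SpinLift.eq_of_isSplit (hk : Odd k) (hP : IsSplit (powForm k q)) (t t' : SpinLift k q) :
    t = t' := by
  have h : t.t = t'.t := Units.ext (hP.rotor_unique hk t.isRotor t'.isRotor t.isSpin.norm
    t'.isSpin.norm (congrArg Units.val t.pow_eq_one) (congrArg Units.val t'.pow_eq_one))
  cases t
  cases t'
  cases h
  rfl

/-- The cyclic shift of `W ^ k` lifts uniquely to an element of order `k` of the spin group. -/
theorem SpinLift.nonempty_unique [Module.Finite R W] [Module.Projective R W] (hk : Odd k)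
    (hq : Function.Bijective q.polarBilin) : Nonempty (Unique (SpinLift k q)) := by
  have hP : IsSplit (powForm k q) := (IsSplit.of_nondegenerate q hq).pow k
  obtain ⟨t⟩ := (hasRotor_of_nondegenerate hk q hq).nonempty_spinLift hk hP
  exact ⟨⟨⟨t⟩, fun t' => SpinLift.eq_of_isSplit hk hP t' t⟩⟩

end SpinLift

/-! ### Tensor powers of the Clifford algebra -/

namespace GrMod

section CliffordHom

variable {R : Type u} [CommRing R] {U X : Type u} [AddCommGroup U] [Module R U]
  [AddCommGroup X] [Module R X] {P : QuadraticForm R U} {S : QuadraticForm R X}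

/-- The map `a ↦ a e` from the bimodule `C(P)` to a graded module `N`, for a vector `e` of `N`.
It is a morphism of graded modules if `e` is even and the two copies of each vector act in the same
way on `e`, see `cliffordHom_c` and `cliffordHom_ε`. -/
def cliffordHom (N : GrMod S) (g : (P.prod (-P)) →qᵢ S) (e : N.carrier) :
    (clifford P).carrier →ₗ[R] N.carrier :=
  LinearMap.flip N.act.toLinearMap e ∘ₗ (CliffordAlgebra.map g).toLinearMap ∘ₗ
    (CliffordAlgebra.map (QuadraticMap.Isometry.inl P (-P))).toLinearMap ∘ₗ
      (toClifford P).symm.toLinearMap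

theorem cliffordHom_apply (N : GrMod S) (g : (P.prod (-P)) →qᵢ S) (e : N.carrier)
    (a : CliffordAlgebra P) : cliffordHom N g e (toClifford P a) =
      N.act (CliffordAlgebra.map g (CliffordAlgebra.map (QuadraticMap.Isometry.inl P (-P)) a)) e :=
  rfl

theorem cliffordHom_one (N : GrMod S) (g : (P.prod (-P)) →qᵢ S) (e : N.carrier) :
    cliffordHom N g e (toClifford P 1) = e := by
  rw [cliffordHom_apply, map_one, map_one, map_one, Module.End.one_apply]

theorem cliffordHom_c (N : GrMod S) (g : (P.prod (-P)) →qᵢ S) {e : N.carrier}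
    (hv : ∀ y, N.c (g (0, y)) e = N.c (g (y, 0)) e) (x : U × U) (m : (clifford P).carrier) :
    cliffordHom N g e ((clifford P).c x m) = N.c (g x) (cliffordHom N g e m) := by
  obtain ⟨a, rfl⟩ := (toClifford P).surjective m
  obtain ⟨v, w⟩ := x
  have h1 : ∀ v, N.act (CliffordAlgebra.map g (CliffordAlgebra.map
      (QuadraticMap.Isometry.inl P (-P)) (CliffordAlgebra.ι P v))) = N.c (g (v, 0)) := fun v => by
    rw [CliffordAlgebra.map_apply_ι, CliffordAlgebra.map_apply_ι, act_ι]
    rfl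
  have h2 : N.act (CliffordAlgebra.map g (CliffordAlgebra.map
      (QuadraticMap.Isometry.inr P (-P)) (CliffordAlgebra.ι (-P) w))) = N.c (g (0, w)) := by
    rw [CliffordAlgebra.map_apply_ι, CliffordAlgebra.map_apply_ι, act_ι]
    rfl
  have h3 := congrArg (fun z => N.act (CliffordAlgebra.map g z) e)
    (ι_inr_mul_map_inl (Q' := -P) w a)
  simp only [map_mul, Module.End.mul_apply] at h3
  have h4 : g (v, w) = g (v, 0) + g (0, w) := by rw [← map_add]; simp
  rw [clifford_c, map_add, map_add, cliffordHom_apply, cliffordHom_apply, cliffordHom_apply, h4,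
    map_add, LinearMap.add_apply, map_mul, map_mul, map_mul, Module.End.mul_apply, h1, map_mul,
    map_mul, map_mul, Module.End.mul_apply, h1, ← hv, ← h2, h3]

theorem cliffordHom_ε (N : GrMod S) (g : (P.prod (-P)) →qᵢ S) {e : N.carrier} (he : N.ε e = e)
    (m : (clifford P).carrier) :
    cliffordHom N g e ((clifford P).ε m) = N.ε (cliffordHom N g e m) := by
  obtain ⟨a, rfl⟩ := (toClifford P).surjective m
  rw [clifford_ε, cliffordHom_apply, cliffordHom_apply, ε_act, he, involute_map, involute_map]

/-- If the split algebra `C(P ⊥ -P)` acts on both sides, every functional `φ` on `C(P)` is recovered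
from `cliffordHom`: the endomorphism `a ↦ φ a • 1` comes from an element of `C(P ⊥
-P)`, which maps
the image of `a` to `φ a • e`. Hence the kernel is killed by all functionals. -/
theorem cliffordHom_injective [Invertible (2 : R)] (hP : IsSplit P) (N : GrMod S)
    (g : (P.prod (-P)) →qᵢ S) {e : N.carrier} (hv : ∀ y, N.c (g (0, y)) e = N.c (g (y, 0)) e)
    (l : N.carrier →ₗ[R] R) (hl : l e = 1) : Function.Injective (cliffordHom N g e) := by
  have := hP.projective
  rw [injective_iff_map_eq_zero]
  intro m hm
  obtain ⟨a, rfl⟩ := (toClifford P).surjective m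
  rw [(toClifford P).map_eq_zero_iff, ← Module.forall_dual_apply_eq_zero_iff R]
  intro φ
  obtain ⟨z, hz⟩ := hP.bijective.2
    (LinearMap.toSpanSingleton R _ (toClifford P 1) ∘ₗ φ ∘ₗ (toClifford P).symm.toLinearMap)
  have h1 := hom_act (clifford P) N g _ (cliffordHom_c N g hv) z (toClifford P a)
  rw [hm, map_zero, hz] at h1
  have h2 := congrArg l h1
  simpa [cliffordHom_one, hl] using h2

end CliffordHom

section TensorPower

variable {R : Type u} [CommRing R] {U : Type u} [AddCommGroup U] [Module R U]
  {P : QuadraticForm R U}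

/-- The `k`-th graded tensor power of a graded module over `C(U)`, as a graded module over
`C(U ^ k)`: the vector `x` acts as `∑ i, x i` with the `i`-th summand acting on the `i`-th
factor. -/
def tensorPower (M : GrMod P) (k : ℕ) : GrMod (powForm k P) where
  carrier := ⨂[R] _ : Fin k, M.carrier
  c :=
    { toFun := fun x => ∑ i : Fin k, M.slot k i (M.c (x i))
      map_add' := fun x y => by
        simp only [Pi.add_apply, ← Finset.sum_add_distrib, ← map_add]
      map_smul' := fun r x => by
        simp only [Pi.smul_apply, Finset.smul_sum, ← map_smul, RingHom.id_apply] }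
  c_mul_self := fun x => by
    change (∑ i : Fin k, M.slot k i (M.c (x i))) * (∑ i : Fin k, M.slot k i (M.c (x i))) = _
    rw [sum_mul_self_of_anticommute _ _ fun i j hij =>
      M.slot_mul_slot_of_ne k hij (M.ε_mul_c _) (M.ε_mul_c _)]
    simp only [M.slot_mul_slot_self k _ (M.c_mul_self _), ← map_sum]
    congr 1
    simp
  ε := PiTensorProduct.map fun _ => M.ε
  ε_mul_self := by
    rw [← PiTensorProduct.map_mul]
    simp [M.ε_mul_self]
  ε_mul_c := fun x => by
    change _ * (∑ i : Fin k, M.slot k i (M.c (x i))) = -((∑ i : Fin k, M.slot k i (M.c (x i))) * _)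
    rw [Finset.mul_sum, Finset.sum_mul, ← Finset.sum_neg_distrib]
    refine Finset.sum_congr rfl fun i _ => ?_
    rw [slot_apply, ← PiTensorProduct.map_mul, ← PiTensorProduct.map_mul]
    refine (map_of_smul M k (fun l => if l = i then -1 else 1) _
      (Function.update (fun j => if j < i then M.ε else 1) i (M.c (x i)) * fun _ => M.ε)
        fun l => ?_).trans ?_
    · rcases eq_or_ne l i with rfl | hi
      · simp [M.ε_mul_c]
      · simp only [Pi.mul_apply, Function.update_of_ne hi, hi, if_false, one_smul]
        split_ifs <;> simp
    · rw [Finset.prod_ite_eq' Finset.univ i, if_pos (Finset.mem_univ i)]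
      exact neg_one_smul R (_ : Module.End R (⨂[R] _ : Fin k, M.carrier))

variable (M : GrMod P) (k : ℕ)

/-- The pure tensors. -/
def pure : MultilinearMap R (fun _ : Fin k => M.carrier) (M.tensorPower k).carrier :=
  PiTensorProduct.tprod R

/-- The operator `slot`, on the carrier of the tensor power. -/
def slotEnd (i : Fin k) : Module.End R M.carrier →ₗ[R] Module.End R (M.tensorPower k).carrier :=
  M.slot k i

theorem slotEnd_pure (i : Fin k) (f : Module.End R M.carrier) (m : Fin k → M.carrier)
    (hm : ∀ j < i, M.ε (m j) = m j) :
    M.slotEnd k i f (M.pure k m) = M.pure k (Function.update m i (f (m i))) := by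
  have : M.slotEnd k i f (M.pure k m) = M.pure k (fun j =>
      Function.update (fun j => if j < i then M.ε else 1) i f j (m j)) :=
    PiTensorProduct.map_tprod _ _
  rw [this]
  congr 1
  funext j
  rcases eq_or_ne j i with rfl | hj
  · simp
  · rw [Function.update_of_ne hj, Function.update_of_ne hj]
    split_ifs with h
    · exact hm j h
    · rfl

theorem tensorPower_c (x : Fin k → U) :
    (M.tensorPower k).c x = ∑ i, M.slotEnd k i (M.c (x i)) := rfl

theorem tensorPower_ε_pure (m : Fin k → M.carrier) :
    (M.tensorPower k).ε (M.pure k m) = M.pure k fun i => M.ε (m i) :=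
  PiTensorProduct.map_tprod _ _

theorem span_range_pure : Submodule.span R (Set.range (M.pure k)) = ⊤ :=
  PiTensorProduct.span_tprod_eq_top

theorem tensorPower_c_single (i : Fin k) (x : U) :
    (M.tensorPower k).c (Pi.single i x) = M.slotEnd k i (M.c x) := by
  rw [tensorPower_c, Finset.sum_eq_single i, Pi.single_eq_same]
  · intro j _ hj
    rw [Pi.single_eq_of_ne hj, map_zero, map_zero]
  · simp

theorem tensorPower_act_single (i : Fin k) (a : CliffordAlgebra P) (m : Fin k → M.carrier)
    (hm : ∀ j < i, M.ε (m j) = m j) :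
    (M.tensorPower k).act (CliffordAlgebra.map
      (QuadraticMap.Isometry.single (fun _ : Fin k => P) i) a) (M.pure k m) =
        M.pure k (Function.update m i (M.act a (m i))) := by
  induction a using CliffordAlgebra.induction generalizing m with
  | algebraMap r => simp
  | ι x =>
    rw [CliffordAlgebra.map_apply_ι, act_ι, act_ι]
    exact (LinearMap.congr_fun (M.tensorPower_c_single k i x) _).trans (M.slotEnd_pure k i _ m hm)
  | mul a b ha hb =>
    rw [map_mul, map_mul, Module.End.mul_apply, hb m hm, ha _ fun j hj => ?_, Function.update_self,
      Function.update_idem, map_mul, Module.End.mul_apply]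
    rw [Function.update_of_ne hj.ne]
    exact hm j hj
  | add a b ha hb =>
    rw [map_add, map_add, LinearMap.add_apply, ha m hm, hb m hm, map_add, LinearMap.add_apply,
      MultilinearMap.map_update_add]

/-- The graded cyclic permutation of the factors of the tensor power. -/
def tensorCyc [Invertible (2 : R)] : Module.End R (M.tensorPower k).carrier := M.cyc k

theorem tensorCyc_c [Invertible (2 : R)] (x : Fin k → U) (z : (M.tensorPower k).carrier) :
    M.tensorCyc k ((M.tensorPower k).c x z) =
      (M.tensorPower k).c (shift R U k x) (M.tensorCyc k z) := by
  refine LinearMap.congr_fun (f := M.tensorCyc k * (M.tensorPower k).c x)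
    (g := (M.tensorPower k).c (shift R U k x) * M.tensorCyc k) ?_ z
  change M.cyc k * (∑ i : Fin k, M.slot k i (M.c (x i))) =
    (∑ i : Fin k, M.slot k i (M.c (x ((finRotate k).symm i)))) * M.cyc k
  rw [Finset.mul_sum, Finset.sum_mul, ← Equiv.sum_comp (finRotate k) (fun i => _ * M.cyc k)]
  refine Finset.sum_congr rfl fun i _ => ?_
  rw [M.cyc_mul_slot k i (M.ε_mul_c _), Equiv.symm_apply_apply]

/-- The cyclic permutation fixes the power of an even vector. -/
theorem tensorCyc_pure [Invertible (2 : R)] (hk : 0 < k) (m : M.carrier) (hm : M.ε m = m) :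
    M.tensorCyc k (M.pure k fun _ => m) = M.pure k fun _ => m := by
  have h0 : M.evenProj m = m := by
    rw [evenProj, LinearMap.smul_apply, LinearMap.add_apply, Module.End.one_apply, hm,
      ← two_smul R m, smul_smul, invOf_mul_self, one_smul]
  have h1 : M.oddProj m = 0 := by
    rw [oddProj, LinearMap.smul_apply, LinearMap.sub_apply, Module.End.one_apply, hm, sub_self,
      smul_zero]
  change PiTensorProduct.reindex R (fun _ : Fin k => M.carrier) (finRotate k)
    (PiTensorProduct.map (fun i : Fin k => if (i : ℕ) + 1 = k then M.evenProj else 1)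
      (PiTensorProduct.tprod R fun _ => m) +
    PiTensorProduct.map (fun i : Fin k => if (i : ℕ) + 1 = k then M.oddProj else M.ε)
      (PiTensorProduct.tprod R fun _ => m)) = PiTensorProduct.tprod R fun _ => m
  rw [PiTensorProduct.map_tprod, PiTensorProduct.map_tprod,
    (PiTensorProduct.tprod R).map_coord_zero (⟨k - 1, by omega⟩ : Fin k)
      (m := fun i : Fin k => (if (i : ℕ) + 1 = k then M.oddProj else M.ε) m), add_zero,
    PiTensorProduct.reindex_tprod]
  · congr 1
    funext i
    split_ifs
    · exact h0
    · rfl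
  · rw [if_pos (show k - 1 + 1 = k by omega), h1]

end TensorPower

section Power

variable {R : Type u} [CommRing R] {V : Type u} [AddCommGroup V] [Module R V]
  (k : ℕ) (Q : QuadraticForm R V)

/-- The isometry `V ^ k ⊥ W ^ k ≅ (V ⊥ W) ^ k` with `W = V(-1)`. -/
def doublePow : ((powForm k Q).prod (-powForm k Q)).IsometryEquiv (powForm k (Q.prod (-Q))) where
  toFun x := fun i => (x.1 i, x.2 i)
  invFun x := (fun i => (x i).1, fun i => (x i).2)
  map_add' _ _ := rfl
  map_smul' _ _ := rfl
  left_inv _ := rfl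
  right_inv _ := rfl
  map_app' x := by simp [Finset.sum_add_distrib]

/-- The tensor power of the unit of the Clifford algebra. -/
def pureOne : ((clifford Q).tensorPower k).carrier := (clifford Q).pure k fun _ => toClifford Q 1

theorem ε_pureOne : ((clifford Q).tensorPower k).ε (pureOne k Q) = pureOne k Q := by
  rw [pureOne, tensorPower_ε_pure, clifford_ε, map_one]

theorem c_pureOne (y : Fin k → V) :
    ((clifford Q).tensorPower k).c (doublePow k Q (0, y)) (pureOne k Q) =
      ((clifford Q).tensorPower k).c (doublePow k Q (y, 0)) (pureOne k Q) := by
  rw [tensorPower_c, tensorPower_c, LinearMap.sum_apply, LinearMap.sum_apply]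
  refine Finset.sum_congr rfl fun i _ => ?_
  have h1 : doublePow k Q (0, y) i = (0, y i) := rfl
  have h2 : doublePow k Q (y, 0) i = (y i, 0) := rfl
  rw [h1, h2, pureOne, slotEnd_pure, slotEnd_pure, clifford_c, clifford_c]
  · simp
  all_goals
    intro j _
    rw [clifford_ε, map_one]

/-- The morphism `C(V ^ k) → C(V) ^ {⊗ k}` of graded bimodules that maps `1` to `1 ⊗ ⋯ ⊗ 1`. -/
def powerHom : (clifford (powForm k Q)).carrier →ₗ[R] ((clifford Q).tensorPower k).carrier :=
  cliffordHom _ (doublePow k Q).toIsometry (pureOne k Q)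

theorem powerHom_injective [Invertible (2 : R)] (hQ : IsSplit (powForm k Q)) :
    Function.Injective (powerHom k Q) := by
  let l : ((clifford Q).tensorPower k).carrier →ₗ[R] R :=
    PiTensorProduct.lift ((MultilinearMap.mkPiAlgebra R (Fin k) R).compLinearMap
      fun _ => scalarPart Q ∘ₗ (toClifford Q).symm.toLinearMap)
  refine cliffordHom_injective hQ _ _ (c_pureOne k Q) l ?_
  refine (PiTensorProduct.lift.tprod _).trans ?_
  simp [scalarPart_one]

/-- A pure tensor is reached by filling in its factors from the last to the first: the element of
`C(V)` that acts on the `i`-th factor meets only factors `1` before it, so that no sign occurs. -/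
theorem powerHom_surjective : Function.Surjective (powerHom k Q) := by
  have hact : ∀ (i : Fin k) (a : CliffordAlgebra Q) (z),
      z ∈ LinearMap.range (powerHom k Q) → ((clifford Q).tensorPower k).act (CliffordAlgebra.map
        (QuadraticMap.Isometry.single (fun _ : Fin k => Q.prod (-Q)) i)
          (CliffordAlgebra.map (QuadraticMap.Isometry.inl Q (-Q)) a)) z ∈
            LinearMap.range (powerHom k Q) := by
    rintro i a _ ⟨m, rfl⟩
    obtain ⟨b, rfl⟩ := (toClifford _).surjective m
    refine ⟨toClifford _ (CliffordAlgebra.map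
      (QuadraticMap.Isometry.single (fun _ : Fin k => Q) i) a * b), ?_⟩
    have h : (CliffordAlgebra.map (doublePow k Q).toIsometry).comp ((CliffordAlgebra.map
        (QuadraticMap.Isometry.inl (powForm k Q) (-powForm k Q))).comp (CliffordAlgebra.map
          (QuadraticMap.Isometry.single (fun _ : Fin k => Q) i))) = (CliffordAlgebra.map
        (QuadraticMap.Isometry.single (fun _ : Fin k => Q.prod (-Q)) i)).comp
          (CliffordAlgebra.map (QuadraticMap.Isometry.inl Q (-Q))) := by
      rw [CliffordAlgebra.map_comp_map, CliffordAlgebra.map_comp_map, CliffordAlgebra.map_comp_map]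
      congr 1
      ext x j
      · change (Pi.single i x : Fin k → V) j = ((Pi.single i (x, 0) : Fin k → V × V) j).1
        rcases eq_or_ne j i with rfl | hj
        · simp
        · simp [hj]
      · change (0 : V) = ((Pi.single i (x, 0) : Fin k → V × V) j).2
        rcases eq_or_ne j i with rfl | hj
        · simp
        · simp [hj]
    have h' := AlgHom.congr_fun h a
    simp only [AlgHom.comp_apply] at h'
    rw [powerHom, cliffordHom_apply, cliffordHom_apply, map_mul, map_mul, map_mul,
      Module.End.mul_apply, h']
  have key : ∀ n : ℕ, n ≤ k → ∀ m : Fin k → CliffordAlgebra Q,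
      (∀ j : Fin k, (j : ℕ) + n < k → m j = 1) →
      (clifford Q).pure k (fun j => toClifford Q (m j)) ∈ LinearMap.range (powerHom k Q) := by
    intro n
    induction n with
    | zero =>
      intro _ m hm
      refine ⟨toClifford _ 1, ?_⟩
      rw [powerHom, cliffordHom_one, pureOne]
      congr 1
      funext j
      rw [hm j (by omega)]
    | succ n ih =>
      intro hn m hm
      let i : Fin k := ⟨k - (n + 1), by omega⟩
      have h1 := hact i (m i) _ (ih (by omega) (Function.update m i 1) fun j hj => ?_)
      · rw [tensorPower_act_single] at h1
        · rw [Function.update_self, clifford_act_inl, mul_one] at h1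
          convert h1 using 2
          funext j
          rcases eq_or_ne j i with rfl | hj
          · simp
          · simp [hj]
        · intro j hj
          have hj' : (j : ℕ) < k - (n + 1) := hj
          rw [Function.update_of_ne hj.ne, hm j (by omega), clifford_ε, map_one]
      · rcases eq_or_ne j i with rfl | hji
        · simp
        · have : (j : ℕ) ≠ k - (n + 1) := fun h => hji (Fin.ext h)
          rw [Function.update_of_ne hji, hm j (by omega)]
  rw [← LinearMap.range_eq_top, eq_top_iff, ← span_range_pure, Submodule.span_le]
  rintro _ ⟨m, rfl⟩
  have := key k le_rfl (fun j => (toClifford Q).symm (m j)) fun j hj => by omega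
  simpa using this

variable [Invertible (2 : R)]

/-- The action of the diagonal copy of `V` and of `W ^ k`. -/
def diagVec (x : V × (Fin k → V)) : (Fin k → V) × (Fin k → V) := (fun _ => x.1, x.2)

/-- The shift as an isometry. -/
def shiftIsometry : (powForm k Q).IsometryEquiv (powForm k Q) where
  toLinearEquiv := shift R V k
  map_app' x := by
    rw [QuadraticMap.pi_apply, QuadraticMap.pi_apply]
    exact Equiv.sum_comp (finRotate k).symm fun i => Q (x i)

/-- The bimodule `C(V ^ k)` is the `k`-th graded tensor power of the bimodule `C(V)`. -/
def powerEquiv {k : ℕ} {Q : QuadraticForm R V} (hQ : IsSplit (powForm k Q)) :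
    (clifford (powForm k Q)).carrier ≃ₗ[R] ((clifford Q).power k).carrier :=
  LinearEquiv.ofBijective (M₂ := ((clifford Q).tensorPower k).carrier) (powerHom k Q)
    ⟨powerHom_injective k Q hQ, powerHom_surjective k Q⟩

variable {k Q} (hQ : IsSplit (powForm k Q))

theorem powerEquiv_c (x : V × (Fin k → V)) (m : (clifford (powForm k Q)).carrier) :
    powerEquiv hQ ((clifford (powForm k Q)).c (diagVec k x) m) =
      ((clifford Q).power k).c x (powerEquiv hQ m) :=
  cliffordHom_c _ (doublePow k Q).toIsometry (c_pureOne k Q) (diagVec k x) m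

theorem powerEquiv_ε (m : (clifford (powForm k Q)).carrier) :
    powerEquiv hQ ((clifford (powForm k Q)).ε m) =
      ((clifford Q).power k).ε (powerEquiv hQ m) :=
  cliffordHom_ε _ (doublePow k Q).toIsometry (ε_pureOne k Q) m

/-- The cyclic permutation of the factors corresponds to the automorphism of `C(V ^ k)` induced by
the cyclic shift of the coordinates. -/
theorem powerEquiv_shift (hk : 0 < k) (a : CliffordAlgebra (powForm k Q)) :
    powerEquiv hQ (toClifford _ (CliffordAlgebra.map (shiftIsometry k Q).toIsometry a)) =
      (clifford Q).powerCyc k (powerEquiv hQ (toClifford _ a)) := by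
  change powerHom k Q _ = (clifford Q).tensorCyc k (powerHom k Q _)
  rw [powerHom, cliffordHom_apply, cliffordHom_apply]
  let σ : powForm k (Q.prod (-Q)) →qᵢ powForm k (Q.prod (-Q)) :=
    (shiftIsometry k (Q.prod (-Q))).toIsometry
  have h1 := hom_act _ _ σ ((clifford Q).tensorCyc k) (fun x z => tensorCyc_c _ k x z)
    (CliffordAlgebra.map (doublePow k Q).toIsometry (CliffordAlgebra.map
      (QuadraticMap.Isometry.inl (powForm k Q) (-powForm k Q)) a)) (pureOne k Q)
  have h2 : (clifford Q).tensorCyc k (pureOne k Q) = pureOne k Q :=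
    tensorCyc_pure _ k hk _ (by rw [clifford_ε, map_one])
  have h3 : (CliffordAlgebra.map σ).comp ((CliffordAlgebra.map (doublePow k Q).toIsometry).comp
      (CliffordAlgebra.map (QuadraticMap.Isometry.inl (powForm k Q) (-powForm k Q)))) =
      (CliffordAlgebra.map (doublePow k Q).toIsometry).comp ((CliffordAlgebra.map
        (QuadraticMap.Isometry.inl (powForm k Q) (-powForm k Q))).comp
          (CliffordAlgebra.map (shiftIsometry k Q).toIsometry)) := by
    rw [CliffordAlgebra.map_comp_map, CliffordAlgebra.map_comp_map, CliffordAlgebra.map_comp_map,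
      CliffordAlgebra.map_comp_map]
    congr 1
  have h4 := AlgHom.congr_fun h3 a
  simp only [AlgHom.comp_apply] at h4
  rw [h1, h2, h4]

end Power
end GrMod

/-! ### Roots of unity and eigenmodules -/

section RootsOfUnity

/-- The class of `x` in the domain `ℤ[x]/(Φ_k)` is a primitive `k`-th root of unity. -/
theorem omega_isPrimitiveRoot {k : ℕ} (hk : 0 < k) :
    IsPrimitiveRoot (AdjoinRoot.root (Polynomial.cyclotomic k ℤ)) k := by
  have : IsDomain (Omega k) :=
    AdjoinRoot.isDomain_of_prime (Polynomial.cyclotomic.irreducible hk).prime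
  have hinj : Function.Injective (AdjoinRoot.of (Polynomial.cyclotomic k ℤ)) :=
    AdjoinRoot.of.injective_of_degree_ne_zero (Polynomial.degree_cyclotomic_pos k ℤ hk).ne'
  have : NeZero ((k : ℕ) : Omega k) := ⟨fun h => by
    have h1 : AdjoinRoot.of (Polynomial.cyclotomic k ℤ) (k : ℤ) = 0 := by simpa using h
    rw [map_eq_zero_iff _ hinj] at h1
    omega⟩
  rw [← Polynomial.isRoot_cyclotomic_iff, Polynomial.IsRoot, Polynomial.eval,
    ← Polynomial.map_cyclotomic k (AdjoinRoot.of (Polynomial.cyclotomic k ℤ)),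
    Polynomial.eval₂_map]
  exact AdjoinRoot.eval₂_root _

variable {R : Type u} [CommRing R] {k : ℕ} {ζ : R}

/-- The ring homomorphism `ℤ[x]/(Φ_k) → R` defined by a root of `Φ_k`. -/
theorem exists_omega_hom (hζ : (Polynomial.cyclotomic k R).IsRoot ζ) :
    ∃ f : Omega k →+* R, f (AdjoinRoot.root (Polynomial.cyclotomic k ℤ)) = ζ := by
  have h : Polynomial.eval₂ (Int.castRingHom R) ζ (Polynomial.cyclotomic k ℤ) = 0 := by
    rwa [Polynomial.IsRoot, Polynomial.eval, ← Polynomial.map_cyclotomic k (Int.castRingHom R),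
      Polynomial.eval₂_map] at hζ
  exact ⟨AdjoinRoot.lift _ ζ h, AdjoinRoot.lift_root h⟩

theorem root_pow_eq_one (hk : 0 < k) (hζ : (Polynomial.cyclotomic k R).IsRoot ζ) : ζ ^ k = 1 := by
  obtain ⟨f, rfl⟩ := exists_omega_hom hζ
  rw [← map_pow, (omega_isPrimitiveRoot hk).pow_eq_one, map_one]

/-- The nontrivial powers of a root of `Φ_k` have vanishing power sums. The identity is transported
from the domain `ℤ[x]/(Φ_k)`, since `R` may have zero divisors. -/
theorem geom_sum_root_eq_zero (hk : 0 < k) (hζ : (Polynomial.cyclotomic k R).IsRoot ζ) {n : ℕ}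
    (hn : ¬ k ∣ n) : ∑ j ∈ Finset.range k, (ζ ^ n) ^ j = 0 := by
  obtain ⟨f, rfl⟩ := exists_omega_hom hζ
  have : IsDomain (Omega k) :=
    AdjoinRoot.isDomain_of_prime (Polynomial.cyclotomic.irreducible hk).prime
  have hω := omega_isPrimitiveRoot hk
  set ω := AdjoinRoot.root (Polynomial.cyclotomic k ℤ)
  have h1 : (∑ j ∈ Finset.range k, (ω ^ n) ^ j) * (ω ^ n - 1) = 0 := by
    rw [geom_sum_mul, ← pow_mul, mul_comm, pow_mul, hω.pow_eq_one, one_pow, sub_self]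
  have h2 : ω ^ n - 1 ≠ 0 := fun h => hn (hω.dvd_of_pow_eq_one n (sub_eq_zero.1 h))
  have h3 := (mul_eq_zero.1 h1).resolve_right h2
  simpa using congrArg f h3

/-- For `k ∤ d`, the element `ζ ^ d - 1` divides `∑ l, ((ζ ^ d) ^ l - 1) = -k`. -/
theorem isUnit_root_pow_sub (hk : 0 < k) (hkR : IsUnit (k : R))
    (hζ : (Polynomial.cyclotomic k R).IsRoot ζ) {i j : Fin k} (hij : i ≠ j) :
    IsUnit (ζ ^ (i : ℕ) - ζ ^ (j : ℕ)) := by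
  have hζ1 := root_pow_eq_one hk hζ
  have hu : IsUnit ζ := IsUnit.of_pow_eq_one hζ1 hk.ne'
  have key : ∀ d : ℕ, ¬ k ∣ d → IsUnit (ζ ^ d - 1) := by
    intro d hd
    refine isUnit_of_dvd_unit ?_ hkR
    have h1 : ζ ^ d - 1 ∣ ∑ l ∈ Finset.range k, ((ζ ^ d) ^ l - 1) :=
      Finset.dvd_sum fun l _ => by simpa using sub_dvd_pow_sub_pow (ζ ^ d) 1 l
    rw [Finset.sum_sub_distrib, geom_sum_root_eq_zero hk hζ hd] at h1
    simpa using h1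
  have key2 : ∀ i j : Fin k, i < j → IsUnit (ζ ^ (i : ℕ) - ζ ^ (j : ℕ)) := by
    intro i j h
    have h' : (i : ℕ) < j := h
    have h1 : ζ ^ (i : ℕ) - ζ ^ (j : ℕ) = -(ζ ^ (i : ℕ) * (ζ ^ ((j : ℕ) - i) - 1)) := by
      rw [mul_sub, ← pow_add, Nat.add_sub_cancel' h'.le]
      ring
    rw [h1]
    refine ((hu.pow _).mul (key _ fun hd => ?_)).neg
    have := Nat.le_of_dvd (by omega) hd
    omega
  rcases lt_or_gt_of_ne hij with h | h
  · exact key2 i j h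
  · rw [← neg_sub]
    exact (key2 j i h).neg

end RootsOfUnity

section Spectral

variable {R : Type u} [CommRing R] {k : ℕ} {ζ : R} {M : Type*} [AddCommGroup M] [Module R M]

/-- If `T` is the combination `∑ ζ ^ f(x) e_x` of complete orthogonal idempotents `e_x`, its
eigenmodules are the images of partial sums of the idempotents. The differences of the eigenvalues
have to be units. -/
theorem eigenspace_eq_range_sum {ι : Type*} [Fintype ι] (f : ι → Fin k) (e : ι → Module.End R M)
    (he : CompleteOrthogonalIdempotents e) {T : Module.End R M}
    (hT : ∀ x, T * e x = ζ ^ (f x : ℕ) • e x)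
    (hu : ∀ i j : Fin k, i ≠ j → IsUnit (ζ ^ (i : ℕ) - ζ ^ (j : ℕ))) (j : Fin k) :
    T.eigenspace (ζ ^ (j : ℕ)) =
      LinearMap.range (∑ x ∈ Finset.univ.filter (fun x => f x = j), e x) := by
  classical
  have hTsum : T = ∑ x, ζ ^ (f x : ℕ) • e x := by
    rw [← mul_one T, ← he.complete, Finset.mul_sum]
    exact Finset.sum_congr rfl fun x _ => hT x
  have hT' : ∀ y, e y * T = ζ ^ (f y : ℕ) • e y := by
    intro y
    rw [hTsum, Finset.mul_sum, Finset.sum_eq_single y]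
    · rw [mul_smul_comm, (he.idem y).eq]
    · intro x _ hx
      rw [mul_smul_comm, he.ortho hx.symm, smul_zero]
    · simp
  ext m
  rw [Module.End.mem_eigenspace_iff]
  constructor
  · intro hm
    refine ⟨m, ?_⟩
    have h0 : ∀ y, f y ≠ j → e y m = 0 := by
      intro y hy
      have h1 := LinearMap.congr_fun (hT' y) m
      rw [Module.End.mul_apply, hm, map_smul, LinearMap.smul_apply] at h1
      have h2 : (ζ ^ (f y : ℕ) - ζ ^ (j : ℕ)) • e y m = 0 := by rw [sub_smul, h1, sub_self]
      exact (hu _ _ hy).smul_eq_zero.1 h2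
    have h3 := LinearMap.congr_fun he.complete m
    rw [← Finset.sum_filter_add_sum_filter_not Finset.univ (fun x => f x = j), LinearMap.add_apply,
      Module.End.one_apply] at h3
    rw [← add_zero ((∑ x ∈ Finset.univ.filter (fun x => f x = j), e x) m)]
    refine Eq.trans ?_ h3
    congr 1
    rw [LinearMap.sum_apply]
    exact (Finset.sum_eq_zero fun x hx => h0 x (Finset.mem_filter.1 hx).2).symm
  · rintro ⟨m, rfl⟩
    rw [← Module.End.mul_apply, Finset.mul_sum, LinearMap.sum_apply, LinearMap.sum_apply,
      Finset.smul_sum]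
    refine Finset.sum_congr rfl fun x hx => ?_
    rw [hT x, (Finset.mem_filter.1 hx).2, LinearMap.smul_apply]

variable (ζ) in
/-- The projection onto the eigenmodule of an operator `T` of order `k` for the eigenvalue `ζ ^ j`,
where `κ` is the inverse of `k`; the exponent `(k - 1) j` stands for `-j`. -/
def eigenProj (κ : R) (T : Module.End R M) (j : Fin k) : Module.End R M :=
  κ • ∑ i ∈ Finset.range k, (ζ ^ ((k - 1) * (j : ℕ)) • T) ^ i

theorem eigenProj_commute {κ : R} {T S : Module.End R M} (h : Commute S T) (j : Fin k) :
    Commute S (eigenProj ζ κ T j) :=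
  (Commute.sum_right _ _ _ fun i _ => (h.smul_right _).pow_right i).smul_right _

theorem mul_eigenProj (hζ : ζ ^ k = 1) {κ : R} {T : Module.End R M} (hT : T ^ k = 1) (j : Fin k) :
    T * eigenProj ζ κ T j = ζ ^ (j : ℕ) • eigenProj ζ κ T j := by
  have hk : 0 < k := j.pos
  have h1 : ζ ^ (j : ℕ) * ζ ^ ((k - 1) * (j : ℕ)) = 1 := by
    rw [← pow_add, show (j : ℕ) + (k - 1) * j = k * j by
      obtain ⟨n, rfl⟩ : ∃ n, k = n + 1 := ⟨k - 1, by omega⟩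
      rw [Nat.add_sub_cancel]; ring, pow_mul, hζ, one_pow]
  set S := ζ ^ ((k - 1) * (j : ℕ)) • T with hS
  have hSk : S ^ k = 1 := by
    rw [hS, smul_pow, hT, ← pow_mul, mul_comm, pow_mul, hζ, one_pow, one_smul]
  have hTS : T = ζ ^ (j : ℕ) • S := by rw [hS, smul_smul, h1, one_smul]
  have h2 : S * ∑ i ∈ Finset.range k, S ^ i = ∑ i ∈ Finset.range k, S ^ i := by
    have := mul_neg_geom_sum S k
    rw [hSk, sub_self, sub_mul, one_mul, sub_eq_zero] at this
    exact this.symm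
  rw [eigenProj, ← hS, mul_smul_comm]
  nth_rewrite 1 [hTS]
  rw [smul_mul_assoc, h2, smul_comm]

theorem completeOrthogonalIdempotents_eigenProj (hζ : (Polynomial.cyclotomic k R).IsRoot ζ)
    (hk : 0 < k) {κ : R} (hκ : κ * k = 1) {T : Module.End R M} (hT : T ^ k = 1) :
    CompleteOrthogonalIdempotents (eigenProj (k := k) ζ κ T) := by
  have hζ1 := root_pow_eq_one hk hζ
  have hkR : IsUnit (k : R) := IsUnit.of_mul_eq_one κ (by rw [mul_comm, hκ])
  have hcomm : ∀ j : Fin k, Commute T (eigenProj ζ κ T j) := fun j =>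
    eigenProj_commute (Commute.refl T) j
  have hort : ∀ a b : Fin k, a ≠ b → eigenProj ζ κ T a * eigenProj ζ κ T b = 0 := by
    intro a b hab
    have h1 : T * (eigenProj ζ κ T a * eigenProj ζ κ T b) =
        ζ ^ (a : ℕ) • (eigenProj ζ κ T a * eigenProj ζ κ T b) := by
      rw [← mul_assoc, mul_eigenProj hζ1 hT, smul_mul_assoc]
    have h2 : T * (eigenProj ζ κ T a * eigenProj ζ κ T b) =
        ζ ^ (b : ℕ) • (eigenProj ζ κ T a * eigenProj ζ κ T b) := by
      rw [← mul_assoc, (hcomm a).eq, mul_assoc, mul_eigenProj hζ1 hT, mul_smul_comm]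
    have h3 : (ζ ^ (a : ℕ) - ζ ^ (b : ℕ)) • (eigenProj ζ κ T a * eigenProj ζ κ T b) = 0 := by
      rw [sub_smul, ← h1, ← h2, sub_self]
    exact (isUnit_root_pow_sub hk hkR hζ hab).smul_eq_zero.1 h3
  have hsum : ∑ j : Fin k, eigenProj ζ κ T j = 1 := by
    simp only [eigenProj]
    rw [← Finset.smul_sum, Finset.sum_comm, Finset.sum_eq_single 0]
    -- the coefficient of `T ^ i` is a multiple of `∑ j, ζ ^ (-i j)`, which is zero for `0 < i < k`
    · simp only [pow_zero, Finset.sum_const, Finset.card_univ, Fintype.card_fin]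
      rw [← Nat.cast_smul_eq_nsmul R, smul_smul, hκ, one_smul]
    · intro i hi hi0
      have h1 : ∀ j : Fin k, (ζ ^ ((k - 1) * (j : ℕ)) • T) ^ i =
          (ζ ^ ((k - 1) * i)) ^ (j : ℕ) • T ^ i := fun j => by
        rw [smul_pow, ← pow_mul, ← pow_mul, mul_right_comm]
      rw [Finset.sum_congr rfl fun j _ => h1 j, ← Finset.sum_smul,
        Fin.sum_univ_eq_sum_range (fun j => (ζ ^ ((k - 1) * i)) ^ j),
        geom_sum_root_eq_zero hk hζ, zero_smul]
      intro hd
      have hc : Nat.Coprime k (k - 1) := by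
        obtain ⟨n, rfl⟩ : ∃ n, k = n + 1 := ⟨k - 1, by omega⟩
        simp
      have := Nat.le_of_dvd (by omega) (hc.dvd_of_dvd_mul_left hd)
      have := Finset.mem_range.1 hi
      omega
    · intro h
      exact absurd (Finset.mem_range.2 hk) h
  refine ⟨⟨fun a => ?_, fun a b hab => hort a b hab⟩, hsum⟩
  have := congrArg (fun S => eigenProj ζ κ T a * S) hsum
  simp only [Finset.mul_sum, mul_one] at this
  rw [Finset.sum_eq_single a (fun b _ hb => hort a b hb.symm) (by simp)] at this
  exact this

theorem eigenspace_eq_range_eigenProj (hζ : (Polynomial.cyclotomic k R).IsRoot ζ)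
    (hk : 0 < k) {κ : R} (hκ : κ * k = 1) {T : Module.End R M} (hT : T ^ k = 1) (j : Fin k) :
    T.eigenspace (ζ ^ (j : ℕ)) = LinearMap.range (eigenProj ζ κ T j) := by
  have hkR : IsUnit (k : R) := IsUnit.of_mul_eq_one κ (by rw [mul_comm, hκ])
  rw [eigenspace_eq_range_sum id _ (completeOrthogonalIdempotents_eigenProj hζ hk hκ hT)
    (fun j => mul_eigenProj (root_pow_eq_one hk hζ) hT j)
    (fun i j hij => isUnit_root_pow_sub hk hkR hζ hij)]
  congr 1
  simp [Finset.filter_eq']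

theorem isInternal_range {ι : Type*} [Fintype ι] [DecidableEq ι] {e : ι → Module.End R M}
    (he : CompleteOrthogonalIdempotents e) :
    DirectSum.IsInternal fun i => LinearMap.range (e i) := by
  rw [DirectSum.isInternal_submodule_iff_iSupIndep_and_iSup_eq_top]
  constructor
  · intro i
    rw [Submodule.disjoint_def]
    rintro _ ⟨m, rfl⟩ hm
    have h1 : (⨆ j, ⨆ (_ : j ≠ i), LinearMap.range (e j)) ≤ LinearMap.ker (e i) := by
      refine iSup₂_le fun j hj => ?_
      rintro _ ⟨n, rfl⟩
      rw [LinearMap.mem_ker, ← Module.End.mul_apply, he.ortho hj.symm, LinearMap.zero_apply]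
    have h2 := h1 hm
    rwa [LinearMap.mem_ker, ← Module.End.mul_apply, (he.idem i).eq] at h2
  · rw [eq_top_iff]
    intro m _
    have := LinearMap.congr_fun he.complete m
    rw [LinearMap.sum_apply, Module.End.one_apply] at this
    rw [← this]
    exact Submodule.sum_mem _ fun i _ => Submodule.mem_iSup_of_mem i ⟨m, rfl⟩

/-- An operator of order `k` is diagonalisable when `R` contains the `k`-th roots of unity and the
inverse of `k`. -/
theorem isInternal_eigenspace (hζ : (Polynomial.cyclotomic k R).IsRoot ζ) (hk : 0 < k)
    (hkR : IsUnit (k : R)) {T : Module.End R M} (hT : T ^ k = 1) :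
    DirectSum.IsInternal fun j : Fin k => T.eigenspace (ζ ^ (j : ℕ)) := by
  obtain ⟨κ, hκ⟩ := hkR.exists_left_inv
  have h : (fun j : Fin k => T.eigenspace (ζ ^ (j : ℕ))) =
      fun j => LinearMap.range (eigenProj ζ κ T j) :=
    funext fun j => eigenspace_eq_range_eigenProj hζ hk hκ hT j
  rw [h]
  exact isInternal_range (completeOrthogonalIdempotents_eigenProj hζ hk hκ hT)

end Spectral

namespace GrMod

section Untwisted

variable {R : Type u} [CommRing R] {V W : Type u} [AddCommGroup V] [Module R V]
  [AddCommGroup W] [Module R W] {p : QuadraticForm R V} {q : QuadraticForm R W} {k : ℕ}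

theorem incl_pow (t : SpinLift k q) (p : QuadraticForm R V) :
    (t.incl p : CliffordAlgebra (targetForm k p q)) ^ k = 1 := by
  rw [← Units.val_pow_eq_pow_val, SpinLift.incl, ← map_pow, t.pow_eq_one, map_one, Units.val_one]

theorem map_shiftIsometry_iterate (Q : QuadraticForm R V) (a : CliffordAlgebra (powForm k Q)) :
    (CliffordAlgebra.map (shiftIsometry k Q).toIsometry)^[k] a = a := by
  have h : ∀ n, (CliffordAlgebra.map (shiftIsometry k Q).toIsometry)^[n] =
      ⇑((CliffordAlgebra.map (shiftIsometry k Q).toIsometry) ^ n) := fun n =>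
    (AlgHom.coe_pow _ n).symm
  have h' : (CliffordAlgebra.map (shiftIsometry k Q).toIsometry) ^ k = AlgHom.id R _ := by
    refine CliffordAlgebra.hom_ext (LinearMap.ext fun x => ?_)
    have : ∀ n, ((CliffordAlgebra.map (shiftIsometry k Q).toIsometry) ^ n)
        (CliffordAlgebra.ι _ x) = CliffordAlgebra.ι _ ((shift R V k)^[n] x) := by
      intro n
      induction n with
      | zero => rfl
      | succ n ih =>
        rw [pow_succ', AlgHom.mul_apply, ih, CliffordAlgebra.map_apply_ι,
          Function.iterate_succ_apply']
        rfl
    simp only [LinearMap.comp_apply, AlgHom.toLinearMap_apply, AlgHom.id_apply]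
    rw [this, shift_iterate_self]
  rw [h, h', AlgHom.id_apply]

variable [Invertible (2 : R)]

/-- The operator `T' = t⁻¹ T` is linear over the whole Clifford algebra. -/
theorem untwisted_mul_act (M : GrMod (p.prod q)) (t : SpinLift k q)
    (a : CliffordAlgebra (targetForm k p q)) :
    M.untwisted t * (M.power k).act a = (M.power k).act a * M.untwisted t :=
  LinearMap.ext fun m => hom_act' _ _ (M.untwisted t)
    (fun x m => LinearMap.congr_fun (M.untwisted_mul_c t x) m) a m

theorem act_incl_mul_untwisted (M : GrMod (p.prod q)) (t : SpinLift k q) :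
    (M.power k).act (t.incl p : CliffordAlgebra (targetForm k p q)) * M.untwisted t =
      M.powerCyc k := by
  rw [untwisted, ← mul_assoc, ← map_mul, Units.mul_inv, map_one, one_mul]

/-- The operator `T' = t⁻¹ T` commutes with `t`, so that `T ^ k = t ^ k T' ^ k`. -/
theorem untwisted_pow (M : GrMod (p.prod q)) (t : SpinLift k q) (h : M.powerCyc k ^ k = 1) :
    M.untwisted t ^ k = 1 := by
  have hc : Commute ((M.power k).act (t.incl p : CliffordAlgebra (targetForm k p q)))
      (M.untwisted t) := (M.untwisted_mul_act t _).symm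
  rw [← act_incl_mul_untwisted M t, hc.mul_pow, ← map_pow, incl_pow, map_one, one_mul] at h
  exact h

/-- The graded cyclic permutation has order `k` on the power of `C(V)`, because it corresponds to
the automorphism of `C(V ^ k)` induced by the shift. -/
theorem powerCyc_pow {Q : QuadraticForm R V} (hk : 0 < k) (hQ : IsSplit (powForm k Q)) :
    (clifford Q).powerCyc k ^ k = 1 := by
  refine LinearMap.ext fun m => ?_
  obtain ⟨m, rfl⟩ := (powerEquiv hQ).surjective m
  obtain ⟨a, rfl⟩ := (toClifford _).surjective m
  have h : ∀ n, ((clifford Q).powerCyc k ^ n) (powerEquiv hQ (toClifford _ a)) =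
      powerEquiv hQ (toClifford _
        ((CliffordAlgebra.map (shiftIsometry k Q).toIsometry)^[n] a)) := by
    intro n
    induction n with
    | zero => rfl
    | succ n ih =>
      rw [pow_succ', Module.End.mul_apply, ih, ← powerEquiv_shift hQ hk,
        Function.iterate_succ_apply']
  rw [h, map_shiftIsometry_iterate, Module.End.one_apply]

end Untwisted
end GrMod

/-! ### Projectivity of the tensor power and classes of images of idempotents -/

namespace GrMod

section Restriction

variable {R : Type u} [CommRing R] {U U' : Type u} [AddCommGroup U]
  [Module R U] [AddCommGroup U'] [Module R U'] {S : QuadraticForm R U} {S' : QuadraticForm R U'}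

/-- A finitely generated projective module over `C(S ⊥ S')` is finitely generated and projective
over `C(S)` if `C(S')` is finitely generated and projective over `R`, because `C(S ⊥ S')` is then
finitely generated and projective over `C(S)`. -/
theorem IsFGProj.of_restrict_inl [Module.Finite R (CliffordAlgebra S')]
    [Module.Projective R (CliffordAlgebra S')] {X : GrMod (S.prod S')} (hX : X.IsFGProj)
    (Y : GrMod S) (f : Y.carrier ≃ₗ[R] X.carrier)
    (hf : ∀ x m, f (Y.c x m) = X.c (x, 0) (f m)) : Y.IsFGProj := by
  obtain ⟨n, i, s, hi, hs, h⟩ := hX.exists_split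
  obtain ⟨m, π, σ, -, -, hσ⟩ := Module.Finite.exists_comp_eq_id_of_projective R (CliffordAlgebra S')
  let b : Fin m → CliffordAlgebra S' := fun l => π (Pi.single l 1)
  let φ : Fin m → (CliffordAlgebra S' →ₗ[R] R) := fun l => LinearMap.proj l ∘ₗ σ
  let inl := CliffordAlgebra.map (QuadraticMap.Isometry.inl S S')
  let inr := CliffordAlgebra.map (QuadraticMap.Isometry.inr S S')
  have hb : ∀ c, ∑ l, φ l c • b l = c := by
    intro c
    have h1 : ∑ l, φ l c • (Pi.single l 1 : Fin m → R) = σ c := by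
      funext j
      simp [φ, Pi.single_apply]
    calc ∑ l, φ l c • b l = π (∑ l, φ l c • (Pi.single l 1 : Fin m → R)) := by
          simp only [map_sum, map_smul, b]
      _ = c := by rw [h1]; exact LinearMap.congr_fun hσ c
  have hz : ∀ z, ∑ l, inl (sliceLeft S S' (φ l) z) * inr (b l) = z := by
    intro z
    induction z using prod_induction with
    | h0 => simp
    | hadd x y hx hy => simp only [map_add, add_mul, Finset.sum_add_distrib, hx, hy]
    | hmul a c =>
      have : ∀ l, inl (sliceLeft S S' (φ l) (inl a * inr c)) * inr (b l) =
          inl a * inr (φ l c • b l) := fun l => by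
        rw [sliceLeft_inl_mul_inr, map_smul, map_smul, smul_mul_assoc, mul_smul_comm]
      change ∑ l, inl (sliceLeft S S' (φ l) (inl a * inr c)) * inr (b l) = inl a * inr c
      rw [Finset.sum_congr rfl fun l _ => this l, ← Finset.mul_sum, ← map_sum, hb]
  have hfa : ∀ a y, f (Y.act a y) = X.act (inl a) (f y) :=
    hom_act Y X (QuadraticMap.Isometry.inl S S') f.toLinearMap hf
  refine isFGProj_of_split (ι := Fin n × Fin m) Y
    (LinearMap.pi fun p => sliceLeft S S' (φ p.2) ∘ₗ LinearMap.proj p.1 ∘ₗ i ∘ₗ f.toLinearMap)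
    (f.symm.toLinearMap ∘ₗ s ∘ₗ LinearMap.pi fun j => ∑ l,
      LinearMap.mulRight R (inr (b l)) ∘ₗ inl.toLinearMap ∘ₗ LinearMap.proj (j, l)) ?_ ?_ ?_
  · intro a y
    ext p
    simp only [LinearMap.pi_apply, LinearMap.comp_apply, LinearEquiv.coe_coe, LinearMap.proj_apply,
      hfa, hi, Pi.smul_apply, smul_eq_mul]
    exact sliceLeft_inl_mul _ _ _
  · intro a g
    apply f.injective
    rw [hfa]
    simp only [LinearMap.comp_apply, LinearEquiv.coe_coe, LinearEquiv.apply_symm_apply]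
    rw [← hs]
    congr 1
    funext j
    simp [Finset.mul_sum, mul_assoc]
  · intro y
    apply f.injective
    simp only [LinearMap.comp_apply, LinearEquiv.coe_coe, LinearEquiv.apply_symm_apply]
    refine Eq.trans (congrArg s ?_) (h (f y))
    funext j
    simpa using hz (i (f y) j)

end Restriction

section PowerProjective

variable {R : Type u} [CommRing R] {V : Type u} [AddCommGroup V] [Module R V]
  (k : ℕ) (Q : QuadraticForm R V)

/-- The sum of the coordinates. -/
def coordSum (R : Type u) [CommRing R] (V : Type u) [AddCommGroup V] [Module R V] (k : ℕ) :
    (Fin k → V) →ₗ[R] V := ∑ i, LinearMap.proj i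

theorem coordSum_apply (w : Fin k → V) : coordSum R V k w = ∑ i, w i := by
  simp [coordSum]

/-- The restriction of the form of `V ^ k` to the orthogonal complement of the diagonal. -/
def zeroSumForm : QuadraticForm R (LinearMap.ker (coordSum R V k)) :=
  (powForm k Q).comp (LinearMap.ker (coordSum R V k)).subtype

theorem powForm_diag_add (v : V) (w : Fin k → V) (hw : ∑ i, w i = 0) :
    powForm k Q (fun i => v + w i) = (k : R) * Q v + powForm k Q w := by
  rw [QuadraticMap.pi_apply, QuadraticMap.pi_apply]
  have h : ∀ i, Q (v + w i) = Q v + Q (w i) + QuadraticMap.polarBilin Q v (w i) := fun i => by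
    rw [QuadraticMap.polarBilin_apply_apply, QuadraticMap.polar]; ring
  rw [Finset.sum_congr rfl fun i _ => h i, Finset.sum_add_distrib, Finset.sum_add_distrib,
    ← map_sum (QuadraticMap.polarBilin Q v), hw, map_zero, add_zero]
  simp

/-- The decomposition `V ^ k ≅ V(k) ⊥ V'`, for `k` invertible with inverse `κ`, where `V(k)` is
embedded diagonally and `V'` consists of the vectors whose coordinates have sum zero. -/
def diagDecomp {κ : R} (hκ : κ * k = 1) :
    (((k : R) • Q).prod (zeroSumForm k Q)).IsometryEquiv (powForm k Q) where
  toFun x := fun i => x.1 + x.2.1 i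
  map_add' x y := by funext i; simp; abel
  map_smul' r x := by funext i; simp
  invFun w := (κ • ∑ i, w i, ⟨fun i => w i - κ • ∑ i, w i, by
    rw [LinearMap.mem_ker, coordSum_apply, Finset.sum_sub_distrib, Finset.sum_const,
      Finset.card_univ, Fintype.card_fin, ← Nat.cast_smul_eq_nsmul R, smul_smul, mul_comm, hκ,
      one_smul, sub_self]⟩)
  left_inv x := by
    obtain ⟨v, w, hw⟩ := x
    rw [LinearMap.mem_ker, coordSum_apply] at hw
    have h : κ • ∑ i : Fin k, (v + w i) = v := by
      rw [Finset.sum_add_distrib, hw, add_zero, Finset.sum_const, Finset.card_univ,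
        Fintype.card_fin, ← Nat.cast_smul_eq_nsmul R, smul_smul, hκ, one_smul]
    refine Prod.ext h (Subtype.ext (funext fun i => ?_))
    change v + w i - κ • ∑ i : Fin k, (v + w i) = w i
    rw [h, add_sub_cancel_left]
  right_inv w := by funext i; simp
  map_app' x := by
    obtain ⟨v, w, hw⟩ := x
    rw [LinearMap.mem_ker, coordSum_apply] at hw
    exact powForm_diag_add k Q v w hw

/-- The decomposition `V ^ k ⊥ W ^ k ≅ (V(k) ⊥ W ^ k) ⊥ V'` with `W = V(-1)`. -/
def targetDecomp {κ : R} (hκ : κ * k = 1) : ((targetForm k Q (-Q)).prod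
    (zeroSumForm k Q)).IsometryEquiv ((powForm k Q).prod (-powForm k Q)) where
  toFun x := (diagDecomp k Q hκ (x.1.1, x.2), x.1.2)
  map_add' x y := by
    refine Prod.ext ?_ rfl
    exact map_add (diagDecomp k Q hκ) (x.1.1, x.2) (y.1.1, y.2)
  map_smul' r x := by
    refine Prod.ext ?_ rfl
    exact map_smul (diagDecomp k Q hκ) r (x.1.1, x.2)
  invFun y := ((((diagDecomp k Q hκ).symm y.1).1, y.2), ((diagDecomp k Q hκ).symm y.1).2)
  left_inv x := by simp
  right_inv y := by simp
  map_app' x := by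
    obtain ⟨⟨v, w⟩, w'⟩ := x
    have := (diagDecomp k Q hκ).map_app (v, w')
    simp only [QuadraticMap.prod_apply] at this ⊢
    rw [this]
    simp
    abel

theorem targetDecomp_inl {κ : R} (hκ : κ * k = 1) (x : V × (Fin k → V)) :
    targetDecomp k Q hκ (x, 0) = diagVec k x := by
  refine Prod.ext (funext fun i => ?_) rfl
  change x.1 + 0 = x.1
  rw [add_zero]

variable {k Q} [Invertible (2 : R)]

/-- The `k`-th power of `C(V)` is `C(V ^ k)`, which is finitely generated projective over
`C(V ^
k ⊥ W ^ k)`, hence over `C(V(k) ⊥ W ^ k)`: as `k` is invertible, `V(k)` is an orthogonal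
summand of `V ^ k`. -/
theorem isFGProj_power (hQ : IsSplit (powForm k Q)) (hkR : IsUnit (k : R)) :
    ((clifford Q).power k).IsFGProj := by
  obtain ⟨κ, hκ⟩ := hkR.exists_left_inv
  have h0 : IsSplit (zeroSumForm k Q) := (hQ.of_isometryEquiv
    ((diagDecomp k Q hκ).symm.trans (QuadraticMap.IsometryEquiv.prodComm _ _))).of_prod
  have h1 := h0.finite
  have h2 := h0.projective
  refine IsFGProj.of_restrict_inl (hQ.isFGProj.pullback (targetDecomp k Q hκ)) _
    (powerEquiv hQ).symm fun x m => ?_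
  change (powerEquiv hQ).symm (((clifford Q).power k).c x m) =
    (clifford (powForm k Q)).c (targetDecomp k Q hκ (x, 0)) ((powerEquiv hQ).symm m)
  rw [targetDecomp_inl, LinearEquiv.symm_apply_eq, powerEquiv_c, LinearEquiv.apply_symm_apply]

end PowerProjective

section Image

variable {R : Type u} [CommRing R] {U : Type u} [AddCommGroup U] [Module R U]
  {Q : QuadraticForm R U}

/-- The linear map `p` is an endomorphism of the graded module `M`: it commutes with the vectors and
has degree zero. -/
structure IsGrEnd (M : GrMod Q) (p : Module.End R M.carrier) : Prop where
  map_c : ∀ x m, p (M.c x m) = M.c x (p m)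
  map_ε : ∀ m, p (M.ε m) = M.ε (p m)

/-- The image of an endomorphism of a graded module, as a graded module. -/
def image (M : GrMod Q) {p : Module.End R M.carrier} (hp : M.IsGrEnd p) : GrMod Q :=
  M.restrict (LinearMap.range p)
    (fun x => by rintro _ ⟨m, rfl⟩; exact ⟨M.c x m, hp.map_c x m⟩)
    (by rintro _ ⟨m, rfl⟩; exact ⟨M.ε m, hp.map_ε m⟩)

variable {M : GrMod Q}

theorem IsGrEnd.sum {ι : Type*} (s : Finset ι) {p : ι → Module.End R M.carrier}
    (hp : ∀ i, M.IsGrEnd (p i)) : M.IsGrEnd (∑ i ∈ s, p i) :=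
  ⟨fun x m => by simp [(hp _).map_c], fun m => by simp [(hp _).map_ε]⟩

/-- The inclusion of the image of an endomorphism. -/
def imageIncl {p : Module.End R M.carrier} (hp : M.IsGrEnd p) :
    (M.image hp).carrier →ₗ[R] M.carrier := (LinearMap.range p).subtype

/-- The projection to the image of an endomorphism. -/
def imageProj {p : Module.End R M.carrier} (hp : M.IsGrEnd p) :
    M.carrier →ₗ[R] (M.image hp).carrier := p.rangeRestrict

section
variable {p : Module.End R M.carrier} (hp : M.IsGrEnd p)

theorem imageIncl_injective : Function.Injective (imageIncl hp) := Subtype.val_injective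

theorem imageIncl_proj (m : M.carrier) : imageIncl hp (imageProj hp m) = p m := rfl

theorem imageIncl_c (x : U) (m : (M.image hp).carrier) :
    imageIncl hp ((M.image hp).c x m) = M.c x (imageIncl hp m) := rfl

theorem imageIncl_ε (m : (M.image hp).carrier) :
    imageIncl hp ((M.image hp).ε m) = M.ε (imageIncl hp m) := rfl

theorem imageProj_surjective : Function.Surjective (imageProj hp) := p.surjective_rangeRestrict

theorem imageProj_c (x : U) (m : M.carrier) :
    imageProj hp (M.c x m) = (M.image hp).c x (imageProj hp m) :=
  imageIncl_injective hp (by rw [imageIncl_c, imageIncl_proj, imageIncl_proj, hp.map_c])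

theorem imageProj_ε (m : M.carrier) :
    imageProj hp (M.ε m) = (M.image hp).ε (imageProj hp m) :=
  imageIncl_injective hp (by rw [imageIncl_ε, imageIncl_proj, imageIncl_proj, hp.map_ε])

theorem imageProj_incl (hpp : p * p = p) (m : (M.image hp).carrier) :
    imageProj hp (imageIncl hp m) = m := by
  obtain ⟨m, rfl⟩ := imageProj_surjective hp m
  refine imageIncl_injective hp ?_
  rw [imageIncl_proj, imageIncl_proj, ← Module.End.mul_apply, hpp]

theorem IsFGProj.image (hM : M.IsFGProj) (hpp : p * p = p) : (M.image hp).IsFGProj := by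
  obtain ⟨n, i, s, hi, hs, h⟩ := hM.exists_split
  refine isFGProj_of_split _ (i ∘ₗ imageIncl hp) (imageProj hp ∘ₗ s) ?_ ?_ ?_
  · intro a m
    rw [LinearMap.comp_apply, hom_act' _ _ (imageIncl hp) (imageIncl_c hp), hi,
      LinearMap.comp_apply]
  · intro a f
    rw [LinearMap.comp_apply, hs, hom_act' _ _ (imageProj hp) (imageProj_c hp),
      LinearMap.comp_apply]
  · intro m
    rw [LinearMap.comp_apply, LinearMap.comp_apply, h, imageProj_incl hp hpp]

end

end Image
end GrMod

section ClassOfImage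

variable {R : Type u} [CommRing R] {U : Type u} [AddCommGroup U] [Module R U]
  {Q : QuadraticForm R U}

/-- The zero graded module. -/
def GrMod.zero (Q : QuadraticForm R U) : GrMod Q where
  carrier := PUnit
  c := 0
  c_mul_self _ := Subsingleton.elim _ _
  ε := 1
  ε_mul_self := Subsingleton.elim _ _
  ε_mul_c _ := Subsingleton.elim _ _

theorem hasOddInvolution_of_subsingleton {M : GrMod Q} (h : Subsingleton M.carrier) :
    M.HasOddInvolution :=
  ⟨1, Subsingleton.elim _ _, fun _ => Subsingleton.elim _ _, Subsingleton.elim _ _⟩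

theorem isFGProj_zero : (GrMod.zero Q).IsFGProj :=
  GrMod.isFGProj_of_split (ι := Fin 0) _ 0 0 (fun _ _ => by simp) (fun _ _ => by simp)
    fun _ => rfl

theorem GrMod.IsFGProj.congr {M N : GrMod Q} (hM : M.IsFGProj) (e : N.carrier ≃ₗ[R] M.carrier)
    (hc : ∀ x m, e (N.c x m) = M.c x (e m)) : N.IsFGProj :=
  hM.of_equiv N e AlgEquiv.refl fun x m => by rw [hc, ← M.act_ι]; rfl

/-- Isomorphic graded modules have the same class. -/
theorem cls_congr {M N : GrMod Q} (hM : M.IsFGProj) (e : N.carrier ≃ₗ[R] M.carrier)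
    (hc : ∀ x m, e (N.c x m) = M.c x (e m)) (hε : ∀ m, e (N.ε m) = M.ε (e m)) :
    cls N = cls M := by
  have h : N.IsSum M (GrMod.zero Q) :=
    ⟨e.trans ((LinearEquiv.prodUnique (M := M.carrier) (M₂ := PUnit.{u + 1}) (R := R)).symm),
      fun x m => Prod.ext (hc x m) rfl, fun m => Prod.ext (hε m) rfl⟩
  rw [cls_sum (hM.congr e hc) hM isFGProj_zero h,
    cls_eq_zero (M := GrMod.zero Q) (hasOddInvolution_of_subsingleton
      (inferInstanceAs (Subsingleton PUnit))),
    add_zero]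

/-- The class of the image of a sum of two orthogonal idempotents is the sum of the classes. -/
theorem cls_image_add {M : GrMod Q} (hM : M.IsFGProj) {p q r : Module.End R M.carrier}
    (hp : M.IsGrEnd p) (hq : M.IsGrEnd q) (hr : M.IsGrEnd r) (h : r = p + q) (hpp : p * p = p)
    (hqq : q * q = q) (hpq : p * q = 0) (hqp : q * p = 0) :
    cls (M.image hr) = cls (M.image hp) + cls (M.image hq) := by
  have hrr : r * r = r := by rw [h, mul_add, add_mul, add_mul, hpp, hqq, hpq, hqp]; simp
  have hpr : p * r = p := by rw [h, mul_add, hpp, hpq, add_zero]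
  have hqr : q * r = q := by rw [h, mul_add, hqq, hqp, zero_add]
  refine cls_sum (hM.image hr hrr) (hM.image hp hpp) (hM.image hq hqq) ?_
  refine ⟨LinearEquiv.ofLinearMap
    (((GrMod.imageProj hp).prod (GrMod.imageProj hq)) ∘ₗ GrMod.imageIncl hr)
    (GrMod.imageProj hr ∘ₗ (GrMod.imageIncl hp).coprod (GrMod.imageIncl hq)) ?_ ?_, ?_, ?_⟩
  · have hrp : r * p = p := by rw [h, add_mul, hpp, hqp, add_zero]
    have hrq : r * q = q := by rw [h, add_mul, hqq, hpq, zero_add]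
    refine LinearMap.ext fun z => ?_
    obtain ⟨x, y⟩ := z
    obtain ⟨x, rfl⟩ := GrMod.imageProj_surjective _ x
    obtain ⟨y, rfl⟩ := GrMod.imageProj_surjective _ y
    have e : GrMod.imageIncl hr (GrMod.imageProj hr (GrMod.imageIncl hp (GrMod.imageProj hp x) +
        GrMod.imageIncl hq (GrMod.imageProj hq y))) = p x + q y := by
      rw [GrMod.imageIncl_proj, GrMod.imageIncl_proj, GrMod.imageIncl_proj, map_add,
        ← Module.End.mul_apply, ← Module.End.mul_apply, hrp, hrq]
    refine Prod.ext (GrMod.imageIncl_injective _ ?_) (GrMod.imageIncl_injective _ ?_)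
    · refine (congrArg p e).trans ?_
      rw [map_add, ← Module.End.mul_apply, ← Module.End.mul_apply, hpp, hpq]
      exact add_zero _
    · refine (congrArg q e).trans ?_
      rw [map_add, ← Module.End.mul_apply, ← Module.End.mul_apply, hqq, hqp]
      exact zero_add _
  · refine LinearMap.ext fun z => ?_
    obtain ⟨x, rfl⟩ := GrMod.imageProj_surjective _ z
    refine GrMod.imageIncl_injective _ ?_
    change r (p (r x) + q (r x)) = r x
    rw [← LinearMap.add_apply, ← h, ← Module.End.mul_apply, ← Module.End.mul_apply, hrr, hrr]
  · intro x m
    exact Prod.ext ((congrArg _ (GrMod.imageIncl_c hr x m)).trans (GrMod.imageProj_c _ _ _))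
      ((congrArg _ (GrMod.imageIncl_c hr x m)).trans (GrMod.imageProj_c _ _ _))
  · intro m
    exact Prod.ext ((congrArg _ (GrMod.imageIncl_ε hr m)).trans (GrMod.imageProj_ε _ _))
      ((congrArg _ (GrMod.imageIncl_ε hr m)).trans (GrMod.imageProj_ε _ _))

/-- The class of a finitely generated projective module is additive over orthogonal idempotents. -/
theorem cls_image_sum {M : GrMod Q} (hM : M.IsFGProj) {ι : Type*} {p : ι → Module.End R M.carrier}
    (hp : OrthogonalIdempotents p) (hg : ∀ i, M.IsGrEnd (p i)) (s : Finset ι) :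
    cls (M.image (GrMod.IsGrEnd.sum s hg)) = ∑ i ∈ s, cls (M.image (hg i)) := by
  classical
  induction s using Finset.induction_on with
  | empty =>
    rw [Finset.sum_empty (f := fun i => cls (M.image (hg i)))]
    refine cls_eq_zero (hasOddInvolution_of_subsingleton ⟨fun x y => ?_⟩)
    obtain ⟨x, rfl⟩ := GrMod.imageProj_surjective _ x
    obtain ⟨y, rfl⟩ := GrMod.imageProj_surjective _ y
    apply GrMod.imageIncl_injective
    rw [GrMod.imageIncl_proj, GrMod.imageIncl_proj]
    simp
  | insert i s hi ih =>
    have h1 : p i * ∑ j ∈ s, p j = 0 := by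
      rw [Finset.mul_sum]
      exact Finset.sum_eq_zero fun j hj => hp.ortho fun h => hi (h ▸ hj)
    have h2 : (∑ j ∈ s, p j) * p i = 0 := by
      rw [Finset.sum_mul]
      exact Finset.sum_eq_zero fun j hj => hp.ortho fun h => hi (h ▸ hj)
    rw [Finset.sum_insert (f := fun i => cls (M.image (hg i))) hi, ← ih]
    exact cls_image_add hM _ _ _ (Finset.sum_insert hi) (hp.idem i).eq
      (hp.isIdempotentElem_sum (s := s)).eq h1 h2

end ClassOfImage

/-! ### Tensor products of graded maps -/

namespace GrMod

section TensorHom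

variable {R : Type u} [CommRing R] {U U' X X' : Type u} [AddCommGroup U] [Module R U]
  [AddCommGroup U'] [Module R U'] [AddCommGroup X] [Module R X] [AddCommGroup X'] [Module R X']
  {Q : QuadraticForm R U} {Q' : QuadraticForm R U'} {P : QuadraticForm R X}
  {P' : QuadraticForm R X'} {M : GrMod Q} {N : GrMod Q'} {M' : GrMod P} {N' : GrMod P'}

/-- The tensor product of two linear maps of degree zero. -/
def tensorHom (f : M.carrier →ₗ[R] M'.carrier) (g : N.carrier →ₗ[R] N'.carrier) :
    (M.tensor N).carrier →ₗ[R] (M'.tensor N').carrier := TensorProduct.map f g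

theorem tensorHom_tmk (f : M.carrier →ₗ[R] M'.carrier) (g : N.carrier →ₗ[R] N'.carrier)
    (m : M.carrier) (n : N.carrier) :
    tensorHom f g (M.tmk N m n) = M'.tmk N' (f m) (g n) := rfl

/-- The tensor product of two linear equivalences. -/
def tensorCongr (f : M.carrier ≃ₗ[R] M'.carrier) (g : N.carrier ≃ₗ[R] N'.carrier) :
    (M.tensor N).carrier ≃ₗ[R] (M'.tensor N').carrier := TensorProduct.congr f g

theorem tensorCongr_tmk (f : M.carrier ≃ₗ[R] M'.carrier) (g : N.carrier ≃ₗ[R] N'.carrier)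
    (m : M.carrier) (n : N.carrier) :
    tensorCongr f g (M.tmk N m n) = M'.tmk N' (f m) (g n) := rfl

theorem tensorHom_mul (f f' : Module.End R M.carrier) (g g' : Module.End R N.carrier) :
    (tensorHom f g * tensorHom f' g' : Module.End R (M.tensor N).carrier) =
      tensorHom (f * f') (g * g') :=
  tensor_hom_ext fun _ _ => rfl

theorem tensorHom_smul (r s : R) (f : Module.End R M.carrier) (g : Module.End R N.carrier) :
    (tensorHom (r • f) (s • g) : Module.End R (M.tensor N).carrier) =
      (r * s) • tensorHom f g :=
  tensor_hom_ext fun m n => by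
    rw [tensorHom_tmk, LinearMap.smul_apply, LinearMap.smul_apply, LinearMap.smul_apply,
      tensorHom_tmk, map_smul, map_smul, LinearMap.smul_apply, smul_smul, mul_comm]

theorem IsGrEnd.tensorHom {f : Module.End R M.carrier} {g : Module.End R N.carrier}
    (hf : M.IsGrEnd f) (hg : N.IsGrEnd g) : (M.tensor N).IsGrEnd (tensorHom f g) where
  map_c x m := by
    refine LinearMap.congr_fun (f := GrMod.tensorHom f g ∘ₗ (M.tensor N).c x)
      (g := (M.tensor N).c x ∘ₗ GrMod.tensorHom f g) (tensor_hom_ext fun m n => ?_) m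
    simp only [LinearMap.comp_apply, tensor_c_tmk, tensorHom_tmk, map_add, hf.map_c, hf.map_ε,
      hg.map_c]
  map_ε m := by
    refine LinearMap.congr_fun (f := GrMod.tensorHom f g ∘ₗ (M.tensor N).ε)
      (g := (M.tensor N).ε ∘ₗ GrMod.tensorHom f g) (tensor_hom_ext fun m n => ?_) m
    simp only [LinearMap.comp_apply, tensor_ε_tmk, tensorHom_tmk, hf.map_ε, hg.map_ε]

theorem completeOrthogonalIdempotents_tensorHom {ι ι' : Type*} [Fintype ι] [Fintype ι']
    {e : ι → Module.End R M.carrier} {e' : ι' → Module.End R N.carrier}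
    (he : CompleteOrthogonalIdempotents e) (he' : CompleteOrthogonalIdempotents e') :
    CompleteOrthogonalIdempotents fun x : ι × ι' =>
      (tensorHom (e x.1) (e' x.2) : Module.End R (M.tensor N).carrier) where
  idem x := by
    rw [IsIdempotentElem, tensorHom_mul, (he.idem x.1).eq, (he'.idem x.2).eq]
  ortho x y hxy := by
    have h0 : e x.1 * e y.1 = 0 ∨ e' x.2 * e' y.2 = 0 := by
      by_cases h : x.1 = y.1
      · exact Or.inr (he'.ortho fun h' => hxy (Prod.ext h h'))
      · exact Or.inl (he.ortho h)
    change tensorHom (e x.1) (e' x.2) * tensorHom (e y.1) (e' y.2) = 0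
    rw [tensorHom_mul]
    refine tensor_hom_ext fun m n => ?_
    rw [tensorHom_tmk]
    rcases h0 with h | h <;> rw [h] <;> simp
  complete := by
    refine tensor_hom_ext fun m n => ?_
    have h1 := LinearMap.congr_fun he.complete m
    have h2 := LinearMap.congr_fun he'.complete n
    rw [LinearMap.sum_apply, Module.End.one_apply] at h1 h2
    rw [LinearMap.sum_apply, Module.End.one_apply, Fintype.sum_prod_type]
    simp only [tensorHom_tmk, ← map_sum, h2]
    rw [← LinearMap.sum_apply, ← map_sum, h1]

theorem tensor_act_inl_mul_inr [Invertible (2 : R)] (a : CliffordAlgebra Q)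
    {b : CliffordAlgebra Q'} (hb : CliffordAlgebra.involute b = b) :
    (M.tensor N).act (CliffordAlgebra.map (QuadraticMap.Isometry.inl Q Q') a *
      CliffordAlgebra.map (QuadraticMap.Isometry.inr Q Q') b) =
        tensorHom (M.act a) (N.act b) :=
  tensor_hom_ext fun m n => by
    rw [map_mul, Module.End.mul_apply, tensor_act_inr_even _ _ _ hb, tensor_act_inl, tensorHom_tmk]

/-- The image of `p ⊗ q` is the tensor product of the images of `p` and `q`. -/
theorem cls_image_tensorHom [Invertible (2 : R)] (hM : M.IsFGProj) (hN : N.IsFGProj)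
    {p : Module.End R M.carrier} {q : Module.End R N.carrier} (hp : M.IsGrEnd p) (hq : N.IsGrEnd q)
    (hpp : p * p = p) (hqq : q * q = q) :
    cls ((M.tensor N).image (hp.tensorHom hq)) =
      GrK.mul Q Q' (cls (M.image hp)) (cls (N.image hq)) := by
  have hpq := hp.tensorHom hq
  have hpq2 : (tensorHom p q * tensorHom p q : Module.End R (M.tensor N).carrier) =
      tensorHom p q := by
    rw [tensorHom_mul, hpp, hqq]
  rw [GrK.mul_cls (hM.image hp hpp) (hN.image hq hqq)]
  have hi : ∀ z, imageIncl hpq (imageProj hpq (tensorHom (imageIncl hp) (imageIncl hq) z)) =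
      tensorHom (imageIncl hp) (imageIncl hq) z := by
    intro z
    refine LinearMap.congr_fun (f := tensorHom p q ∘ₗ tensorHom (imageIncl hp) (imageIncl hq))
      (g := tensorHom (imageIncl hp) (imageIncl hq)) (tensor_hom_ext fun m n => ?_) z
    obtain ⟨m, rfl⟩ := imageProj_surjective hp m
    obtain ⟨n, rfl⟩ := imageProj_surjective hq n
    rw [LinearMap.comp_apply, tensorHom_tmk, tensorHom_tmk, imageIncl_proj, imageIncl_proj,
      ← Module.End.mul_apply, ← Module.End.mul_apply, hpp, hqq]
  have hj : ∀ z, tensorHom (imageIncl hp) (imageIncl hq)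
      (tensorHom (imageProj hp) (imageProj hq) z) = tensorHom p q z := by
    intro z
    exact LinearMap.congr_fun (f := tensorHom (imageIncl hp) (imageIncl hq) ∘ₗ
      tensorHom (imageProj hp) (imageProj hq)) (g := tensorHom p q)
      (tensor_hom_ext fun m n => rfl) z
  have hk : ∀ z, tensorHom (imageProj hp) (imageProj hq)
      (tensorHom (imageIncl hp) (imageIncl hq) z) = z := by
    intro z
    refine LinearMap.congr_fun (f := tensorHom (imageProj hp) (imageProj hq) ∘ₗ
      tensorHom (imageIncl hp) (imageIncl hq)) (g := LinearMap.id) (tensor_hom_ext fun m n => ?_) z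
    rw [LinearMap.comp_apply, tensorHom_tmk, tensorHom_tmk, imageProj_incl hp hpp,
      imageProj_incl hq hqq, LinearMap.id_apply]
  refine cls_congr ((hM.image hp hpp).tensor (hN.image hq hqq)) (LinearEquiv.ofLinearMap
    (tensorHom (imageProj hp) (imageProj hq) ∘ₗ imageIncl hpq)
    (imageProj hpq ∘ₗ tensorHom (imageIncl hp) (imageIncl hq)) ?_ ?_) ?_ ?_
  · refine LinearMap.ext fun z => ?_
    rw [LinearMap.comp_apply, LinearMap.comp_apply, LinearMap.comp_apply, hi, hk,
      LinearMap.id_apply]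
  · refine LinearMap.ext fun z => ?_
    have hz : tensorHom p q (imageIncl hpq z) = imageIncl hpq z :=
      congrArg (imageIncl hpq) (imageProj_incl hpq hpq2 z)
    rw [LinearMap.comp_apply, LinearMap.comp_apply, LinearMap.comp_apply, hj, hz,
      LinearMap.id_apply]
    exact imageProj_incl hpq hpq2 z
  · intro x m
    refine LinearMap.congr_fun (f := tensorHom (imageProj hp) (imageProj hq) ∘ₗ (M.tensor N).c x)
      (g := ((M.image hp).tensor (N.image hq)).c x ∘ₗ tensorHom (imageProj hp) (imageProj hq))
      (tensor_hom_ext fun m n => ?_) (imageIncl hpq m)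
    simp only [LinearMap.comp_apply, tensor_c_tmk, tensorHom_tmk, map_add, imageProj_c, imageProj_ε]
  · intro m
    refine LinearMap.congr_fun (f := tensorHom (imageProj hp) (imageProj hq) ∘ₗ (M.tensor N).ε)
      (g := ((M.image hp).tensor (N.image hq)).ε ∘ₗ tensorHom (imageProj hp) (imageProj hq))
      (tensor_hom_ext fun m n => ?_) (imageIncl hpq m)
    simp only [LinearMap.comp_apply, tensor_ε_tmk, tensorHom_tmk, imageProj_ε]

/-- The class of a graded submodule, transported by an isomorphism over an isometry. -/
theorem cls_restrict_eq_pull (g : Q.IsometryEquiv P) (F : M.carrier ≃ₗ[R] M'.carrier)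
    (hc : ∀ x m, F (M.c x m) = M'.c (g x) (F m)) (hε : ∀ m, F (M.ε m) = M'.ε (F m))
    {S : Submodule R M.carrier} {S' : Submodule R M'.carrier} (hS1 hS2 hS1' hS2')
    (hS : ∀ m, m ∈ S ↔ F m ∈ S') (hM : (M'.restrict S' hS1' hS2').IsFGProj) :
    cls (M.restrict S hS1 hS2) = GrK.pull g (cls (M'.restrict S' hS1' hS2')) := by
  rw [GrK.pull, GrK.lift_cls _ _ _ hM]
  refine cls_congr (hM.pullback g) (LinearEquiv.ofSubmodules F S S' ?_) ?_ ?_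
  · ext m
    rw [Submodule.mem_map]
    constructor
    · rintro ⟨n, hn, rfl⟩
      exact (hS n).1 hn
    · intro hm
      exact ⟨F.symm m, (hS _).2 (by simpa using hm), by simp⟩
  · intro x m
    exact Subtype.ext (hc x _)
  · intro m
    exact Subtype.ext (hε _)

end TensorHom

section EigenImage

variable {R : Type u} [CommRing R] [Invertible (2 : R)] {V W : Type u} [AddCommGroup V]
  [Module R V] [AddCommGroup W] [Module R W] {p : QuadraticForm R V} {q : QuadraticForm R W} {k : ℕ}

theorem isGrEnd_eigenProj (M : GrMod (p.prod q)) (t : SpinLift k q) (ζ κ : R) (j : Fin k) :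
    (M.power k).IsGrEnd (eigenProj ζ κ (M.untwisted t) j) where
  map_c x m := (LinearMap.congr_fun
    (eigenProj_commute (ζ := ζ) (κ := κ) (M.untwisted_mul_c t x).symm j).eq m).symm
  map_ε m := (LinearMap.congr_fun
    (eigenProj_commute (ζ := ζ) (κ := κ) (M.untwisted_mul_ε t).symm j).eq m).symm

/-- The eigenmodule, as a graded module, is the image of any projection onto the eigenspace. -/
theorem eigen_eq_image (M : GrMod (p.prod q)) (t : SpinLift k q) {r : R}
    {e : Module.End R (M.power k).carrier} (he : (M.power k).IsGrEnd e)
    (h : (M.untwisted t).eigenspace r = LinearMap.range e) :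
    M.eigen t r = (M.power k).image he := by
  have key : ∀ (S S' : Submodule R (M.power k).carrier) (h1 h2 h1' h2'), S = S' →
      (M.power k).restrict S h1 h2 = (M.power k).restrict S' h1' h2' := by
    rintro S S' h1 h2 h1' h2' rfl
    rfl
  exact key _ _ _ _ _ _ h

end EigenImage

end GrMod

/-! ### The power of an orthogonal sum -/

namespace GrMod

section PowerProd

variable {R : Type u} [CommRing R] [Invertible (2 : R)] {V₁ V₂ : Type u} [AddCommGroup V₁]
  [Module R V₁] [AddCommGroup V₂] [Module R V₂] {k : ℕ} {Q₁ : QuadraticForm R V₁}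
  {Q₂ : QuadraticForm R V₂}

/-- The product in `Spin` of liftings for `W₁ ^ k` and `W₂ ^ k` is the lifting for
`(W₁ ⊥ W₂) ^ k`. -/
theorem spinLift_prod (hk : Odd k) (e : ((powForm k (-Q₁)).prod (powForm k (-Q₂))).IsometryEquiv
      (powForm k (-(Q₁.prod Q₂)))) (he : ∀ w i, e w i = (w.1 i, w.2 i))
    (hP : IsSplit (powForm k (-(Q₁.prod Q₂)))) (t₁ : SpinLift k (-Q₁)) (t₂ : SpinLift k (-Q₂))
    (t : SpinLift k (-(Q₁.prod Q₂))) :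
    (t.t : CliffordAlgebra (powForm k (-(Q₁.prod Q₂)))) = CliffordAlgebra.map e.toIsometry
      (CliffordAlgebra.map (QuadraticMap.Isometry.inl _ _) t₁.t *
        CliffordAlgebra.map (QuadraticMap.Isometry.inr _ _) t₂.t) := by
  have h := (t₁.isRotor.prod t₂.isRotor)
  refine hP.rotor_unique hk t.isRotor (h.map e fun u => funext fun i => ?_) t.isSpin.norm ?_
    (congrArg Units.val t.pow_eq_one) ?_
  · rw [he]
    change _ = e u ((finRotate k).symm i)
    rw [he]
    rfl
  · rw [reverse_map, ← map_mul, inl_mul_inr_mul_reverse (r := 1) (r' := 1), mul_one, map_one,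
      map_one]
    · rw [map_one]; exact t₁.isSpin.norm
    · rw [map_one]; exact t₂.isSpin.norm
  · have hc : Commute (CliffordAlgebra.map (QuadraticMap.Isometry.inl (powForm k (-Q₁))
        (powForm k (-Q₂))) t₁.t) (CliffordAlgebra.map (QuadraticMap.Isometry.inr _ _) t₂.t) :=
      CliffordAlgebra.commute_map_mul_map_of_isOrtho_of_mem_evenOdd_zero_left _ _ isOrtho_inl_inr
        _ _ t₁.isSpin.even t₂.isSpin.even
    have h1 : (t₁.t : CliffordAlgebra (powForm k (-Q₁))) ^ k = 1 := congrArg Units.val t₁.pow_eq_one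
    have h2 : (t₂.t : CliffordAlgebra (powForm k (-Q₂))) ^ k = 1 := congrArg Units.val t₂.pow_eq_one
    rw [← map_pow, hc.mul_pow, ← map_pow, ← map_pow, h1, h2, map_one, map_one, mul_one, map_one]

/-- The isometry `W₁ ^ k ⊥ W₂ ^ k ≅ (W₁ ⊥ W₂) ^ k` with `W_i = V_i(-1)`. -/
def negPowProd (k : ℕ) (Q₁ : QuadraticForm R V₁) (Q₂ : QuadraticForm R V₂) :
    ((powForm k (-Q₁)).prod (powForm k (-Q₂))).IsometryEquiv (powForm k (-(Q₁.prod Q₂))) where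
  toFun w := fun i => (w.1 i, w.2 i)
  invFun w := (fun i => (w i).1, fun i => (w i).2)
  map_add' _ _ := rfl
  map_smul' _ _ := rfl
  left_inv _ := rfl
  right_inv _ := rfl
  map_app' x := by simp [Finset.sum_add_distrib]; abel

/-- Regrouping the orthogonal summands carries `t` to the product of `t₁` and `t₂`. -/
theorem map_shuffle_incl (hk : Odd k) (hP : IsSplit (powForm k (-(Q₁.prod Q₂))))
    (t₁ : SpinLift k (-Q₁)) (t₂ : SpinLift k (-Q₂)) (t : SpinLift k (-(Q₁.prod Q₂))) :
    CliffordAlgebra.map (shuffle k Q₁ Q₂).toIsometry (t.incl (Q₁.prod Q₂)) =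
      CliffordAlgebra.map (QuadraticMap.Isometry.inl _ _) (t₁.incl Q₁) *
        CliffordAlgebra.map (QuadraticMap.Isometry.inr _ _) (t₂.incl Q₂) := by
  have h0 : (t.incl (Q₁.prod Q₂) :
      CliffordAlgebra (targetForm k (Q₁.prod Q₂) (-(Q₁.prod Q₂)))) = CliffordAlgebra.map
        (QuadraticMap.Isometry.inr ((k : R) • (Q₁.prod Q₂)) (powForm k (-(Q₁.prod Q₂)))) t.t := rfl
  have h1 : (t₁.incl Q₁ : CliffordAlgebra (targetForm k Q₁ (-Q₁))) = CliffordAlgebra.map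
      (QuadraticMap.Isometry.inr ((k : R) • Q₁) (powForm k (-Q₁))) t₁.t := rfl
  have h2 : (t₂.incl Q₂ : CliffordAlgebra (targetForm k Q₂ (-Q₂))) = CliffordAlgebra.map
      (QuadraticMap.Isometry.inr ((k : R) • Q₂) (powForm k (-Q₂))) t₂.t := rfl
  rw [h0, h1, h2, spinLift_prod hk (negPowProd k Q₁ Q₂) (fun _ _ => rfl) hP t₁ t₂ t, map_mul,
    map_mul, map_mul]
  simp only [← AlgHom.comp_apply, CliffordAlgebra.map_comp_map]
  congr 1

variable (h₁ : IsSplit (powForm k Q₁)) (h₂ : IsSplit (powForm k Q₂))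
  (h₁₂ : IsSplit (powForm k (Q₁.prod Q₂)))

/-- The identification of `C(V₁ ^ k) ⊗ C(V₂ ^ k)` with the `k`-th tensor power of `C(V₁ ⊥ V₂)`. -/
def powerProdAux :
    ((clifford (powForm k Q₁)).tensor (clifford (powForm k Q₂))).carrier ≃ₗ[R]
      ((clifford (Q₁.prod Q₂)).power k).carrier :=
  (cliffordTensor (powForm k Q₁) (powForm k Q₂)).trans <| (toClifford _).symm.trans <|
    (CliffordAlgebra.equivOfIsometry (powProd k Q₁ Q₂).symm).toLinearEquiv.trans <|
      (toClifford _).trans (powerEquiv h₁₂)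

theorem powerProdAux_tmk (a : CliffordAlgebra (powForm k Q₁)) (b : CliffordAlgebra (powForm k Q₂)) :
    powerProdAux h₁₂ (tmk _ _ (toClifford _ a) (toClifford _ b)) = powerEquiv h₁₂ (toClifford _
      (CliffordAlgebra.map (powProd k Q₁ Q₂).symm.toIsometry
        (CliffordAlgebra.map (QuadraticMap.Isometry.inl _ _) a *
          CliffordAlgebra.map (QuadraticMap.Isometry.inr _ _) b))) := rfl

theorem powerProdAux_c (x : (V₁ × V₂) × (Fin k → V₁ × V₂))
    (m : ((clifford (powForm k Q₁)).tensor (clifford (powForm k Q₂))).carrier) :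
    powerProdAux h₁₂ (((clifford (powForm k Q₁)).tensor (clifford (powForm k Q₂))).c
      (diagVec k (shuffle k Q₁ Q₂ x).1, diagVec k (shuffle k Q₁ Q₂ x).2) m) =
        ((clifford (Q₁.prod Q₂)).power k).c x (powerProdAux h₁₂ m) := by
  obtain ⟨m, rfl⟩ := (cliffordTensor (powForm k Q₁) (powForm k Q₂)).symm.surjective m
  obtain ⟨a, rfl⟩ := (toClifford _).surjective m
  let z : ((Fin k → V₁) × (Fin k → V₂)) × ((Fin k → V₁) × (Fin k → V₂)) :=
    ((fun _ => x.1.1, fun _ => x.1.2), (fun i => (x.2 i).1, fun i => (x.2 i).2))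
  have h1 := cliffordTensor_c z ((cliffordTensor (powForm k Q₁) (powForm k Q₂)).symm
    (toClifford _ a))
  have h2 := clifford_congr_c (powProd k Q₁ Q₂).symm z a
  have h3 := powerEquiv_c h₁₂ x (toClifford _
    (CliffordAlgebra.equivOfIsometry (powProd k Q₁ Q₂).symm a))
  rw [LinearEquiv.apply_symm_apply] at h1
  have h4 : powerProdAux h₁₂ ((cliffordTensor (powForm k Q₁) (powForm k Q₂)).symm
      (toClifford _ a)) = powerEquiv h₁₂ (toClifford _
        (CliffordAlgebra.equivOfIsometry (powProd k Q₁ Q₂).symm a)) := by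
    simp [powerProdAux]
  rw [h4, ← h3]
  refine Eq.trans ?_ (congrArg (powerEquiv h₁₂) h2)
  exact congrArg (fun y => powerEquiv h₁₂ (toClifford _
    (CliffordAlgebra.equivOfIsometry (powProd k Q₁ Q₂).symm ((toClifford _).symm y)))) h1

theorem powerProdAux_ε (m : ((clifford (powForm k Q₁)).tensor (clifford (powForm k Q₂))).carrier) :
    powerProdAux h₁₂ (((clifford (powForm k Q₁)).tensor (clifford (powForm k Q₂))).ε m) =
        ((clifford (Q₁.prod Q₂)).power k).ε (powerProdAux h₁₂ m) := by
  refine LinearMap.congr_fun (f := (powerProdAux h₁₂).toLinearMap ∘ₗ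
    ((clifford (powForm k Q₁)).tensor (clifford (powForm k Q₂))).ε)
    (g := ((clifford (Q₁.prod Q₂)).power k).ε ∘ₗ (powerProdAux h₁₂).toLinearMap)
    (tensor_hom_ext fun m n => ?_) m
  obtain ⟨a, rfl⟩ := (toClifford _).surjective m
  obtain ⟨b, rfl⟩ := (toClifford _).surjective n
  simp only [LinearMap.comp_apply, LinearEquiv.coe_coe]
  rw [tensor_ε_tmk, clifford_ε, clifford_ε, powerProdAux_tmk, powerProdAux_tmk, ← powerEquiv_ε,
    clifford_ε, involute_map, map_mul CliffordAlgebra.involute, involute_map, involute_map]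

theorem powerProdAux_shift (hk : 0 < k) (a : CliffordAlgebra (powForm k Q₁))
    (b : CliffordAlgebra (powForm k Q₂)) :
    powerProdAux h₁₂ (tmk _ _
      (toClifford _ (CliffordAlgebra.map (shiftIsometry k Q₁).toIsometry a))
      (toClifford _ (CliffordAlgebra.map (shiftIsometry k Q₂).toIsometry b))) =
    (clifford (Q₁.prod Q₂)).powerCyc k
      (powerProdAux h₁₂ (tmk _ _ (toClifford _ a) (toClifford _ b))) := by
  have h : CliffordAlgebra.map (powProd k Q₁ Q₂).symm.toIsometry
      (CliffordAlgebra.map (QuadraticMap.Isometry.inl _ _)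
        (CliffordAlgebra.map (shiftIsometry k Q₁).toIsometry a) *
      CliffordAlgebra.map (QuadraticMap.Isometry.inr _ _)
        (CliffordAlgebra.map (shiftIsometry k Q₂).toIsometry b)) =
      CliffordAlgebra.map (shiftIsometry k (Q₁.prod Q₂)).toIsometry
        (CliffordAlgebra.map (powProd k Q₁ Q₂).symm.toIsometry
          (CliffordAlgebra.map (QuadraticMap.Isometry.inl _ _) a *
            CliffordAlgebra.map (QuadraticMap.Isometry.inr _ _) b)) := by
    rw [map_mul, map_mul, map_mul]
    simp only [← AlgHom.comp_apply, CliffordAlgebra.map_comp_map]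
    congr 1
  rw [powerProdAux_tmk, powerProdAux_tmk, ← powerEquiv_shift h₁₂ hk, h]

/-- The tensor power of `C(V₁ ⊥ V₂)` is the tensor product of the powers of `C(V₁)` and `C(V₂)`. -/
def powerProd : ((clifford (Q₁.prod Q₂)).power k).carrier ≃ₗ[R]
    (((clifford Q₁).power k).tensor ((clifford Q₂).power k)).carrier :=
  (powerProdAux h₁₂).symm.trans (tensorCongr (powerEquiv h₁) (powerEquiv h₂))

theorem powerProd_aux (m : ((clifford (powForm k Q₁)).tensor (clifford (powForm k Q₂))).carrier) :
    powerProd h₁ h₂ h₁₂ (powerProdAux h₁₂ m) = tensorCongr (powerEquiv h₁) (powerEquiv h₂) m := by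
  simp [powerProd]

theorem powerProd_c (x : (V₁ × V₂) × (Fin k → V₁ × V₂))
    (m : ((clifford (Q₁.prod Q₂)).power k).carrier) :
    powerProd h₁ h₂ h₁₂ (((clifford (Q₁.prod Q₂)).power k).c x m) =
      (((clifford Q₁).power k).tensor ((clifford Q₂).power k)).c (shuffle k Q₁ Q₂ x)
        (powerProd h₁ h₂ h₁₂ m) := by
  obtain ⟨m, rfl⟩ := (powerProdAux h₁₂).surjective m
  rw [← powerProdAux_c, powerProd_aux, powerProd_aux]
  refine LinearMap.congr_fun (f := (tensorCongr (powerEquiv h₁) (powerEquiv h₂)).toLinearMap ∘ₗ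
      ((clifford (powForm k Q₁)).tensor (clifford (powForm k Q₂))).c
        (diagVec k (shuffle k Q₁ Q₂ x).1, diagVec k (shuffle k Q₁ Q₂ x).2))
    (g := (((clifford Q₁).power k).tensor ((clifford Q₂).power k)).c (shuffle k Q₁ Q₂ x) ∘ₗ
      (tensorCongr (powerEquiv h₁) (powerEquiv h₂)).toLinearMap) (tensor_hom_ext fun m n => ?_) m
  simp only [LinearMap.comp_apply, LinearEquiv.coe_coe, tensor_c_tmk, map_add, tensorCongr_tmk,
    powerEquiv_c, powerEquiv_ε]

theorem powerProd_ε (m : ((clifford (Q₁.prod Q₂)).power k).carrier) :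
    powerProd h₁ h₂ h₁₂ (((clifford (Q₁.prod Q₂)).power k).ε m) =
      (((clifford Q₁).power k).tensor ((clifford Q₂).power k)).ε (powerProd h₁ h₂ h₁₂ m) := by
  obtain ⟨m, rfl⟩ := (powerProdAux h₁₂).surjective m
  rw [← powerProdAux_ε, powerProd_aux, powerProd_aux]
  refine LinearMap.congr_fun (f := (tensorCongr (powerEquiv h₁) (powerEquiv h₂)).toLinearMap ∘ₗ
      ((clifford (powForm k Q₁)).tensor (clifford (powForm k Q₂))).ε)
    (g := (((clifford Q₁).power k).tensor ((clifford Q₂).power k)).ε ∘ₗ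
      (tensorCongr (powerEquiv h₁) (powerEquiv h₂)).toLinearMap) (tensor_hom_ext fun m n => ?_) m
  simp only [LinearMap.comp_apply, LinearEquiv.coe_coe, tensor_ε_tmk, tensorCongr_tmk, powerEquiv_ε]

theorem powerProd_cyc (hk : 0 < k) (m : ((clifford (Q₁.prod Q₂)).power k).carrier) :
    powerProd h₁ h₂ h₁₂ ((clifford (Q₁.prod Q₂)).powerCyc k m) =
      tensorHom ((clifford Q₁).powerCyc k) ((clifford Q₂).powerCyc k) (powerProd h₁ h₂ h₁₂ m) := by
  obtain ⟨m, rfl⟩ := (powerProdAux h₁₂).surjective m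
  refine LinearMap.congr_fun (f := (powerProd h₁ h₂ h₁₂).toLinearMap ∘ₗ
      (clifford (Q₁.prod Q₂)).powerCyc k ∘ₗ (powerProdAux h₁₂).toLinearMap)
    (g := tensorHom ((clifford Q₁).powerCyc k) ((clifford Q₂).powerCyc k) ∘ₗ
      (powerProd h₁ h₂ h₁₂).toLinearMap ∘ₗ (powerProdAux h₁₂).toLinearMap)
    (tensor_hom_ext fun m n => ?_) m
  obtain ⟨a, rfl⟩ := (toClifford _).surjective m
  obtain ⟨b, rfl⟩ := (toClifford _).surjective n
  simp only [LinearMap.comp_apply, LinearEquiv.coe_coe]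
  rw [← powerProdAux_shift h₁₂ hk, powerProd_aux, powerProd_aux, tensorCongr_tmk, tensorCongr_tmk,
    tensorHom_tmk, powerEquiv_shift h₁ hk, powerEquiv_shift h₂ hk]

/-- The untwisted action on the power of `C(V₁ ⊥ V₂)` is the tensor product of the untwisted
actions, as the cyclic permutations and the liftings to the spin groups are compatible. -/
theorem powerProd_untwisted (hk : Odd k) (hP : IsSplit (powForm k (-(Q₁.prod Q₂))))
    (t₁ : SpinLift k (-Q₁)) (t₂ : SpinLift k (-Q₂)) (t : SpinLift k (-(Q₁.prod Q₂)))
    (m : ((clifford (Q₁.prod Q₂)).power k).carrier) :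
    powerProd h₁ h₂ h₁₂ ((clifford (Q₁.prod Q₂)).untwisted t m) =
      tensorHom ((clifford Q₁).untwisted t₁) ((clifford Q₂).untwisted t₂)
        (powerProd h₁ h₂ h₁₂ m) := by
  have h2 : CliffordAlgebra.involute (t₂.incl Q₂ : CliffordAlgebra (targetForm k Q₂ (-Q₂))) =
      t₂.incl Q₂ := involute_map_of_even _ t₂.isSpin.even
  have hact := tensor_act_inl_mul_inr (M := (clifford Q₁).power k) (N := (clifford Q₂).power k)
    (t₁.incl Q₁ : CliffordAlgebra (targetForm k Q₁ (-Q₁))) h2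
  rw [← map_shuffle_incl hk hP t₁ t₂ t] at hact
  have hinj : Function.Injective ((((clifford Q₁).power k).tensor ((clifford Q₂).power k)).act
      (CliffordAlgebra.map (shuffle k Q₁ Q₂).toIsometry (t.incl (Q₁.prod Q₂)))) := by
    refine Function.LeftInverse.injective (g :=
      (((clifford Q₁).power k).tensor ((clifford Q₂).power k)).act
      (CliffordAlgebra.map (shuffle k Q₁ Q₂).toIsometry (↑(t.incl (Q₁.prod Q₂))⁻¹))) fun z => ?_
    rw [← Module.End.mul_apply, ← map_mul, ← map_mul, Units.inv_mul, map_one, map_one,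
      Module.End.one_apply]
  apply hinj
  have h3 := hom_act _ _ (shuffle k Q₁ Q₂).toIsometry (powerProd h₁ h₂ h₁₂).toLinearMap
    (powerProd_c h₁ h₂ h₁₂) (t.incl (Q₁.prod Q₂)) ((clifford (Q₁.prod Q₂)).untwisted t m)
  rw [← Module.End.mul_apply (R := R) (M := ((clifford (Q₁.prod Q₂)).power k).carrier),
    act_incl_mul_untwisted] at h3
  have h4 := powerProd_cyc h₁ h₂ h₁₂ hk.pos m
  refine h3.symm.trans (h4.trans ?_)
  rw [hact, ← Module.End.mul_apply, tensorHom_mul, act_incl_mul_untwisted, act_incl_mul_untwisted]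

end PowerProd
end GrMod

/-! ### Multiplicativity of the Bott class -/

open GrMod

section Eigenmodules

variable {R : Type u} [CommRing R] [Invertible (2 : R)] {V : Type u} [AddCommGroup V] [Module R V]
  {k : ℕ} {Q : QuadraticForm R V} {ζ : R}

theorem untwisted_clifford_pow (hk : 0 < k) (hQ : IsSplit (powForm k Q)) (t : SpinLift k (-Q)) :
    (clifford Q).untwisted t ^ k = 1 :=
  untwisted_pow _ t (powerCyc_pow hk hQ)

theorem eigen_clifford_eq_image (hk : 0 < k) (hQ : IsSplit (powForm k Q))
    (hζ : (Polynomial.cyclotomic k R).IsRoot ζ) {κ : R} (hκ : κ * k = 1) (t : SpinLift k (-Q))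
    (j : Fin k) : (clifford Q).eigen t (ζ ^ (j : ℕ)) =
      ((clifford Q).power k).image (isGrEnd_eigenProj (clifford Q) t ζ κ j) :=
  eigen_eq_image _ _ _
    (eigenspace_eq_range_eigenProj hζ hk hκ (untwisted_clifford_pow hk hQ t) j)

theorem isFGProj_eigen (hk : 0 < k) (hQ : IsSplit (powForm k Q))
    (hζ : (Polynomial.cyclotomic k R).IsRoot ζ) (hkR : IsUnit (k : R)) (t : SpinLift k (-Q))
    (j : Fin k) : ((clifford Q).eigen t (ζ ^ (j : ℕ))).IsFGProj := by
  obtain ⟨κ, hκ⟩ := hkR.exists_left_inv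
  rw [eigen_clifford_eq_image hk hQ hζ hκ]
  exact (isFGProj_power hQ hkR).image _ ((completeOrthogonalIdempotents_eigenProj hζ hk hκ
    (untwisted_clifford_pow hk hQ t)).idem j).eq

end Eigenmodules

section Multiplicativity

theorem GrKOmega.pull_tmul {R : Type u} [CommRing R] {k : ℕ} {U U' : Type u} [AddCommGroup U]
    [Module R U] [AddCommGroup U'] [Module R U']
    {P : QuadraticForm R U} {P' : QuadraticForm R U'} (e : P.IsometryEquiv P') (x : GrK P')
    (a : Omega k) : GrKOmega.pull k e (x ⊗ₜ a) = GrK.pull e x ⊗ₜ a := rfl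

variable {R : Type u} [CommRing R] [Invertible (2 : R)] {V₁ V₂ : Type u} [AddCommGroup V₁]
  [Module R V₁] [AddCommGroup V₂] [Module R V₂] {k : ℕ} {Q₁ : QuadraticForm R V₁}
  {Q₂ : QuadraticForm R V₂} {ζ : R}

/-- The sum of two residues. -/
def addMod (hk : 0 < k) (x : Fin k × Fin k) : Fin k := ⟨((x.1 : ℕ) + x.2) % k, Nat.mod_lt _ hk⟩

/-- The eigenmodule of `T₁' ⊗ T₂'` for `ζ ^ j` is the sum of the tensor products of the eigenmodules
for `ζ ^ a` and `ζ ^ b` with `a + b ≡ j`. -/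
theorem cls_eigen_prod (hk : Odd k) (hkR : IsUnit (k : R))
    (hζ : (Polynomial.cyclotomic k R).IsRoot ζ)
    (h₁ : IsSplit (powForm k Q₁)) (h₂ : IsSplit (powForm k Q₂))
    (h₁₂ : IsSplit (powForm k (Q₁.prod Q₂))) (hP : IsSplit (powForm k (-(Q₁.prod Q₂))))
    (t₁ : SpinLift k (-Q₁)) (t₂ : SpinLift k (-Q₂)) (t : SpinLift k (-(Q₁.prod Q₂))) (j : Fin k) :
    cls ((clifford (Q₁.prod Q₂)).eigen t (ζ ^ (j : ℕ))) =
      ∑ x ∈ Finset.univ.filter (fun x => addMod hk.pos x = j),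
        GrK.pull (shuffle k Q₁ Q₂) (GrK.mul _ _
          (cls ((clifford Q₁).eigen t₁ (ζ ^ (x.1 : ℕ))))
          (cls ((clifford Q₂).eigen t₂ (ζ ^ (x.2 : ℕ))))) := by
  have hk0 := hk.pos
  have hζ1 := root_pow_eq_one hk0 hζ
  obtain ⟨κ, hκ⟩ := hkR.exists_left_inv
  have hT₁ := untwisted_clifford_pow hk0 h₁ t₁
  have hT₂ := untwisted_clifford_pow hk0 h₂ t₂
  have he₁ := completeOrthogonalIdempotents_eigenProj hζ hk0 hκ hT₁
  have he₂ := completeOrthogonalIdempotents_eigenProj hζ hk0 hκ hT₂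
  have hg₁ := isGrEnd_eigenProj (clifford Q₁) t₁ ζ κ
  have hg₂ := isGrEnd_eigenProj (clifford Q₂) t₂ ζ κ
  have hM₁ := isFGProj_power h₁ hkR
  have hM₂ := isFGProj_power h₂ hkR
  have he := completeOrthogonalIdempotents_tensorHom he₁ he₂
  have hg := fun x : Fin k × Fin k => (hg₁ x.1).tensorHom (hg₂ x.2)
  have hspec := eigenspace_eq_range_sum (ζ := ζ) (addMod hk0) _ he
    (T := tensorHom ((clifford Q₁).untwisted t₁) ((clifford Q₂).untwisted t₂))
    (fun x => by
      rw [tensorHom_mul, mul_eigenProj hζ1 hT₁, mul_eigenProj hζ1 hT₂, tensorHom_smul, ← pow_add,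
        pow_eq_pow_mod _ hζ1]
      rfl)
    (fun i j hij => isUnit_root_pow_sub hk0 hkR hζ hij) j
  have hmul : ∀ x : Fin k × Fin k, cls ((((clifford Q₁).power k).tensor
      ((clifford Q₂).power k)).image (hg x)) = GrK.mul _ _
        (cls ((clifford Q₁).eigen t₁ (ζ ^ (x.1 : ℕ))))
        (cls ((clifford Q₂).eigen t₂ (ζ ^ (x.2 : ℕ)))) := fun x => by
    rw [eigen_clifford_eq_image hk0 h₁ hζ hκ, eigen_clifford_eq_image hk0 h₂ hζ hκ]
    exact cls_image_tensorHom hM₁ hM₂ _ _ (he₁.idem _).eq (he₂.idem _).eq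
  simp only [← hmul]
  rw [← map_sum, ← cls_image_sum (hM₁.tensor hM₂) he.toOrthogonalIdempotents hg]
  refine cls_restrict_eq_pull (shuffle k Q₁ Q₂) (powerProd h₁ h₂ h₁₂) (powerProd_c h₁ h₂ h₁₂)
    (powerProd_ε h₁ h₂ h₁₂) _ _ _ _ (fun m => ?_) ((hM₁.tensor hM₂).image
      (IsGrEnd.sum _ hg) (he.toOrthogonalIdempotents.isIdempotentElem_sum).eq)
  rw [← hspec, Module.End.mem_eigenspace_iff, Module.End.mem_eigenspace_iff,
    ← powerProd_untwisted h₁ h₂ h₁₂ hk hP t₁ t₂ t, ← map_smul,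
    (powerProd h₁ h₂ h₁₂).injective.eq_iff]

/-- The product of the classes is a sum over pairs of exponents; it is collected by their sum modulo
`k`, which is the exponent of `ω` since `ω ^ k = 1`. -/
theorem bottClass_prod (hk : Odd k) (hkR : IsUnit (k : R))
    (hζ : (Polynomial.cyclotomic k R).IsRoot ζ)
    (h₁ : IsSplit (powForm k Q₁)) (h₂ : IsSplit (powForm k Q₂))
    (h₁₂ : IsSplit (powForm k (Q₁.prod Q₂))) (hP : IsSplit (powForm k (-(Q₁.prod Q₂))))
    (t₁ : SpinLift k (-Q₁)) (t₂ : SpinLift k (-Q₂)) (t : SpinLift k (-(Q₁.prod Q₂))) :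
    bottClass ζ (Q₁.prod Q₂) t = GrKOmega.pull k (shuffle k Q₁ Q₂)
      (GrKOmega.mul k _ _ (bottClass ζ Q₁ t₁) (bottClass ζ Q₂ t₂)) := by
  have hω := (omega_isPrimitiveRoot hk.pos).pow_eq_one
  simp only [bottClass, twistedOp, map_sum, LinearMap.sum_apply, GrKOmega.mul_tmul,
    GrKOmega.pull_tmul]
  set ω := AdjoinRoot.root (Polynomial.cyclotomic k ℤ)
  simp only [cls_eigen_prod hk hkR hζ h₁ h₂ h₁₂ hP t₁ t₂ t, TensorProduct.sum_tmul]
  rw [Finset.sum_comm, ← Fintype.sum_prod_type']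
  rw [← Finset.sum_fiberwise Finset.univ (addMod hk.pos)]
  refine Finset.sum_congr rfl fun j _ => Finset.sum_congr rfl fun x hx => ?_
  rw [← (Finset.mem_filter.1 hx).2, ← pow_add, pow_eq_pow_mod (_ + _) hω]
  rfl

end Multiplicativity

end CliffordBott

end

theorem theorem7p1 {R : Type u} [CommRing R] [Invertible (2 : R)] (k : ℕ) (hk : Odd k)
    (hkR : IsUnit (k : R)) (ζ : R) (hζ : (Polynomial.cyclotomic k R).IsRoot ζ) :
    (∀ (V : Type u) [AddCommGroup V] [Module R V] [Module.Finite R V] [Module.Projective R V]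
        (Q : QuadraticForm R V), Function.Bijective Q.polarBilin →
      Function.Bijective (CliffordBott.GrMod.clifford Q).act ∧
      (CliffordBott.GrMod.clifford Q).IsFGProj ∧
      Nonempty (Unique (CliffordBott.SpinLift k (-Q))) ∧
      ∀ t : CliffordBott.SpinLift k (-Q),
        (CliffordBott.GrMod.clifford Q).untwisted t ^ k = 1 ∧
        DirectSum.IsInternal
          (fun j : Fin k => ((CliffordBott.GrMod.clifford Q).untwisted t).eigenspace
            (ζ ^ (j : ℕ))) ∧
        ∀ j : Fin k, ((CliffordBott.GrMod.clifford Q).eigen t (ζ ^ (j : ℕ))).IsFGProj) ∧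
    (∀ (V₁ V₂ : Type u) [AddCommGroup V₁] [Module R V₁] [Module.Finite R V₁]
        [Module.Projective R V₁] [AddCommGroup V₂] [Module R V₂] [Module.Finite R V₂]
        [Module.Projective R V₂] (Q₁ : QuadraticForm R V₁) (Q₂ : QuadraticForm R V₂),
      Function.Bijective Q₁.polarBilin → Function.Bijective Q₂.polarBilin →
      ∀ (t₁ : CliffordBott.SpinLift k (-Q₁)) (t₂ : CliffordBott.SpinLift k (-Q₂))
        (t : CliffordBott.SpinLift k (-(Q₁.prod Q₂))),
        CliffordBott.bottClass ζ (Q₁.prod Q₂) t =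
          CliffordBott.GrKOmega.pull k (CliffordBott.shuffle k Q₁ Q₂)
            (CliffordBott.GrKOmega.mul k _ _ (CliffordBott.bottClass ζ Q₁ t₁)
              (CliffordBott.bottClass ζ Q₂ t₂))) := by
  refine ⟨fun V _ _ _ _ Q hQ => ?_, fun V₁ V₂ _ _ _ _ _ _ _ _ Q₁ Q₂ hQ₁ hQ₂ t₁ t₂ t => ?_⟩
  · have hs := CliffordBott.IsSplit.of_nondegenerate Q hQ
    refine ⟨hs.bijective, hs.isFGProj, CliffordBott.SpinLift.nonempty_unique hk
      (CliffordBott.bijective_polarBilin_neg hQ), fun t => ?_⟩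
    have hT := CliffordBott.untwisted_clifford_pow hk.pos (hs.pow k) t
    exact ⟨hT, CliffordBott.isInternal_eigenspace hζ hk.pos hkR hT,
      CliffordBott.isFGProj_eigen hk.pos (hs.pow k) hζ hkR t⟩
  · have h₁ := (CliffordBott.IsSplit.of_nondegenerate Q₁ hQ₁).pow k
    have h₂ := (CliffordBott.IsSplit.of_nondegenerate Q₂ hQ₂).pow k
    have h₁' := (CliffordBott.IsSplit.of_nondegenerate (-Q₁)
      (CliffordBott.bijective_polarBilin_neg hQ₁)).pow k
    have h₂' := (CliffordBott.IsSplit.of_nondegenerate (-Q₂)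
      (CliffordBott.bijective_polarBilin_neg hQ₂)).pow k
    exact CliffordBott.bottClass_prod hk hkR hζ h₁ h₂
      ((h₁.prod h₂).of_isometryEquiv (CliffordBott.powProd k Q₁ Q₂).symm)
      ((h₁'.prod h₂').of_isometryEquiv (CliffordBott.GrMod.negPowProd k Q₁ Q₂)) t₁ t₂ t
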